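/- Let $\mathcal H=\ell^2(\mathbb N)$ be the one-mode Fock space with number states $|n\rangle$, let $\hat a,\hat a^\dagger$ be the ladder operators, $\hat a|n\rangle=\sqrt n\,|n-1\rangle$, $\hat a^\dagger|n\rangle=\sqrt{n+1}\,|n+1\rangle$, and let $\hat b,\hat b^\dagger$ be those of a second mode. Let $|\alpha\rangle=e^{-|\alpha|^2/2}\sum_n\frac{\alpha^n}{\sqrt{n!}}|n\rangle$ $(\alpha\in\mathbb C)$ be the coherent states, let $\hat D(\beta)=\exp(\beta\hat a^\dagger-\beta^*\hat a)$, and let $d^2\alpha=d\,\mathrm{Re}\,\alpha\;d\,\mathrm{Im}\,\alpha$. Exponentials of these skew-symmetric operators are unitaries in the sense of Stone's theorem. For a bounded operator $\hat X$ on $\mathcal H$ define the quantum-limited amplifier and attenuator $$\mathcal A_\kappa(\hat X)=\mathrm{Tr}_2\big[\hat S(\hat X\otimes|0\rangle\langle 0|)\hat S^\dagger\big],\quad \hat S=\exp\big[\mathrm{arcosh}\sqrt\kappa\,(\hat a^\dagger\hat b^\dagger-\hat a\hat b)\big]\quad(\kappa\ge1),$$ $$\mathcal E_\lambda(\hat X)=\mathrm{Tr}_2\big[\hat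 B(\hat X\otimes|0\rangle\langle 0|)\hat B^\dagger\big],\quad \hat B=\exp\big[\arccos\sqrt\lambda\,(\hat a^\dagger\hat b-\hat a\hat b^\dagger)\big]\quad(0\le\lambda\le1),$$ where $\mathrm{Tr}_2\hat Y=\sum_n(1\otimes\langle n|)\,\hat Y\,(1\otimes|n\rangle)$ converges weakly, and put $\mathcal C=\mathcal E_{1/2}\circ\mathcal A_2$. The quasiprobability distributions of $\hat X$ are given by $$\hat X=\int\frac{d^2\alpha}{\pi}P_{\hat X}(\alpha)|\alpha\rangle\langle\alpha|,\qquad W_{\hat X}(\alpha)=\int\frac{d^2\beta}{\pi}\mathrm{Tr}[\hat X\hat D(\beta)]\,e^{\alpha\beta^*-\alpha^*\beta},\qquad Q_{\hat X}(\alpha)=\langle\alpha|\hat X|\alpha\rangle .$$ Here $P$ and $W$ are in general tempered distributions on $\mathbb C$: the first equation means $\langle m|\hat X|n\rangle=\frac1\pi\,P_{\hat X}\big[\alpha\mapsto\langle m|\alpha\rangle\langle\alpha|n\rangle\big]$ for all $m,n\in\mathbb N$, and the second means $W_{\hat X}[f]=\sum_n\int\frac{d^2\beta}{\pi}\langle n|\hat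 X\hat D(\beta)|n\rangle\int d^2\alpha\,f(\alpha)e^{\alpha\beta^*-\alpha^*\beta}$ for every Schwartz function $f$. Then for every bounded operator $\hat X$ on $\mathcal H$ the Wigner distribution $W_{\hat X}$ exists as a tempered distribution, $\mathcal C(\hat X)$ and $\mathcal C^2(\hat X)$ each have exactly one tempered P distribution, and $$P_{\mathcal C(\hat X)}=W_{\hat X},\qquad W_{\mathcal C(\hat X)}=Q_{\hat X},\qquad P_{\mathcal C^2(\hat X)}=Q_{\hat X}$$ as tempered distributions. Moreover: (i) $\langle\varphi|\mathcal C^2(\hat X)|\psi\rangle=\int\frac{d^2\alpha}{\pi}\,Q_{\hat X}(\alpha)\langle\varphi|\alpha\rangle\langle\alpha|\psi\rangle$, with an absolutely convergent integral, for all $\varphi,\psi\in\mathcal H$. (ii) If $\hat X$ is trace class, then $W_{\mathcal C(\hat X)}(\alpha)=Q_{\hat X}(\alpha)$ for every $\alpha\in\mathbb C$, the trace and the integral defining the left-hand side being absolutely convergent. (iii) If $\hat X$ is trace class and $\beta\mapsto\mathrm{Tr}[\hat X\hat D(\beta)]$ is integrable, so that $W_{\hat X}(\alpha)$ is given for every $\alpha$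 by an absolutely convergent integral, then $\langle\varphi|\mathcal C(\hat X)|\psi\rangle=\int\frac{d^2\alpha}{\pi}\,W_{\hat X}(\alpha)\langle\varphi|\alpha\rangle\langle\alpha|\psi\rangle$, with an absolutely convergent integral, for all $\varphi,\psi\in\mathcal H$. -/

import Mathlib

open scoped SchwartzMap ComplexConjugate InnerProductSpace
open MeasureTheory

noncomputable section

namespace QuantumOptics

/-- The Hilbert space `ℓ²(ι)` with its standard orthonormal basis indexed by `ι`. -/
abbrev Ell2 (ι : Type) : Type := lp (fun _ : ι => ℂ) 2

/-- One-mode Fock space; the standard basis vector of index `n` is the number state `|n⟩`. -/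
abbrev Fock : Type := Ell2 ℕ

/-- Two-mode Fock space, i.e. the Hilbert tensor product `Fock ⊗ Fock`; the standard basis vector
of index `(m, n)` is `|m⟩ ⊗ |n⟩`. -/
abbrev Fock2 : Type := Ell2 (ℕ × ℕ)

/-- Standard basis vectors (number states). -/
def ket {ι : Type} [DecidableEq ι] (i : ι) : Ell2 ι := lp.single 2 i (1 : ℂ)

/-- Finite-particle vectors (finite linear combinations of number states) are represented by
`ι →₀ ℂ`; this is their inclusion in the Hilbert space. -/
def finVec {ι : Type} [DecidableEq ι] : (ι →₀ ℂ) →ₗ[ℂ] Ell2 ι :=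
  Finsupp.linearCombination ℂ (fun i : ι => ket i)

/-! ### Exponentials of unbounded skew-symmetric operators -/

/-- `U` is a strongly continuous one-parameter group of unitary operators whose generator extends
the operator `G`, which is defined on the finite-particle vectors. -/
structure IsUnitaryGroupOf {ι : Type} [DecidableEq ι] (G : Module.End ℂ (ι →₀ ℂ))
    (U : ℝ → (Ell2 ι →L[ℂ] Ell2 ι)) : Prop where
  map_zero : U 0 = 1
  map_add : ∀ s t : ℝ, U (s + t) = U s * U t
  mem_unitary : ∀ t : ℝ, U t ∈ unitary (Ell2 ι →L[ℂ] Ell2 ι)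
  continuous : ∀ ψ : Ell2 ι, Continuous (fun t : ℝ => U t ψ)
  hasDerivAt : ∀ v : ι →₀ ℂ, HasDerivAt (fun t : ℝ => U t (finVec v)) (finVec (G v)) 0

open Classical in
/-- The exponential `exp G` of an operator `G` on the finite-particle vectors: the value at time
`1` of the unitary group generated by `G` (Stone's theorem). It is only used for operators `G` that
are essentially skew-adjoint on the finite-particle vectors, and for those the group exists and is
unique. -/
def opExp {ι : Type} [DecidableEq ι] (G : Module.End ℂ (ι →₀ ℂ)) : Ell2 ι →L[ℂ] Ell2 ι :=
  if h : ∃ U : ℝ → (Ell2 ι →L[ℂ] Ell2 ι), IsUnitaryGroupOf G U then h.choose 1 else 0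

/-! ### Ladder operators -/

/-- One mode: `a |n⟩ = √n |n - 1⟩`. -/
def annihilate : Module.End ℂ (ℕ →₀ ℂ) :=
  Finsupp.linearCombination ℂ (fun n : ℕ => Finsupp.single (n - 1) ((√(n : ℝ) : ℝ) : ℂ))

/-- One mode: `a† |n⟩ = √(n + 1) |n + 1⟩`. -/
def create : Module.End ℂ (ℕ →₀ ℂ) :=
  Finsupp.linearCombination ℂ (fun n : ℕ => Finsupp.single (n + 1) ((√((n : ℝ) + 1) : ℝ) : ℂ))

/-- Two modes: annihilation operator `a` of the first mode. -/
def annihilate₁ : Module.End ℂ (ℕ × ℕ →₀ ℂ) :=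
  Finsupp.linearCombination ℂ
    (fun p : ℕ × ℕ => Finsupp.single (p.1 - 1, p.2) ((√(p.1 : ℝ) : ℝ) : ℂ))

/-- Two modes: creation operator `a†` of the first mode. -/
def create₁ : Module.End ℂ (ℕ × ℕ →₀ ℂ) :=
  Finsupp.linearCombination ℂ
    (fun p : ℕ × ℕ => Finsupp.single (p.1 + 1, p.2) ((√((p.1 : ℝ) + 1) : ℝ) : ℂ))

/-- Two modes: annihilation operator `b` of the second mode. -/
def annihilate₂ : Module.End ℂ (ℕ × ℕ →₀ ℂ) :=
  Finsupp.linearCombination ℂ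
    (fun p : ℕ × ℕ => Finsupp.single (p.1, p.2 - 1) ((√(p.2 : ℝ) : ℝ) : ℂ))

/-- Two modes: creation operator `b†` of the second mode. -/
def create₂ : Module.End ℂ (ℕ × ℕ →₀ ℂ) :=
  Finsupp.linearCombination ℂ
    (fun p : ℕ × ℕ => Finsupp.single (p.1, p.2 + 1) ((√((p.2 : ℝ) + 1) : ℝ) : ℂ))

/-- Displacement operator `D(β) = exp (β a† - β* a)`. -/
def displacement (β : ℂ) : Fock →L[ℂ] Fock :=
  opExp (β • create - conj β • annihilate)

/-- Two-mode squeezing operator `S(κ) = exp [arcosh √κ (a† b† - a b)]`. -/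
def squeezing (κ : ℝ) : Fock2 →L[ℂ] Fock2 :=
  opExp (((Real.arcosh (√κ) : ℝ) : ℂ) • (create₁ * create₂ - annihilate₁ * annihilate₂))

/-- Two-mode beam splitter operator `B(θ) = exp [arccos √θ (a† b - a b†)]`. -/
def beamSplitter (θ : ℝ) : Fock2 →L[ℂ] Fock2 :=
  opExp (((Real.arccos (√θ) : ℝ) : ℂ) • (create₁ * annihilate₂ - annihilate₁ * create₂))

/-! ### Tensor products, partial trace and the two channels -/

lemma tensor_summable (ψ χ : Fock) :
    Summable (fun p : ℕ × ℕ => ‖ψ p.1‖ ^ 2 * ‖χ p.2‖ ^ 2) := by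
  have h : ∀ φ : Fock, Summable (fun n => ‖φ n‖ ^ 2) := fun φ => by
    have := (lp.memℓp φ).summable (by norm_num)
    simpa using this
  exact (h ψ).mul_of_nonneg (h χ) (fun _ => by positivity) (fun _ => by positivity)

/-- The vector `ψ ⊗ χ`. -/
def tensor (ψ χ : Fock) : Fock2 :=
  ⟨fun p : ℕ × ℕ => ψ p.1 * χ p.2, by
    apply memℓp_gen
    simpa [mul_pow] using tensor_summable ψ χ⟩

lemma norm_tensor (ψ χ : Fock) : ‖tensor ψ χ‖ = ‖ψ‖ * ‖χ‖ := by
  have h : ∀ {ι : Type} (φ : Ell2 ι), ‖φ‖ ^ 2 = ∑' n, ‖φ n‖ ^ 2 := fun φ => by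
    have := lp.norm_rpow_eq_tsum (p := 2) (by norm_num) φ
    simpa using this
  have hs : ∀ φ : Fock, Summable (fun n => ‖φ n‖ ^ 2) := fun φ => by
    have := (lp.memℓp φ).summable (by norm_num)
    simpa using this
  have h2 : ‖tensor ψ χ‖ ^ 2 = (‖ψ‖ * ‖χ‖) ^ 2 := by
    rw [mul_pow, h, h, h, (hs ψ).tsum_mul_tsum (hs χ) (tensor_summable ψ χ)]
    refine tsum_congr fun p => ?_
    simp [tensor, mul_pow]
  exact (pow_left_inj₀ (norm_nonneg _) (by positivity) two_ne_zero).1 h2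

/-- The operator `1 ⊗ |χ⟩ : Fock → Fock ⊗ Fock`, `ψ ↦ ψ ⊗ χ`. Its adjoint is `1 ⊗ ⟨χ|`. -/
def tensorKet (χ : Fock) : Fock →L[ℂ] Fock2 :=
  LinearMap.mkContinuous
    { toFun := fun ψ => tensor ψ χ
      map_add' := fun ψ φ => by
        ext p
        exact add_mul _ _ _
      map_smul' := fun c ψ => by
        ext p
        exact mul_assoc _ _ _ }
    ‖χ‖ (fun ψ => by
      change ‖tensor ψ χ‖ ≤ _
      rw [norm_tensor, mul_comm])

/-- The operator `X ⊗ |0⟩⟨0| = (1 ⊗ |0⟩) X (1 ⊗ ⟨0|)`. -/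
def withVacuum (X : Fock →L[ℂ] Fock) : Fock2 →L[ℂ] Fock2 :=
  tensorKet (ket 0) ∘L X ∘L (tensorKet (ket 0)).adjoint

/-- Partial trace over the second mode, `Tr₂ Y = ∑ₙ (1 ⊗ ⟨n|) Y (1 ⊗ |n⟩)`, the series being taken
in the weak operator topology (i.e. matrix element by matrix element). -/
def partialTrace₂ (Y : Fock2 →L[ℂ] Fock2) : Fock →L[ℂ] Fock :=
  (∑' n : ℕ, ContinuousLinearMapWOT.ofCLM
    ((tensorKet (ket n)).adjoint ∘L Y ∘L tensorKet (ket n))).toCLM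

/-- Quantum-limited amplifier channel of strength `κ ≥ 1`. -/
def amplifier (κ : ℝ) (X : Fock →L[ℂ] Fock) : Fock →L[ℂ] Fock :=
  partialTrace₂ (squeezing κ ∘L withVacuum X ∘L (squeezing κ).adjoint)

/-- Quantum-limited attenuator channel of strength `θ ∈ [0, 1]`. -/
def attenuator (θ : ℝ) (X : Fock →L[ℂ] Fock) : Fock →L[ℂ] Fock :=
  partialTrace₂ (beamSplitter θ ∘L withVacuum X ∘L (beamSplitter θ).adjoint)

/-- The channel `𝒞 = ℰ_{1/2} ∘ 𝒜_2`. -/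
def channelC : (Fock →L[ℂ] Fock) → (Fock →L[ℂ] Fock) :=
  attenuator (1 / 2) ∘ amplifier 2

/-! ### Coherent states and the Husimi Q distribution -/

/-- The coherent state `|α⟩ = exp (-|α|²/2) ∑ₙ αⁿ/√n! |n⟩`. -/
def coherent (α : ℂ) : Fock :=
  ⟨fun n : ℕ => (Real.exp (-‖α‖ ^ 2 / 2) : ℂ) * α ^ n / (√(n.factorial : ℝ) : ℂ), by
    apply memℓp_gen
    have h := (Real.summable_pow_div_factorial (‖α‖ ^ 2)).mul_left
      (Real.exp (-‖α‖ ^ 2 / 2) ^ 2)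
    refine h.congr fun n => ?_
    have h2 : √(n.factorial : ℝ) ^ 2 = n.factorial := Real.sq_sqrt (by positivity)
    have h3 : ‖(Real.exp (-‖α‖ ^ 2 / 2) : ℂ)‖ = Real.exp (-‖α‖ ^ 2 / 2) := by
      rw [Complex.norm_real, Real.norm_of_nonneg (Real.exp_pos _).le]
    have h4 : ‖(√(n.factorial : ℝ) : ℂ)‖ = √(n.factorial : ℝ) := by
      rw [Complex.norm_real, Real.norm_of_nonneg (Real.sqrt_nonneg _)]
    rw [norm_div, norm_mul, norm_pow, h3, h4]
    simp only [ENNReal.toReal_ofNat, Real.rpow_ofNat, div_pow, mul_pow, h2]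
    ring⟩

/-- Husimi distribution `Q_X(α) = ⟨α|X|α⟩`. -/
def husimi (X : Fock →L[ℂ] Fock) (α : ℂ) : ℂ :=
  ⟪coherent α, X (coherent α)⟫_ℂ

/-! ### The Glauber–Sudarshan P distribution -/

/-- The tempered distribution `P` on the complex plane is a P distribution of `X`:
`X = ∫ d²α/π P(α) |α⟩⟨α|`, that is, each Fock matrix element `⟨m|X|n⟩` is `1/π` times the value of
`P` on the Schwartz function `α ↦ ⟨m|α⟩⟨α|n⟩`. -/
def IsGlauberP (X : Fock →L[ℂ] Fock) (P : 𝓢'(ℂ, ℂ)) : Prop :=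
  ∀ m n : ℕ, ∃ f : 𝓢(ℂ, ℂ),
    (∀ α : ℂ, f α = ⟪ket m, coherent α⟫_ℂ * ⟪coherent α, ket n⟫_ℂ) ∧
      ⟪(ket m : Fock), X (ket n)⟫_ℂ = (Real.pi : ℂ)⁻¹ * P f

/-- The function `p` on the complex plane is a P distribution of `X`:
`X = ∫ d²α/π p(α) |α⟩⟨α|` as an absolutely convergent weak integral on the whole Fock space. -/
def IsGlauberPFun (X : Fock →L[ℂ] Fock) (p : ℂ → ℂ) : Prop :=
  ∀ φ ψ : Fock,
    Integrable (fun α : ℂ => p α * (⟪φ, coherent α⟫_ℂ * ⟪coherent α, ψ⟫_ℂ)) ∧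
      ⟪φ, X ψ⟫_ℂ = (Real.pi : ℂ)⁻¹ * ∫ α : ℂ, p α * (⟪φ, coherent α⟫_ℂ * ⟪coherent α, ψ⟫_ℂ)

/-! ### The Wigner W distribution -/

/-- Trace-class (nuclear) operators: `X = ∑ₖ |uₖ⟩⟨vₖ|` with `∑ₖ ‖uₖ‖ ‖vₖ‖ < ∞`. -/
def IsTraceClass (X : Fock →L[ℂ] Fock) : Prop :=
  ∃ u v : ℕ → Fock, Summable (fun k => ‖u k‖ * ‖v k‖) ∧
    ∀ ψ : Fock, HasSum (fun k => ⟪v k, ψ⟫_ℂ • u k) (X ψ)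

/-- `⟨n|X D(β)|n⟩`, the diagonal elements whose sum over `n` is `Tr[X D(β)]`. -/
def weylDiag (X : Fock →L[ℂ] Fock) (n : ℕ) (β : ℂ) : ℂ :=
  ⟪(ket n : Fock), X (displacement β (ket n))⟫_ℂ

/-- `Tr[X D(β)]`. -/
def charFun (X : Fock →L[ℂ] Fock) (β : ℂ) : ℂ := ∑' n : ℕ, weylDiag X n β

/-- The kernel `exp (α β* - α* β)`. -/
def symplecticKernel (α β : ℂ) : ℂ := Complex.exp (α * conj β - conj α * β)

/-- The function `w` on the complex plane is the Wigner function of `X`: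
`w(α) = ∫ d²β/π Tr[X D(β)] exp (α β* - α* β)` for every `α`, where the traces and the integrals
converge absolutely. -/
def IsWignerFun (X : Fock →L[ℂ] Fock) (w : ℂ → ℂ) : Prop :=
  (∀ β : ℂ, Summable (fun n : ℕ => weylDiag X n β)) ∧ Integrable (charFun X) ∧
    ∀ α : ℂ, w α = (Real.pi : ℂ)⁻¹ * ∫ β : ℂ, charFun X β * symplecticKernel α β

/-- The tempered distribution `W` on the complex plane is the Wigner distribution of `X`:
`W(α) = ∫ d²β/π Tr[X D(β)] exp (α β* - α* β)` in the sense of distributions. Paired with a Schwartz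
function `f`, the right-hand side is `∑ₙ ∫ d²β/π ⟨n|X D(β)|n⟩ ∫ d²α f(α) exp (α β* - α* β)`, i.e.
`1/π` times the trace of `X` times the (trace-class) operator obtained by smearing `D(β)` with the
symplectic Fourier transform of `f`. This makes sense for every bounded operator `X`. -/
def IsWignerDist (X : Fock →L[ℂ] Fock) (W : 𝓢'(ℂ, ℂ)) : Prop :=
  ∀ f : 𝓢(ℂ, ℂ),
    HasSum (fun n : ℕ => (Real.pi : ℂ)⁻¹ *
      ∫ β : ℂ, weylDiag X n β * ∫ α : ℂ, f α * symplecticKernel α β) (W f)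

end QuantumOptics

end

noncomputable section

namespace QuantumOptics

open Filter Topology

/-! ### Number states and finite-particle vectors -/

section Basis

variable {ι : Type} [DecidableEq ι]

/-! Everything is governed by the characteristic function χ(β) = Tr[X D(β)]. The symplectic Fourier
transforms of P, W and Q differ only by Gaussians: each passage P → W → Q multiplies by e^{-|β|²/2}
(`gauss`). So the theorem amounts to saying that 𝒞 multiplies χ by this factor, which is
`IsNuclear.charFun_channelC`. Two facts give it. For gain 2 and transmissivity 1/2 the Kraus
operators of the amplifier and the attenuator are adjoint to each other up to scalars
(`adjoint_ampKraus`), so 𝒞 is its own dual for the trace pairing (`IsNuclear.tsum_channelC`); and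
D(β) is an eigenvector of 𝒞 with eigenvalue e^{-|β|²/2} (`channelC_displacement`). Duality tested on
rank-one operators gives the Weyl expansion of 𝒞(X) (`IsNuclear.inner_channelC`), and expanding
displacement operators in coherent states turns it into a P representation. This settles trace-class
X.

A bounded X is the weak limit of the norm-bounded finite-rank operators obtained by cutting off the
number states. The Kraus series converge absolutely, so 𝒞 respects such limits. The Wigner
distribution does too, because ∫ h(β)⟨n|X D(β)|n⟩ is O((n+1)⁻²) with a constant proportional to ‖X‖:
multiplying D(β) on the right by a a† is a differential operator in β with polynomial coefficients,
and integration by parts moves it onto h (`smear_smearNumber`). The same estimate makes W tempered.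

P distributions are unique because a tempered distribution that kills every α ↦ ⟨m|α⟩⟨α|n⟩ is zero
(`temperedDistribution_eq_zero`). A compactly supported g is h · `gauss` with h Schwartz, and its
symplectic Fourier transform is the Husimi function of ∫ h(β)D(β). The matrix elements of that
operator decay faster than any power, while the Schwartz seminorms of ⟨m|α⟩⟨α|n⟩ grow polynomially
(`cohMatrix_iteratedFDeriv_decay`); hence the matrix expansion converges in the Schwartz space. Such
g are dense.

The unitaries enter only through explicit orbits. Finite-particle vectors are analytic for
ladder-type generators, so the groups exist, and a proposed orbit is recognised by
`IsUnitaryGroupOf.apply_eq_of_ladder`: its coordinates are analytic in time and their derivatives at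
0 are forced. Operator identities are then checked on exponential vectors, where they become
Gaussian integrals. -/

lemma ket_apply (i j : ι) : (ket i : Ell2 ι) j = if j = i then 1 else 0 := by
  simp [ket, lp.single_apply, Pi.single_apply]

lemma inner_ket_left (i : ι) (ψ : Ell2 ι) : ⟪(ket i : Ell2 ι), ψ⟫_ℂ = ψ i := by
  rw [ket, lp.inner_single_left]; simp

lemma inner_ket_right (i : ι) (ψ : Ell2 ι) : ⟪ψ, (ket i : Ell2 ι)⟫_ℂ = conj (ψ i) := by
  rw [← inner_conj_symm, inner_ket_left]

lemma norm_ket (i : ι) : ‖(ket i : Ell2 ι)‖ = 1 := by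
  rw [ket, lp.norm_single (by norm_num)]; simp

lemma finVec_single (i : ι) (c : ℂ) : finVec (Finsupp.single i c) = c • (ket i : Ell2 ι) := by
  simp [finVec]

lemma hasSum_ket (ψ : Ell2 ι) : HasSum (fun i => ψ i • (ket i : Ell2 ι)) ψ := by
  have h := lp.hasSum_single (p := 2) (by norm_num) ψ
  refine h.congr_fun fun i => ?_
  ext j
  by_cases hj : j = i
  · subst hj; simp [ket_apply, lp.single_apply]
  · simp [ket_apply, lp.single_apply, hj]

lemma denseRange_finVec : DenseRange (finVec : (ι →₀ ℂ) → Ell2 ι) := by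
  intro ψ
  refine mem_closure_of_tendsto (hasSum_ket ψ) (Eventually.of_forall fun s => ?_)
  refine ⟨∑ i ∈ s, Finsupp.single i (ψ i), ?_⟩
  simp [finVec_single]

lemma finVec_apply (v : ι →₀ ℂ) (i : ι) : (finVec v : Ell2 ι) i = v i := by
  induction v using Finsupp.induction_linear with
  | zero => simp
  | add f g hf hg => simp [map_add, hf, hg]
  | single j c => simp [finVec_single, ket_apply, Finsupp.single_apply, eq_comm]

lemma norm_finVec_le (v : ι →₀ ℂ) : ‖(finVec v : Ell2 ι)‖ ≤ v.sum fun _ c => ‖c‖ := by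
  rw [finVec, Finsupp.linearCombination_apply, Finsupp.sum, Finsupp.sum]
  refine (norm_sum_le _ _).trans (Finset.sum_le_sum fun i _ => ?_)
  rw [norm_smul, norm_ket, mul_one]

end Basis

/-! ### Strong continuity from a dense set -/

/-- The uniform bound on the operators turns an approximation of `x` from the span into convergence
that is uniform in the parameter, and uniform limits of continuous functions are continuous. -/
lemma continuous_apply_of_dense {α E F : Type*} [TopologicalSpace α] [NormedAddCommGroup E]
    [NormedSpace ℂ E] [NormedAddCommGroup F] [NormedSpace ℂ F] (U : α → E →L[ℂ] F) (C : ℝ)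
    (hC : ∀ a, ‖U a‖ ≤ C) {S : Set E} (hS : Dense (Submodule.span ℂ S : Set E))
    (h : ∀ x ∈ S, Continuous fun a => U a x) (x : E) : Continuous fun a => U a x := by
  have hspan : ∀ y ∈ Submodule.span ℂ S, Continuous fun a => U a y := by
    intro y hy
    induction hy using Submodule.span_induction with
    | mem y hy => exact h y hy
    | zero => simpa using continuous_const
    | add y z _ _ hy hz =>
      simp only [map_add]
      exact Continuous.add hy hz
    | smul c y _ hy =>
      simp only [map_smul]
      exact continuous_const.smul hy
  obtain ⟨u, hu, hux⟩ := mem_closure_iff_seq_limit.1 (hS x)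
  have hunif : TendstoUniformly (fun n a => U a (u n)) (fun a => U a x) atTop := by
    rw [Metric.tendstoUniformly_iff]
    intro ε hε
    have h0 : Tendsto (fun n => (|C| + 1) * dist x (u n)) atTop (𝓝 0) := by
      have := (tendsto_const_nhds (x := x)).dist hux
      simpa using this.const_mul (|C| + 1)
    filter_upwards [h0.eventually_lt_const hε] with n hn a
    refine lt_of_le_of_lt ?_ hn
    rw [dist_eq_norm, dist_eq_norm, ← map_sub]
    refine ((U a).le_opNorm _).trans ?_
    gcongr
    exact (hC a).trans ((le_abs_self C).trans (by linarith))
  exact hunif.continuous (Frequently.of_forall fun n => hspan _ (hu n))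

/-! ### Double series -/

lemma tsum_prod_eq_tsum_antidiagonal {E : Type*} [NormedAddCommGroup E] [CompleteSpace E]
    {f : ℕ × ℕ → E} (hf : Summable f) :
    ∑' n, ∑' m, f (n, m) = ∑' k, ∑ p ∈ Finset.HasAntidiagonal.antidiagonal k, f p := by
  rw [← hf.tsum_prod, ← Finset.HasAntidiagonal.sigmaAntidiagonalEquivProd.tsum_eq f]
  have hs := (Finset.HasAntidiagonal.sigmaAntidiagonalEquivProd (A := ℕ)).summable_iff.2 hf
  refine hs.tsum_sigma.trans ?_
  refine tsum_congr fun k => ?_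
  rw [tsum_fintype]
  exact Finset.sum_finset_coe (fun p => f p) (Finset.HasAntidiagonal.antidiagonal k)

/-- Meant for double series whose terms carry (p + q)! and are therefore not dominated by a product
of two series; only the sums over p + q = k are geometric. -/
lemma summable_prod_of_antidiagonal {f : ℕ × ℕ → ℝ} (h0 : ∀ p, 0 ≤ f p)
    (hf : Summable fun k => ∑ p ∈ Finset.HasAntidiagonal.antidiagonal k, f p) : Summable f := by
  rw [← (Finset.HasAntidiagonal.sigmaAntidiagonalEquivProd (A := ℕ)).summable_iff]
  refine (summable_sigma_of_nonneg (fun _ => h0 _)).2 ?_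
  refine ⟨fun k => (hasSum_fintype _).summable, hf.congr fun k => ?_⟩
  rw [tsum_fintype]
  exact (Finset.sum_finset_coe (fun p => f p) (Finset.HasAntidiagonal.antidiagonal k)).symm

lemma sum_antidiagonal_div_factorial (s t : ℝ) (k : ℕ) :
    ∑ p ∈ Finset.HasAntidiagonal.antidiagonal k, s ^ p.1 / (p.1.factorial : ℝ) * (t ^ p.2 / (p.2.factorial : ℝ)) =
      (s + t) ^ k / (k.factorial : ℝ) := by
  rw [(Commute.all s t).add_pow', Finset.sum_div]
  refine Finset.sum_congr rfl fun p hp => ?_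
  rw [Finset.HasAntidiagonal.mem_antidiagonal] at hp
  subst hp
  have h := Nat.add_choose_mul_factorial_mul_factorial p.1 p.2
  have h1 : (p.1.factorial : ℝ) ≠ 0 := by positivity
  have h2 : (p.2.factorial : ℝ) ≠ 0 := by positivity
  have h3 : ((p.1 + p.2).factorial : ℝ) ≠ 0 := by positivity
  have h' : ((p.1 + p.2).choose p.1 : ℝ) * p.1.factorial * p.2.factorial = (p.1 + p.2).factorial := by
    rw [← Nat.choose_symm_add] at h
    exact_mod_cast h
  rw [nsmul_eq_mul]
  field_simp
  linear_combination (-(s ^ p.1 * t ^ p.2)) * h'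

/-- A norm-convergent power series with geometrically bounded vector coefficients. -/
lemma hasFPowerSeriesOnBall_of_hasSum {F : Type*} [NormedAddCommGroup F] [NormedSpace ℝ F]
    {f : ℝ → F} {a : ℕ → F} {C K : ℝ} (hK : 0 < K) (ha : ∀ n, ‖a n‖ ≤ C * K ^ n)
    (hf : ∀ t : ℝ, |t| * K < 1 → HasSum (fun n => t ^ n • a n) (f t)) :
    HasFPowerSeriesOnBall f (fun n => ContinuousMultilinearMap.mkPiRing ℝ (Fin n) (a n)) 0
      (ENNReal.ofReal (1 / K)) where
  r_le := by
    refine FormalMultilinearSeries.le_radius_of_bound (C := C) _ fun n => ?_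
    rw [ContinuousMultilinearMap.norm_mkPiRing]
    have : ((1 / K).toNNReal : ℝ) = 1 / K := Real.coe_toNNReal _ (by positivity)
    rw [this]
    calc ‖a n‖ * (1 / K) ^ n ≤ C * K ^ n * (1 / K) ^ n := by gcongr; exact ha n
      _ = C := by rw [mul_assoc, ← mul_pow, mul_one_div_cancel hK.ne', one_pow, mul_one]
  r_pos := by rw [ENNReal.ofReal_pos]; positivity
  hasSum := by
    intro y hy
    rw [Metric.mem_eball, edist_zero_right, ← ofReal_norm,
      ENNReal.ofReal_lt_ofReal_iff (by positivity), lt_div_iff₀ hK, Real.norm_eq_abs] at hy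
    simpa using hf y hy

/-! ### Unitary groups generated by skew-symmetric operators with a dense set of analytic vectors -/

section Nelson

variable {D H : Type*} [AddCommGroup D] [Module ℂ D] [NormedAddCommGroup H]
  [InnerProductSpace ℂ H]

/-- `G` is skew-symmetric on the dense domain `j : D → H`, and every vector of `D` is analytic for
`G` with radius of convergence at least `1 / K`. -/
structure IsAnalyticSkew (j : D →ₗ[ℂ] H) (G : Module.End ℂ D) (K : ℝ) : Prop where
  pos : 0 < K
  dense : DenseRange j
  skew : ∀ v w, ⟪j (G v), j w⟫_ℂ = -⟪j v, j (G w)⟫_ℂ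
  bound : ∀ v, ∃ C, ∀ n : ℕ, ‖j ((G ^ n) v)‖ ≤ C * (K ^ n * n.factorial)

variable {j : D →ₗ[ℂ] H} {G : Module.End ℂ D} {K : ℝ}

/-- Terms of the exponential series. -/
def expTerm (j : D →ₗ[ℂ] H) (G : Module.End ℂ D) (t : ℝ) (v : D) (n : ℕ) : H :=
  ((t ^ n / (n.factorial : ℝ) : ℝ) : ℂ) • j ((G ^ n) v)

/-- The exponential series. -/
def expSeries (j : D →ₗ[ℂ] H) (G : Module.End ℂ D) (t : ℝ) (v : D) : H :=
  ∑' n, expTerm j G t v n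

namespace IsAnalyticSkew

lemma skew_pow (h : IsAnalyticSkew j G K) (n : ℕ) (v w : D) :
    ⟪j ((G ^ n) v), j w⟫_ℂ = (-1) ^ n * ⟪j v, j ((G ^ n) w)⟫_ℂ := by
  induction n generalizing w with
  | zero => simp
  | succ n ih =>
    rw [pow_succ' G, Module.End.mul_apply, h.skew, ih, ← Module.End.mul_apply, ← pow_succ, pow_succ' G]
    ring

lemma exists_norm_expTerm_le (h : IsAnalyticSkew j G K) (v : D) :
    ∃ C, ∀ (t : ℝ) (n : ℕ), ‖expTerm j G t v n‖ ≤ C * (|t| * K) ^ n := by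
  obtain ⟨C, hC⟩ := h.bound v
  refine ⟨C, fun t n => ?_⟩
  rw [expTerm, norm_smul, Complex.norm_real, norm_div, norm_pow, Real.norm_eq_abs,
    Real.norm_of_nonneg (Nat.cast_nonneg _)]
  have hn : (0 : ℝ) < n.factorial := by positivity
  calc |t| ^ n / n.factorial * ‖j ((G ^ n) v)‖
      ≤ |t| ^ n / n.factorial * (C * (K ^ n * n.factorial)) := by gcongr; exact hC n
    _ = C * (|t| * K) ^ n := by rw [mul_pow]; field_simp

lemma summable_norm_expTerm (h : IsAnalyticSkew j G K) {t : ℝ} (ht : |t| * K < 1) (v : D) :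
    Summable fun n => ‖expTerm j G t v n‖ := by
  obtain ⟨C, hC⟩ := h.exists_norm_expTerm_le v
  have hK := h.pos
  refine Summable.of_nonneg_of_le (fun _ => norm_nonneg _) (hC t) ?_
  exact (summable_geometric_of_lt_one (by positivity) ht).mul_left C

lemma hasFPowerSeriesOnBall (h : IsAnalyticSkew j G K) {f : ℝ → H} {v : D}
    (hf : ∀ t : ℝ, |t| * K < 1 → HasSum (expTerm j G t v) (f t)) :
    HasFPowerSeriesOnBall f (fun n => ContinuousMultilinearMap.mkPiRing ℝ (Fin n)
      (((n.factorial : ℝ)⁻¹ : ℝ) • j ((G ^ n) v))) 0 (ENNReal.ofReal (1 / K)) := by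
  obtain ⟨C, hC⟩ := h.bound v
  refine hasFPowerSeriesOnBall_of_hasSum (C := C) h.pos (fun n => ?_) fun t ht => ?_
  · rw [norm_smul, norm_inv, Real.norm_of_nonneg (Nat.cast_nonneg _)]
    have hn : (0 : ℝ) < n.factorial := by positivity
    rw [inv_mul_le_iff₀ hn]
    linarith [hC n]
  · refine (hf t ht).congr_fun fun n => ?_
    rw [expTerm, smul_smul, div_eq_mul_inv, Complex.coe_smul]

lemma hasDerivAt_zero (h : IsAnalyticSkew j G K) {f : ℝ → H} {v : D}
    (hf : ∀ t : ℝ, |t| * K < 1 → HasSum (expTerm j G t v) (f t)) : HasDerivAt f (j (G v)) 0 := by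
  have := (h.hasFPowerSeriesOnBall hf).hasFPowerSeriesAt.hasDerivAt
  simpa using this

variable [CompleteSpace H]

lemma hasSum_expTerm (h : IsAnalyticSkew j G K) {t : ℝ} (ht : |t| * K < 1) (v : D) :
    HasSum (expTerm j G t v) (expSeries j G t v) :=
  (h.summable_norm_expTerm ht v).of_norm.hasSum

/-- In the Cauchy product, skew-symmetry moves all powers of `G` to the right with a sign. The part
of degree k is ((-t) + t)^k / k! times ⟨v, G^k w⟩, so only k = 0 survives. -/
lemma inner_expSeries (h : IsAnalyticSkew j G K) {t : ℝ} (ht : |t| * K < 1) (v w : D) :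
    ⟪expSeries j G t v, expSeries j G t w⟫_ℂ = ⟪j v, j w⟫_ℂ := by
  have hv := h.summable_norm_expTerm ht v
  have hw := h.summable_norm_expTerm ht w
  have hs : Summable fun p : ℕ × ℕ => ⟪expTerm j G t v p.1, expTerm j G t w p.2⟫_ℂ := by
    refine Summable.of_norm_bounded (hv.mul_of_nonneg hw (fun _ => norm_nonneg _)
      fun _ => norm_nonneg _) fun p => norm_inner_le_norm _ _
  have h1 : ∀ n, ∑' m, ⟪expTerm j G t v n, expTerm j G t w m⟫_ℂ =
      ⟪expTerm j G t v n, expSeries j G t w⟫_ℂ := fun n =>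
    (((h.hasSum_expTerm ht w).mapL (innerSL ℂ (expTerm j G t v n)))).tsum_eq
  have h2 : ∑' n, ⟪expTerm j G t v n, expSeries j G t w⟫_ℂ =
      ⟪expSeries j G t v, expSeries j G t w⟫_ℂ :=
    (((h.hasSum_expTerm ht v).mapL (innerSLFlip ℂ (expSeries j G t w)))).tsum_eq
  rw [← h2]
  simp_rw [← h1]
  rw [tsum_prod_eq_tsum_antidiagonal hs, tsum_eq_single 0]
  · simp [expTerm]
  · intro k hk
    have h3 : ∀ p ∈ Finset.HasAntidiagonal.antidiagonal k,
        ⟪expTerm j G t v p.1, expTerm j G t w p.2⟫_ℂ =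
          (((-t) ^ p.1 / (p.1.factorial : ℝ) * (t ^ p.2 / (p.2.factorial : ℝ)) : ℝ) : ℂ) *
            ⟪j v, j ((G ^ k) w)⟫_ℂ := by
      intro p hp
      rw [Finset.HasAntidiagonal.mem_antidiagonal] at hp
      rw [expTerm, expTerm, inner_smul_left, inner_smul_right, h.skew_pow, ← Module.End.mul_apply,
        ← pow_add, hp, Complex.conj_ofReal, neg_pow]
      push_cast
      ring
    rw [Finset.sum_congr rfl h3, ← Finset.sum_mul, ← Complex.ofReal_sum,
      sum_antidiagonal_div_factorial]
    simp [hk]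

lemma expSeries_add (h : IsAnalyticSkew j G K) {t : ℝ} (ht : |t| * K < 1) (v w : D) :
    expSeries j G t (v + w) = expSeries j G t v + expSeries j G t w := by
  rw [expSeries, expSeries, expSeries, ← (h.hasSum_expTerm ht v).summable.tsum_add
    (h.hasSum_expTerm ht w).summable]
  exact tsum_congr fun n => by simp [expTerm]

lemma expSeries_smul (h : IsAnalyticSkew j G K) {t : ℝ} (ht : |t| * K < 1) (c : ℂ) (v : D) :
    expSeries j G t (c • v) = c • expSeries j G t v := by
  rw [expSeries, expSeries, ← (h.hasSum_expTerm ht v).summable.tsum_const_smul]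
  exact tsum_congr fun n => by simp [expTerm, smul_comm c]

lemma norm_expSeries (h : IsAnalyticSkew j G K) {t : ℝ} (ht : |t| * K < 1) (v : D) :
    ‖expSeries j G t v‖ = ‖j v‖ := by
  rw [@norm_eq_sqrt_re_inner ℂ, @norm_eq_sqrt_re_inner ℂ, h.inner_expSeries ht]

open Classical in
/-- The exponential `exp (t G)` for small `t`. -/
def localExp (_ : IsAnalyticSkew j G K) (t : ℝ) : H →L[ℂ] H :=
  -- Beyond the disc of convergence the series need not be linear in the vector, hence the default
  -- value 0. The values are used only for `|t| * K < 1`.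
  if h : IsLinearMap ℂ (expSeries j G t) then (h.mk' _).extendOfNorm j else 0

lemma localExp_apply (h : IsAnalyticSkew j G K) {t : ℝ} (ht : |t| * K < 1) (v : D) :
    h.localExp t (j v) = expSeries j G t v := by
  have hl : IsLinearMap ℂ (expSeries j G t) := ⟨h.expSeries_add ht, h.expSeries_smul ht⟩
  rw [localExp, dif_pos hl]
  exact LinearMap.extendOfNorm_eq h.dense ⟨1, fun x => by simp [h.norm_expSeries ht]⟩ v

lemma localExp_zero (h : IsAnalyticSkew j G K) : h.localExp 0 = 1 := by
  refine ContinuousLinearMap.ext_on (s := Set.range j) (h.dense.mono Submodule.subset_span) ?_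
  rintro _ ⟨v, rfl⟩
  rw [h.localExp_apply (by simp), expSeries, tsum_eq_single 0]
  · simp [expTerm]
  · intro n hn; simp [expTerm, hn]

/-- The double series for exp(sG) exp(tG)v is regrouped by total degree and the binomial theorem is
applied. Absolute convergence is exactly what `(|s| + |t|) * K < 1` provides: the terms of degree k
add up to at most a constant times that number to the power k. -/
lemma localExp_mul (h : IsAnalyticSkew j G K) {s t : ℝ} (hst : (|s| + |t|) * K < 1) :
    h.localExp s * h.localExp t = h.localExp (s + t) := by
  have hK := h.pos
  have hs : |s| * K < 1 := lt_of_le_of_lt (by gcongr; simp) hst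
  have ht : |t| * K < 1 := lt_of_le_of_lt (by gcongr; simp) hst
  have hs' : |s + t| * K < 1 := lt_of_le_of_lt (by gcongr; exact abs_add_le _ _) hst
  refine ContinuousLinearMap.ext_on (s := Set.range j) (h.dense.mono Submodule.subset_span) ?_
  rintro _ ⟨v, rfl⟩
  rw [mul_apply_eq_comp, h.localExp_apply ht, h.localExp_apply hs']
  have key : ∀ p : ℕ × ℕ, ((t ^ p.1 / (p.1.factorial : ℝ) : ℝ) : ℂ) •
      expTerm j G s ((G ^ p.1) v) p.2 =
      ((t ^ p.1 / (p.1.factorial : ℝ) * (s ^ p.2 / (p.2.factorial : ℝ)) : ℝ) : ℂ) •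
        j ((G ^ (p.1 + p.2)) v) := fun p => by
    rw [expTerm, smul_smul, ← Module.End.mul_apply, ← pow_add, add_comm p.2, Complex.ofReal_mul]
  obtain ⟨C, hC⟩ := h.bound v
  have hsum : Summable fun p : ℕ × ℕ => ((t ^ p.1 / (p.1.factorial : ℝ) : ℝ) : ℂ) •
      expTerm j G s ((G ^ p.1) v) p.2 := by
    refine Summable.of_norm_bounded (g := fun p : ℕ × ℕ =>
      |t| ^ p.1 / (p.1.factorial : ℝ) * (|s| ^ p.2 / (p.2.factorial : ℝ)) *
        (|C| * (K ^ (p.1 + p.2) * (p.1 + p.2).factorial))) ?_ fun p => ?_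
    · refine summable_prod_of_antidiagonal (fun p => by positivity) ?_
      refine ((summable_geometric_of_lt_one (r := (|s| + |t|) * K) (by positivity) hst).mul_left
        |C|).congr fun k => ?_
      have : ∀ p ∈ Finset.HasAntidiagonal.antidiagonal k,
          |t| ^ p.1 / (p.1.factorial : ℝ) * (|s| ^ p.2 / (p.2.factorial : ℝ)) *
            (|C| * (K ^ (p.1 + p.2) * (p.1 + p.2).factorial)) =
          |t| ^ p.1 / (p.1.factorial : ℝ) * (|s| ^ p.2 / (p.2.factorial : ℝ)) *
            (|C| * (K ^ k * k.factorial)) := fun p hp => by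
        rw [Finset.HasAntidiagonal.mem_antidiagonal] at hp
        rw [hp]
      rw [Finset.sum_congr rfl this, ← Finset.sum_mul, sum_antidiagonal_div_factorial]
      have hk : (0 : ℝ) < k.factorial := by positivity
      rw [mul_pow, add_comm |t|]
      field_simp
    · rw [key, norm_smul, Complex.norm_real, Real.norm_eq_abs, abs_mul, abs_div, abs_div, abs_pow,
        abs_pow, Nat.abs_cast, Nat.abs_cast]
      gcongr
      refine (hC _).trans ?_
      gcongr
      exact le_abs_self C
  have h1 : ∀ n, ∑' m, ((t ^ n / (n.factorial : ℝ) : ℝ) : ℂ) • expTerm j G s ((G ^ n) v) m =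
      h.localExp s (expTerm j G t v n) := fun n => by
    rw [expTerm, map_smul, h.localExp_apply hs]
    exact ((h.hasSum_expTerm hs _).const_smul _).tsum_eq
  have h2 := ((h.hasSum_expTerm ht v).mapL (h.localExp s)).tsum_eq
  rw [← h2]
  simp_rw [← h1]
  rw [tsum_prod_eq_tsum_antidiagonal hsum, expSeries]
  refine tsum_congr fun k => ?_
  have h3 : ∀ p ∈ Finset.HasAntidiagonal.antidiagonal k,
      ((t ^ p.1 / (p.1.factorial : ℝ) : ℝ) : ℂ) • expTerm j G s ((G ^ p.1) v) p.2 =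
      ((t ^ p.1 / (p.1.factorial : ℝ) * (s ^ p.2 / (p.2.factorial : ℝ)) : ℝ) : ℂ) •
        j ((G ^ k) v) := fun p hp => by
    rw [Finset.HasAntidiagonal.mem_antidiagonal] at hp
    rw [key, hp]
  rw [Finset.sum_congr rfl h3, ← Finset.sum_smul, ← Complex.ofReal_sum,
    sum_antidiagonal_div_factorial, expTerm, add_comm]

lemma localExp_pow (h : IsAnalyticSkew j G K) (N : ℕ) {t : ℝ} (ht : (N * |t|) * K < 1) :
    h.localExp t ^ N = h.localExp (N * t) := by
  have hK := h.pos
  induction N with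
  | zero => simp [h.localExp_zero]
  | succ n ih =>
    have hn : ((n : ℝ) * |t|) * K < 1 := by
      refine lt_of_le_of_lt ?_ ht
      push_cast
      gcongr
      linarith
    rw [pow_succ, ih hn, h.localExp_mul]
    · push_cast; ring_nf
    · rw [abs_mul, Nat.abs_cast]
      push_cast at ht
      linarith

/-- An isometry with a right inverse is unitary. The right inverse is the exponential at `-t`, and
the factor 2 lets the addition law apply to `t` and `-t`. -/
lemma localExp_mem_unitary (h : IsAnalyticSkew j G K) {t : ℝ} (ht : (2 * |t|) * K < 1) :
    h.localExp t ∈ unitary (H →L[ℂ] H) := by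
  have hK := h.pos
  have ht1 : |t| * K < 1 := lt_of_le_of_lt (by gcongr; linarith [abs_nonneg t]) ht
  have hinv : h.localExp t * h.localExp (-t) = 1 := by
    rw [h.localExp_mul (by rw [abs_neg]; linarith), add_neg_cancel, h.localExp_zero]
  have hiso : star (h.localExp t) * h.localExp t = 1 := by
    refine (ContinuousLinearMap.norm_map_iff_adjoint_comp_self _).1 fun x => ?_
    refine h.dense.induction (P := fun x => ‖h.localExp t x‖ = ‖x‖) ?_ ?_ x
    · rintro _ ⟨v, rfl⟩
      rw [h.localExp_apply ht1, h.norm_expSeries ht1]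
    · exact isClosed_eq (by fun_prop) (by fun_prop)
  rw [Unitary.mem_iff]
  refine ⟨hiso, ?_⟩
  have : star (h.localExp t) = h.localExp (-t) := by
    calc star (h.localExp t) = star (h.localExp t) * (h.localExp t * h.localExp (-t)) := by
          rw [hinv, mul_one]
      _ = h.localExp (-t) := by rw [← mul_assoc, hiso, one_mul]
  rw [this, hinv]

/-- The unitary group generated by `G`. -/
def group (h : IsAnalyticSkew j G K) (t : ℝ) : H →L[ℂ] H :=
  -- The integer `⌊|t| * K⌋₊ + 1` exceeds `|t| * K`, so each factor lies inside the disc of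
  -- convergence.
  h.localExp (t / (⌊|t| * K⌋₊ + 1 : ℕ)) ^ (⌊|t| * K⌋₊ + 1)

lemma group_eq (h : IsAnalyticSkew j G K) {t : ℝ} {N : ℕ} (hN : |t| * K < N) :
    h.group t = h.localExp (t / N) ^ N := by
  have hK := h.pos
  -- Two admissible subdivisions of the time interval are compared through their common refinement
  -- `M * N`.
  have key : ∀ {M N : ℕ}, |t| * K < M → 0 < N →
      h.localExp (t / M) = h.localExp (t / (M * N : ℕ)) ^ N := by
    intro M N hM hN
    have hM0 : (0 : ℝ) < M := lt_of_le_of_lt (by positivity) hM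
    have hN0 : (0 : ℝ) < N := by exact_mod_cast hN
    rw [h.localExp_pow]
    · congr 1; push_cast; field_simp
    · rw [abs_div, Nat.abs_cast]
      push_cast
      have : N * (|t| / (M * N)) * K = |t| * K / M := by field_simp
      rw [this, div_lt_one hM0]
      exact hM
  have hM : |t| * K < (⌊|t| * K⌋₊ + 1 : ℕ) := by exact_mod_cast Nat.lt_floor_add_one _
  have hN0 : 0 < N := by
    have : (0 : ℝ) < N := lt_of_le_of_lt (by positivity) hN
    exact_mod_cast this
  rw [group, key hM hN0, key hN (Nat.succ_pos ⌊|t| * K⌋₊), ← pow_mul, ← pow_mul, mul_comm N]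

lemma group_eq_localExp (h : IsAnalyticSkew j G K) {t : ℝ} (ht : |t| * K < 1) :
    h.group t = h.localExp t := by
  rw [h.group_eq (N := 1) (by simpa using ht)]
  simp

lemma group_add (h : IsAnalyticSkew j G K) (s t : ℝ) : h.group (s + t) = h.group s * h.group t := by
  have hK := h.pos
  obtain ⟨N, hN⟩ := exists_nat_gt ((|s| + |t|) * K)
  have hN0 : (0 : ℝ) < N := lt_of_le_of_lt (by positivity) hN
  have hs : |s| * K < N := lt_of_le_of_lt (by gcongr; simp) hN
  have ht : |t| * K < N := lt_of_le_of_lt (by gcongr; simp) hN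
  have hst : |s + t| * K < N := lt_of_le_of_lt (by gcongr; exact abs_add_le _ _) hN
  have hc : (|s / N| + |t / N|) * K < 1 := by
    rw [abs_div, abs_div, Nat.abs_cast, ← add_div, div_mul_eq_mul_div, div_lt_one hN0]
    exact hN
  rw [h.group_eq hs, h.group_eq ht, h.group_eq hst, ← Commute.mul_pow, h.localExp_mul hc, add_div]
  rw [commute_iff_eq, h.localExp_mul hc, h.localExp_mul (by rw [add_comm]; exact hc), add_comm]

lemma group_mem_unitary (h : IsAnalyticSkew j G K) (t : ℝ) : h.group t ∈ unitary (H →L[ℂ] H) := by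
  have hK := h.pos
  obtain ⟨N, hN⟩ := exists_nat_gt (2 * |t| * K)
  have hN0 : (0 : ℝ) < N := lt_of_le_of_lt (by positivity) hN
  have ht : |t| * K < N := lt_of_le_of_lt (by gcongr; linarith [abs_nonneg t]) hN
  rw [h.group_eq ht]
  refine pow_mem (h.localExp_mem_unitary ?_) N
  rw [abs_div, Nat.abs_cast, mul_div_assoc', div_mul_eq_mul_div, div_lt_one hN0]
  exact hN

lemma hasDerivAt_group (h : IsAnalyticSkew j G K) (v : D) :
    HasDerivAt (fun t => h.group t (j v)) (j (G v)) 0 := by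
  refine h.hasDerivAt_zero fun t ht => ?_
  rw [h.group_eq_localExp ht, h.localExp_apply ht]
  exact h.hasSum_expTerm ht v

lemma continuous_group (h : IsAnalyticSkew j G K) (ψ : H) : Continuous fun t => h.group t ψ := by
  refine continuous_apply_of_dense h.group 1 (fun t => ?_)
    (S := Set.range j) (h.dense.mono Submodule.subset_span) ?_ ψ
  · refine ContinuousLinearMap.opNorm_le_bound _ zero_le_one fun x => ?_
    rw [one_mul, ContinuousLinearMap.norm_map_of_mem_unitary (h.group_mem_unitary t)]
  · rintro _ ⟨v, rfl⟩
    rw [continuous_iff_continuousAt]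
    intro t
    have h0 : ContinuousAt (fun s => h.group (s - t) (j v)) t := by
      have h1 := (h.hasDerivAt_group v).continuousAt
      refine ContinuousAt.comp (f := fun s => s - t) (x := t) (by simpa using h1) (by fun_prop)
    have h2 := (h.group t).continuous.continuousAt.comp h0
    refine h2.congr (Eventually.of_forall fun s => ?_)
    simp only [Function.comp]
    rw [← mul_apply_eq_comp, ← h.group_add]
    simp

end IsAnalyticSkew

end Nelson

/-! ### Ladder-type operators -/

section Ladder

variable {ι : Type}

/-- The `ℓ¹` norm of a finite-particle vector. -/
def l1 (v : ι →₀ ℂ) : ℝ := v.sum fun _ c => ‖c‖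

lemma l1_nonneg (v : ι →₀ ℂ) : 0 ≤ l1 v := Finset.sum_nonneg fun _ _ => norm_nonneg _

lemma l1_eq {v : ι →₀ ℂ} {s : Finset ι} (hs : v.support ⊆ s) : l1 v = ∑ i ∈ s, ‖v i‖ :=
  Finsupp.sum_of_support_subset v hs _ (by simp)

lemma l1_smul (c : ℂ) (v : ι →₀ ℂ) : l1 (c • v) = ‖c‖ * l1 v := by
  rw [l1_eq (Finsupp.support_smul (b := c) (g := v)), l1, Finsupp.sum, Finset.mul_sum]
  exact Finset.sum_congr rfl fun i _ => by simp

lemma l1_single (i : ι) (c : ℂ) : l1 (Finsupp.single i c) = ‖c‖ := by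
  simp [l1]

/-- An operator which maps the number state `i` to a combination of the states `r i` and `l i`,
in a skew-symmetric way and with coefficients of at most linear growth in the degree `d`. -/
structure IsLadder (G : Module.End ℂ (ι →₀ ℂ)) (d : ι → ℕ) (c : ℝ) (x y : ι → ℂ)
    (r l : ι → ι) : Prop where
  pos : 0 < c
  apply_single : ∀ i, G (Finsupp.single i 1) =
    Finsupp.single (r i) (x i) - Finsupp.single (l i) (y i)
  norm_x : ∀ i, ‖x i‖ ≤ c * (d i + 1)
  norm_y : ∀ i, ‖y i‖ ≤ c * (d i + 1)
  deg_r : ∀ i, d (r i) ≤ d i + 2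
  deg_l : ∀ i, d (l i) ≤ d i + 2
  left_right : ∀ i, x i = 0 ∨ (l (r i) = i ∧ y (r i) = conj (x i))
  right_left : ∀ i, y i = 0 ∨ (r (l i) = i ∧ x (l i) = conj (y i))

variable {G : Module.End ℂ (ι →₀ ℂ)} {d : ι → ℕ} {c : ℝ} {x y : ι → ℂ} {r l : ι → ι}

namespace IsLadder

lemma smul (h : IsLadder G d c x y r l) (a : ℝ) :
    IsLadder ((a : ℂ) • G) d ((|a| + 1) * c) (fun i => a * x i) (fun i => a * y i) r l where
  -- The summand 1 in `|a| + 1` keeps the constant positive when `a = 0`.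
  pos := by have := h.pos; positivity
  apply_single i := by
    rw [LinearMap.smul_apply, h.apply_single, smul_sub, Finsupp.smul_single, Finsupp.smul_single]
    simp
  norm_x i := by
    rw [norm_mul, Complex.norm_real, Real.norm_eq_abs, mul_assoc]
    have := h.norm_x i
    gcongr
    linarith
  norm_y i := by
    rw [norm_mul, Complex.norm_real, Real.norm_eq_abs, mul_assoc]
    have := h.norm_y i
    gcongr
    linarith
  deg_r := h.deg_r
  deg_l := h.deg_l
  left_right i := by
    rcases h.left_right i with h0 | ⟨h1, h2⟩
    · simp [h0]
    · right; simp [h1, h2]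
  right_left i := by
    rcases h.right_left i with h0 | ⟨h1, h2⟩
    · simp [h0]
    · right; simp [h1, h2]

lemma apply_eq (h : IsLadder G d c x y r l) (v : ι →₀ ℂ) :
    G v = v.sum fun i a => a • (Finsupp.single (r i) (x i) - Finsupp.single (l i) (y i)) := by
  conv_lhs => rw [← Finsupp.sum_single v]
  rw [map_finsuppSum]
  refine Finsupp.sum_congr fun i _ => ?_
  rw [← h.apply_single, ← map_smul, Finsupp.smul_single, smul_eq_mul, mul_one]

end IsLadder

variable [DecidableEq ι]

lemma l1_add (v w : ι →₀ ℂ) : l1 (v + w) ≤ l1 v + l1 w := by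
  rw [l1_eq (s := v.support ∪ w.support) Finsupp.support_add,
    l1_eq (s := v.support ∪ w.support) Finset.subset_union_left,
    l1_eq (s := v.support ∪ w.support) Finset.subset_union_right, ← Finset.sum_add_distrib]
  exact Finset.sum_le_sum fun i _ => norm_add_le _ _

lemma l1_sum_le {s : Finset ι} (f : ι → ι →₀ ℂ) : l1 (∑ i ∈ s, f i) ≤ ∑ i ∈ s, l1 (f i) := by
  induction s using Finset.induction_on with
  | empty => simp [l1]
  | insert a s ha ih =>
    rw [Finset.sum_insert ha, Finset.sum_insert ha]
    exact (l1_add _ _).trans (by gcongr)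

namespace IsLadder

lemma l1_apply_le (h : IsLadder G d c x y r l) {v : ι →₀ ℂ} {L : ℕ}
    (hv : ∀ i ∈ v.support, d i ≤ L) : l1 (G v) ≤ 2 * c * (L + 1) * l1 v := by
  have hc := h.pos
  rw [h.apply_eq, Finsupp.sum]
  refine (l1_sum_le _).trans ?_
  rw [l1, Finsupp.sum, Finset.mul_sum]
  refine Finset.sum_le_sum fun i hi => ?_
  rw [l1_smul, mul_comm, sub_eq_add_neg, ← Finsupp.single_neg]
  gcongr
  refine (l1_add _ _).trans ?_
  rw [l1_single, l1_single, norm_neg]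
  have h1 := h.norm_x i
  have h2 := h.norm_y i
  have h3 : c * (d i + 1) ≤ c * (L + 1) := by
    have : (d i : ℝ) ≤ L := by exact_mod_cast hv i hi
    gcongr
  linarith

lemma deg_apply (h : IsLadder G d c x y r l) {v : ι →₀ ℂ} {L : ℕ}
    (hv : ∀ i ∈ v.support, d i ≤ L) : ∀ i ∈ (G v).support, d i ≤ L + 2 := by
  intro k hk
  rw [h.apply_eq, Finsupp.sum] at hk
  obtain ⟨i, hi, hki⟩ := Finset.mem_biUnion.1 (Finsupp.support_finsetSum hk)
  have hki := Finsupp.support_smul hki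
  rcases Finset.mem_union.1 (Finsupp.support_sub hki) with hk' | hk'
  · have := Finset.mem_singleton.1 (Finsupp.support_single_subset hk')
    subst this
    exact (h.deg_r i).trans (by have := hv i hi; lia)
  · have := Finset.mem_singleton.1 (Finsupp.support_single_subset hk')
    subst this
    exact (h.deg_l i).trans (by have := hv i hi; lia)

lemma deg_pow (h : IsLadder G d c x y r l) {v : ι →₀ ℂ} {L : ℕ}
    (hv : ∀ i ∈ v.support, d i ≤ L) (n : ℕ) : ∀ i ∈ ((G ^ n) v).support, d i ≤ L + 2 * n := by
  induction n with
  | zero => simpa using hv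
  | succ n ih =>
    rw [pow_succ', Module.End.mul_apply]
    intro i hi
    have := h.deg_apply ih i hi
    lia

/-- Each application raises the degree by at most 2, so the factor at step n is at most 2c(L + 2n +
1) ≤ 4c(L + n + 1). The product of these factors is bounded by a factorial. -/
lemma l1_pow_le (h : IsLadder G d c x y r l) {v : ι →₀ ℂ} {L : ℕ}
    (hv : ∀ i ∈ v.support, d i ≤ L) (n : ℕ) :
    l1 ((G ^ n) v) ≤ l1 v * ((4 * c) ^ n * (L + n).factorial) := by
  have hc := h.pos
  induction n with
  | zero =>
    simp only [pow_zero, Module.End.one_apply, one_mul, Nat.add_zero]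
    refine le_mul_of_one_le_right (l1_nonneg v) ?_
    exact_mod_cast Nat.one_le_iff_ne_zero.2 (Nat.factorial_ne_zero _)
  | succ n ih =>
    rw [pow_succ', Module.End.mul_apply]
    refine (h.l1_apply_le (h.deg_pow hv n)).trans ?_
    have h0 := l1_nonneg v
    calc 2 * c * (((L + 2 * n : ℕ) : ℝ) + 1) * l1 ((G ^ n) v)
        ≤ 2 * c * (2 * (L + n + 1)) * (l1 v * ((4 * c) ^ n * (L + n).factorial)) := by
          have hL : (((L + 2 * n : ℕ) : ℝ) + 1) ≤ 2 * (L + n + 1) := by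
            push_cast
            have : (0 : ℝ) ≤ L := Nat.cast_nonneg _
            linarith
          have h1 := l1_nonneg ((G ^ n) v)
          gcongr
      _ = l1 v * ((4 * c) ^ (n + 1) * (L + (n + 1)).factorial) := by
          rw [← Nat.add_assoc, Nat.factorial_succ]
          push_cast
          ring

/-- The raising and lowering coefficients are conjugate wherever they do not vanish. Where `r` and
`l` fail to be mutually inverse, at the boundary of the index set, the coefficient is zero. -/
lemma inner_skew (h : IsLadder G d c x y r l) (v w : ι →₀ ℂ) :
    ⟪finVec (G v), finVec w⟫_ℂ = -⟪finVec v, finVec (G w)⟫_ℂ := by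
  have key : ∀ i j, (if r i = j then conj (x i) else 0) = if l j = i then y j else 0 := by
    intro i j
    by_cases hj : r i = j
    · subst hj
      rcases h.left_right i with h0 | ⟨h1, h2⟩
      · rw [h0]
        rcases h.right_left (r i) with h3 | ⟨h3, h4⟩
        · simp [h3]
        · by_cases hl : l (r i) = i
          · rw [hl, h0] at h4
            have : y (r i) = 0 := by simpa using h4.symm
            simp [this]
          · simp [hl]
      · simp [h1, h2]
    · rw [if_neg hj]
      by_cases hl : l j = i
      · subst hl
        rcases h.right_left j with h3 | ⟨h3, h4⟩
        · simp [h3]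
        · exact absurd h3 hj
      · simp [hl]
  have hb : ∀ i j, ⟪finVec (G (Finsupp.single i 1)), (ket j : Ell2 ι)⟫_ℂ =
      -⟪(ket i : Ell2 ι), finVec (G (Finsupp.single j 1))⟫_ℂ := by
    intro i j
    rw [inner_ket_right, inner_ket_left, finVec_apply, finVec_apply, h.apply_single,
      h.apply_single, Finsupp.sub_apply, Finsupp.sub_apply, Finsupp.single_apply,
      Finsupp.single_apply, Finsupp.single_apply, Finsupp.single_apply, map_sub]
    have k1 := key i j
    have k2 := congrArg conj (key j i)
    simp only [apply_ite (starRingEnd ℂ), map_zero, Complex.conj_conj] at k2 ⊢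
    rw [k1, ← k2]
    ring
  induction v using Finsupp.induction_linear with
  | zero => simp
  | add f g hf hg => simp only [map_add, inner_add_left, hf, hg]; ring
  | single i a =>
    induction w using Finsupp.induction_linear with
    | zero => simp
    | add f g hf hg => simp only [map_add, inner_add_right, hf, hg]; ring
    | single j b =>
      have hs : ∀ (i : ι) (a : ℂ), Finsupp.single i a = a • Finsupp.single i (1 : ℂ) := by simp
      rw [hs i, hs j]
      simp only [map_smul, inner_smul_left, inner_smul_right, finVec_single, one_smul]
      rw [hb]
      ring

lemma isAnalyticSkew (h : IsLadder G d c x y r l) : IsAnalyticSkew (finVec (ι := ι)) G (8 * c) where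
  pos := by have := h.pos; positivity
  dense := denseRange_finVec
  skew := h.inner_skew
  bound v := by
    have hc := h.pos
    obtain ⟨L, hL⟩ : ∃ L, ∀ i ∈ v.support, d i ≤ L := ⟨v.support.sup d, fun i hi => Finset.le_sup hi⟩
    refine ⟨l1 v * (2 ^ L * L.factorial), fun n => ?_⟩
    refine (norm_finVec_le _).trans ((h.l1_pow_le hL n).trans ?_)
    -- Bounding a binomial coefficient by 2^(L + n) separates n! from L!; this is what turns the
    -- rate 4c into 8c.
    have h1 : (L + n).factorial ≤ 2 ^ (L + n) * (L.factorial * n.factorial) := by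
      rw [← Nat.add_choose_mul_factorial_mul_factorial, mul_assoc]
      exact Nat.mul_le_mul_right _ (Nat.choose_le_two_pow _ _)
    have h2 : ((L + n).factorial : ℝ) ≤ 2 ^ (L + n) * (L.factorial * n.factorial) := by
      exact_mod_cast h1
    have h0 := l1_nonneg v
    calc l1 v * ((4 * c) ^ n * (L + n).factorial)
        ≤ l1 v * ((4 * c) ^ n * (2 ^ (L + n) * (L.factorial * n.factorial))) := by gcongr
      _ = l1 v * (2 ^ L * L.factorial) * ((8 * c) ^ n * n.factorial) := by
          rw [show 8 * c = 4 * c * 2 by ring, mul_pow (4 * c) 2, pow_add]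
          ring

end IsLadder

end Ladder

/-! ### Exponentials of ladder-type operators -/

section OpExp

variable {ι : Type} {G : Module.End ℂ (ι →₀ ℂ)} {K : ℝ}

lemma neg_pow_apply (G : Module.End ℂ (ι →₀ ℂ)) (n : ℕ) (v : ι →₀ ℂ) :
    ((-G) ^ n) v = ((-1 : ℂ) ^ n) • (G ^ n) v := by
  induction n with
  | zero => simp
  | succ n ih => simp [pow_succ', ih]

/-- The derivative of a coordinate is a combination of two coordinates, so by induction every
derivative of every coordinate vanishes at 0. Analyticity then replaces any uniqueness theorem for
the infinite linear system. -/
lemma eq_zero_of_ladder {x y : ι → ℂ} {r l : ι → ι} {g : ℝ → ι → ℂ} (hg : ∀ i, AnalyticOnNhd ℝ (fun t => g t i) Set.univ)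
    (hg' : ∀ t i, HasDerivAt (fun t => g t i) (conj (y i) * g t (l i) - conj (x i) * g t (r i)) t)
    (hg0 : ∀ i, g 0 i = 0) (t : ℝ) (i : ι) : g t i = 0 := by
  have hz : ∀ (n : ℕ) (i : ι), iteratedDeriv n (fun t => g t i) 0 = 0 := by
    intro n
    induction n with
    | zero => intro i; simp [hg0]
    | succ n ih =>
      intro i
      have hder : deriv (fun t => g t i) = fun t =>
          conj (y i) * g t (l i) - conj (x i) * g t (r i) := funext fun t => (hg' t i).deriv
      have hsm : ∀ i, ContDiffAt ℝ n (fun t => g t i) 0 := fun i => (hg i 0 trivial).contDiffAt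
      rw [iteratedDeriv_succ', hder, iteratedDeriv_fun_sub (contDiffAt_const.mul (hsm _))
        (contDiffAt_const.mul (hsm _)), iteratedDeriv_const_mul_field,
        iteratedDeriv_const_mul_field, ih, ih]
      simp
  have hev : ∀ᶠ t in 𝓝 0, g t i = 0 := by
    rw [← analyticOrderAt_eq_top]
    refine ENat.eq_top_iff_forall_ge.2 fun n => ?_
    rw [natCast_le_analyticOrderAt_iff_iteratedDeriv_eq_zero (hg i 0 trivial)]
    exact fun k _ => hz k i
  exact (hg i).eqOn_zero_of_preconnected_of_eventuallyEq_zero isPreconnected_univ (Set.mem_univ 0)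
    hev (Set.mem_univ t)

variable [DecidableEq ι]
  {U : ℝ → (Ell2 ι →L[ℂ] Ell2 ι)}

lemma IsAnalyticSkew.isUnitaryGroupOf (h : IsAnalyticSkew (finVec (ι := ι)) G K) :
    IsUnitaryGroupOf G h.group where
  map_zero := by rw [h.group_eq_localExp (by simp), h.localExp_zero]
  map_add := h.group_add
  mem_unitary := h.group_mem_unitary
  continuous := h.continuous_group
  hasDerivAt := h.hasDerivAt_group

/-- `opExp` picks an unspecified group, so all orbits below are computed for an arbitrary group
whose generator extends `G`. -/
lemma IsAnalyticSkew.exists_opExp_eq (h : IsAnalyticSkew (finVec (ι := ι)) G K) :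
    ∃ U : ℝ → (Ell2 ι →L[ℂ] Ell2 ι), IsUnitaryGroupOf G U ∧ opExp G = U 1 := by
  have hex : ∃ U : ℝ → (Ell2 ι →L[ℂ] Ell2 ι), IsUnitaryGroupOf G U := ⟨_, h.isUnitaryGroupOf⟩
  exact ⟨hex.choose, hex.choose_spec, by rw [opExp, dif_pos hex]⟩

namespace IsUnitaryGroupOf

lemma norm_apply (hU : IsUnitaryGroupOf G U) (t : ℝ) (ψ : Ell2 ι) : ‖U t ψ‖ = ‖ψ‖ :=
  ContinuousLinearMap.norm_map_of_mem_unitary (hU.mem_unitary t) ψ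

lemma hasDerivAt_apply (hU : IsUnitaryGroupOf G U) (v : ι →₀ ℂ) (t : ℝ) :
    HasDerivAt (fun s => U s (finVec v)) (U t (finVec (G v))) t := by
  have h1 : HasDerivAt (fun s => U (s - t) (finVec v)) (finVec (G v)) t := by
    have := HasDerivAt.comp_sub_const t t (f := fun s => U s (finVec v)) (f' := finVec (G v))
      (by simpa using hU.hasDerivAt v)
    exact this
  have h2 := ((U t).restrictScalars ℝ).hasFDerivAt.comp_hasDerivAt t h1
  refine h2.congr_of_eventuallyEq (Eventually.of_forall fun s => ?_)
  simp only [Function.comp, ContinuousLinearMap.coe_restrictScalars']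
  rw [← mul_apply_eq_comp, ← hU.map_add]
  simp

/-- The time derivative of the remainder of order n + 1 at `v` is the remainder of order n at `G v`.
Unitarity gives order 0, and comparison of derivatives integrates the bound. -/
lemma norm_taylor_le (hU : IsUnitaryGroupOf G U) (n : ℕ) (v : ι →₀ ℂ) {t : ℝ} (ht : 0 ≤ t) :
    ‖U t (finVec v) - ∑ k ∈ Finset.range n, expTerm finVec G t v k‖ ≤
      t ^ n / n.factorial * ‖(finVec ((G ^ n) v) : Ell2 ι)‖ := by
  induction n generalizing v t with
  | zero => simp [hU.norm_apply]
  | succ n ih =>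
    have hterm : ∀ (s : ℝ) (k : ℕ), HasDerivAt (fun s => expTerm (finVec (ι := ι)) G s v (k + 1))
        (expTerm finVec G s (G v) k) s := by
      intro s k
      have h1 : HasDerivAt (fun s : ℝ => s ^ (k + 1) / ((k + 1).factorial : ℝ))
          (s ^ k / (k.factorial : ℝ)) s := by
        refine ((hasDerivAt_pow (k + 1) s).div_const ((k + 1).factorial : ℝ)).congr_deriv ?_
        rw [Nat.factorial_succ]
        push_cast
        have : (0 : ℝ) < k.factorial := by positivity
        field_simp
      have h2 := h1.ofReal_comp.smul_const (finVec ((G ^ (k + 1)) v) : Ell2 ι)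
      rw [expTerm, ← Module.End.mul_apply, ← pow_succ]
      exact h2
    have hd : ∀ s : ℝ, HasDerivAt
        (fun s => U s (finVec v) - ∑ k ∈ Finset.range (n + 1), expTerm finVec G s v k)
        (U s (finVec (G v)) - ∑ k ∈ Finset.range n, expTerm finVec G s (G v) k) s := by
      intro s
      simp_rw [Finset.sum_range_succ']
      refine (hU.hasDerivAt_apply v s).sub ?_
      have := (HasDerivAt.fun_sum fun k (_ : k ∈ Finset.range n) => hterm s k).add
        (hasDerivAt_const s (finVec v : Ell2 ι))
      rw [add_zero] at this
      refine this.congr_of_eventuallyEq (Eventually.of_forall fun s => ?_)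
      simp [expTerm]
    have hB : ∀ s : ℝ, HasDerivAt
        (fun s => s ^ (n + 1) / (n + 1).factorial * ‖(finVec ((G ^ (n + 1)) v) : Ell2 ι)‖)
        (s ^ n / n.factorial * ‖(finVec ((G ^ n) (G v)) : Ell2 ι)‖) s := by
      intro s
      rw [← Module.End.mul_apply, ← pow_succ]
      refine HasDerivAt.mul_const ?_ _
      refine ((hasDerivAt_pow (n + 1) s).div_const ((n + 1).factorial : ℝ)).congr_deriv ?_
      rw [Nat.factorial_succ]
      push_cast
      have : (0 : ℝ) < n.factorial := by positivity
      field_simp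
    refine image_norm_le_of_norm_deriv_right_le_deriv_boundary (a := 0) (b := t)
      (f' := fun s => U s (finVec (G v)) - ∑ k ∈ Finset.range n, expTerm finVec G s (G v) k)
      (fun s _ => (hd s).continuousAt.continuousWithinAt) (fun s _ => (hd s).hasDerivWithinAt)
      ?_ hB (fun s hs => ih (G v) hs.1) ⟨ht, le_rfl⟩
    rw [Finset.sum_range_succ']
    simp [expTerm, hU.map_zero]

lemma neg (hU : IsUnitaryGroupOf G U) : IsUnitaryGroupOf (-G) fun t => U (-t) where
  map_zero := by simp [hU.map_zero]
  map_add s t := by rw [neg_add, hU.map_add]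
  mem_unitary t := hU.mem_unitary _
  continuous ψ := (hU.continuous ψ).comp continuous_neg
  hasDerivAt v := by
    have h := HasDerivAt.scomp (h := fun t : ℝ => -t) (h' := -1) (0 : ℝ)
      (by simpa using hU.hasDerivAt v) (hasDerivAt_neg 0)
    simpa [Function.comp_def] using h

/-- The Taylor remainder is bounded by the norm of a term of a convergent series. The estimate is
one-sided in time; negative times are handled by the reversed group, generated by `-G`. -/
lemma hasSum_expTerm (hU : IsUnitaryGroupOf G U) (h : IsAnalyticSkew (finVec (ι := ι)) G K)
    (v : ι →₀ ℂ) {t : ℝ} (ht : |t| * K < 1) :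
    HasSum (expTerm finVec G t v) (U t (finVec v)) := by
  have main : ∀ {G : Module.End ℂ (ι →₀ ℂ)} {U : ℝ → (Ell2 ι →L[ℂ] Ell2 ι)}
      (_ : IsUnitaryGroupOf G U) (_ : IsAnalyticSkew (finVec (ι := ι)) G K) {t : ℝ} (_ : 0 ≤ t)
      (_ : |t| * K < 1), HasSum (expTerm finVec G t v) (U t (finVec v)) := by
    intro G U hU h t h0 ht
    refine (hasSum_iff_tendsto_nat_of_summable_norm (h.summable_norm_expTerm ht v)).2 ?_
    rw [tendsto_iff_norm_sub_tendsto_zero]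
    refine squeeze_zero (fun _ => norm_nonneg _) (fun n => ?_)
      (h.summable_norm_expTerm ht v).tendsto_atTop_zero
    rw [norm_sub_rev]
    refine (hU.norm_taylor_le n v h0).trans_eq ?_
    rw [expTerm, norm_smul, Complex.norm_real, Real.norm_of_nonneg (by positivity)]
  rcases le_total 0 t with h0 | h0
  · exact main hU h h0 ht
  · have h' : IsAnalyticSkew (finVec (ι := ι)) (-G) K :=
      { pos := h.pos
        dense := h.dense
        skew := fun v w => by simp [h.skew]
        bound := fun v => by
          obtain ⟨C, hC⟩ := h.bound v
          refine ⟨C, fun n => ?_⟩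
          rw [neg_pow_apply, map_smul, norm_smul]
          simpa using hC n }
    have := main hU.neg h' (t := -t) (by linarith) (by simpa using ht)
    rw [neg_neg] at this
    refine this.congr_fun fun n => ?_
    rw [expTerm, expTerm, neg_pow t, neg_pow_apply, map_smul, smul_smul]
    congr 1
    push_cast
    have h1 : ((-1 : ℂ) ^ n) * (-1) ^ n = 1 := by rw [← mul_pow]; simp
    linear_combination (-(t : ℂ) ^ n / n.factorial) * h1

lemma analyticAt_apply (hU : IsUnitaryGroupOf G U) (h : IsAnalyticSkew (finVec (ι := ι)) G K)
    (v : ι →₀ ℂ) (t : ℝ) : AnalyticAt ℝ (fun s => U s (finVec v)) t := by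
  have h0 : AnalyticAt ℝ (fun s => U s (finVec v)) 0 :=
    (h.hasFPowerSeriesOnBall fun t ht => hU.hasSum_expTerm h v ht).analyticAt
  have h1 : AnalyticAt ℝ (fun s => U (s - t) (finVec v)) t := by
    refine AnalyticAt.fun_comp (g := fun s => U s (finVec v)) (f := fun s => s - t) ?_ (by fun_prop)
    simpa using h0
  have h2 := (((U t).restrictScalars ℝ).analyticAt _).comp h1
  refine h2.congr (Eventually.of_forall fun s => ?_)
  simp only [Function.comp, ContinuousLinearMap.coe_restrictScalars']
  rw [← mul_apply_eq_comp, ← hU.map_add]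
  simp

/-- Moving the group onto a number state, which is an analytic vector, gives coordinates analytic in
time for every `ψ`, with no domain condition. -/
lemma coe_apply_eq (hU : IsUnitaryGroupOf G U) (t : ℝ) (ψ : Ell2 ι) (i : ι) :
    (U t ψ) i = conj ⟪ψ, U (-t) (finVec (Finsupp.single i 1))⟫_ℂ := by
  rw [inner_conj_symm, finVec_single, one_smul, ← inner_ket_left,
    ← ContinuousLinearMap.inner_map_map_of_mem_unitary (hU.mem_unitary (-t)) (ket i),
    ← mul_apply_eq_comp, ← hU.map_add, neg_add_cancel, hU.map_zero, one_apply_eq_self]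

end IsUnitaryGroupOf

variable {d : ι → ℕ} {c : ℝ} {x y : ι → ℂ} {r l : ι → ι}

/-- A family of coordinates which solves the evolution equation of a ladder-type operator and is
analytic in time is the orbit of its initial vector. -/
lemma IsUnitaryGroupOf.apply_eq_of_ladder (hU : IsUnitaryGroupOf G U)
    (h : IsLadder G d c x y r l) {f : ℝ → ι → ℂ} {ψ : Ell2 ι}
    (hf : ∀ i, AnalyticOnNhd ℝ (fun t => f t i) Set.univ)
    (hf' : ∀ t i, HasDerivAt (fun t => f t i) (conj (y i) * f t (l i) - conj (x i) * f t (r i)) t)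
    (hf0 : ∀ i, f 0 i = ψ i) (t : ℝ) (i : ι) : (U t ψ) i = f t i := by
  have hs := h.isAnalyticSkew
  have hcan : ∀ i, AnalyticOnNhd ℝ (fun t => (U t ψ) i) Set.univ := by
    intro i s _
    have h1 : AnalyticAt ℝ (fun t => U (-t) (finVec (Finsupp.single i 1))) s :=
      AnalyticAt.fun_comp (hU.analyticAt_apply hs _ (-s)) (by fun_prop)
    have h2 := ((Complex.conjCLE.toContinuousLinearMap.comp
      ((innerSL ℂ ψ).restrictScalars ℝ)).analyticAt _).comp h1
    refine h2.congr (Eventually.of_forall fun s => ?_)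
    simp [hU.coe_apply_eq]
  have hcd : ∀ t i, HasDerivAt (fun t => (U t ψ) i)
      (conj (y i) * (U t ψ) (l i) - conj (x i) * (U t ψ) (r i)) t := by
    intro t i
    have h1 := HasDerivAt.scomp (h := fun t : ℝ => -t) (h' := -1) t
      (hU.hasDerivAt_apply (Finsupp.single i 1) (-t)) (hasDerivAt_neg t)
    have h2 := (Complex.conjCLE.toContinuousLinearMap.comp
      ((innerSL ℂ ψ).restrictScalars ℝ)).hasFDerivAt.comp_hasDerivAt t h1
    have h3 := h2.congr_of_eventuallyEq (f₁ := fun t => (U t ψ) i)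
      (Eventually.of_forall fun s => by simp [hU.coe_apply_eq])
    refine h3.congr_deriv ?_
    have hs' : ∀ (i : ι) (a : ℂ), Finsupp.single i a = a • Finsupp.single i (1 : ℂ) := by simp
    rw [hU.coe_apply_eq, hU.coe_apply_eq, h.apply_single, hs' (r i) (x i), hs' (l i) (y i)]
    simp only [ContinuousLinearMap.comp_apply, ContinuousLinearMap.coe_restrictScalars',
      innerSL_apply_apply, map_sub, map_smul, neg_smul, one_smul, ContinuousLinearEquiv.coe_coe,
      Complex.conjCLE_apply, map_neg]
    rw [smul_eq_mul, smul_eq_mul, map_mul, map_mul]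
    ring
  -- The difference of the true and the proposed coordinates is analytic, solves the homogeneous
  -- ladder system and starts at 0.
  exact sub_eq_zero.1 (eq_zero_of_ladder (y := y) (x := x) (l := l) (r := r)
    (g := fun t i => (U t ψ) i - f t i) (fun i s hs => (hcan i s hs).sub (hf i s hs))
    (fun t i => ((hcd t i).sub (hf' t i)).congr_deriv (by ring))
    (fun i => by simp [hf0, hU.map_zero]) t i)

end OpExp

/-! ### Exponential vectors -/

/-- The square root of `n!` as a complex number. -/
def sqrtFact (n : ℕ) : ℂ := ((√(n.factorial : ℝ) : ℝ) : ℂ)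

lemma sqrtFact_ne_zero (n : ℕ) : sqrtFact n ≠ 0 := by
  rw [sqrtFact, Complex.ofReal_ne_zero]
  positivity

lemma sqrtFact_zero : sqrtFact 0 = 1 := by simp [sqrtFact]

lemma sqrtFact_succ (n : ℕ) : sqrtFact (n + 1) = ((√((n : ℝ) + 1) : ℝ) : ℂ) * sqrtFact n := by
  rw [sqrtFact, sqrtFact, ← Complex.ofReal_mul, ← Real.sqrt_mul (by positivity), Nat.factorial_succ]
  push_cast
  rfl

lemma sqrtFact_sq (n : ℕ) : sqrtFact n * sqrtFact n = n.factorial := by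
  rw [sqrtFact, ← Complex.ofReal_mul, Real.mul_self_sqrt (by positivity)]
  simp

lemma conj_sqrtFact (n : ℕ) : conj (sqrtFact n) = sqrtFact n := Complex.conj_ofReal _

lemma norm_sqrtFact (n : ℕ) : ‖sqrtFact n‖ = √(n.factorial : ℝ) := by
  rw [sqrtFact, Complex.norm_real, Real.norm_of_nonneg (by positivity)]

/-- The exponential vector (unnormalised coherent state) `∑ₙ γⁿ/√n! |n⟩`. -/
def expVec (γ : ℂ) : Fock := ((Real.exp (‖γ‖ ^ 2 / 2) : ℝ) : ℂ) • coherent γ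

lemma expVec_apply (γ : ℂ) (n : ℕ) : expVec γ n = γ ^ n / sqrtFact n := by
  have h : ((Real.exp (‖γ‖ ^ 2 / 2) : ℝ) : ℂ) * ((Real.exp (-‖γ‖ ^ 2 / 2) : ℝ) : ℂ) = 1 := by
    rw [← Complex.ofReal_mul, ← Real.exp_add, neg_div, add_neg_cancel, Real.exp_zero,
      Complex.ofReal_one]
  change ((Real.exp (‖γ‖ ^ 2 / 2) : ℝ) : ℂ) *
    (((Real.exp (-‖γ‖ ^ 2 / 2) : ℝ) : ℂ) * γ ^ n / sqrtFact n) = _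
  rw [← mul_div_assoc, ← mul_assoc, h, one_mul]

lemma coherent_eq (γ : ℂ) : coherent γ = ((Real.exp (-‖γ‖ ^ 2 / 2) : ℝ) : ℂ) • expVec γ := by
  rw [expVec, smul_smul, ← Complex.ofReal_mul, ← Real.exp_add, neg_div, neg_add_cancel,
    Real.exp_zero, Complex.ofReal_one, one_smul]

lemma hasSum_inner_expVec (ψ : Fock) (γ : ℂ) :
    HasSum (fun n => conj (ψ n) * γ ^ n / sqrtFact n) ⟪ψ, expVec γ⟫_ℂ := by
  refine (lp.hasSum_inner ψ (expVec γ)).congr_fun fun n => ?_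
  rw [expVec_apply, RCLike.inner_apply]
  ring

lemma inner_expVec (a b : ℂ) : ⟪expVec a, expVec b⟫_ℂ = Complex.exp (conj a * b) := by
  refine (hasSum_inner_expVec _ b).unique ?_
  have h := NormedSpace.expSeries_div_hasSum_exp (conj a * b)
  rw [← Complex.exp_eq_exp_ℂ] at h
  refine h.congr_fun fun n => ?_
  rw [expVec_apply, map_div₀, conj_sqrtFact, map_pow, ← sqrtFact_sq, mul_pow]
  have := sqrtFact_ne_zero n
  field_simp

/-- Real `γ` suffice: along them the inner product is a power series with coefficients conj ψₙ /
√n!, and a vanishing power series has vanishing coefficients. -/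
lemma eq_zero_of_inner_expVec {ψ : Fock} (h : ∀ γ, ⟪ψ, expVec γ⟫_ℂ = 0) : ψ = 0 := by
  have hp := hasFPowerSeriesOnBall_of_hasSum (f := fun _ : ℝ => (0 : ℂ))
    (a := fun n => conj (ψ n) / sqrtFact n) (C := ‖ψ‖) (K := 1) one_pos (fun n => ?_) fun t _ => ?_
  · ext n
    have h0 := congrFun hp.hasFPowerSeriesAt.eq_zero n
    have h1 : conj (ψ n) / sqrtFact n = 0 :=
      (ContinuousMultilinearMap.mkPiRing_eq_zero_iff _).1 h0
    simpa [sqrtFact_ne_zero] using h1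
  · rw [norm_div, norm_sqrtFact, RCLike.norm_conj, one_pow, mul_one]
    have h1 : 1 ≤ √(n.factorial : ℝ) := by
      rw [Real.one_le_sqrt]
      exact_mod_cast Nat.one_le_iff_ne_zero.2 (Nat.factorial_ne_zero _)
    exact (div_le_self (norm_nonneg _) h1).trans (lp.norm_apply_le_norm (by norm_num) ψ n)
  · have h1 := hasSum_inner_expVec ψ t
    rw [h] at h1
    refine h1.congr_fun fun n => ?_
    rw [← Complex.coe_smul]
    push_cast
    rw [smul_eq_mul]
    ring

lemma dense_span_expVec : Dense (Submodule.span ℂ (Set.range expVec) : Set Fock) := by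
  rw [Submodule.dense_iff_topologicalClosure_eq_top, Submodule.topologicalClosure_eq_top_iff,
    Submodule.eq_bot_iff]
  intro ψ hψ
  refine eq_zero_of_inner_expVec fun γ => ?_
  rw [Submodule.mem_orthogonal'] at hψ
  exact hψ _ (Submodule.subset_span ⟨γ, rfl⟩)

lemma continuous_expVec : Continuous expVec := by
  rw [continuous_iff_continuousAt]
  intro γ
  rw [ContinuousAt, tendsto_iff_norm_sub_tendsto_zero]
  have h1 : Continuous fun a : ℂ => √(RCLike.re (⟪expVec a - expVec γ, expVec a - expVec γ⟫_ℂ)) := by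
    simp only [inner_sub_left, inner_sub_right, inner_expVec]
    fun_prop
  have h2 := h1.tendsto γ
  simp only [← @norm_eq_sqrt_re_inner ℂ, sub_self, norm_zero] at h2
  exact h2

lemma continuous_coherent : Continuous coherent := by
  rw [funext coherent_eq]
  have h : Continuous fun γ : ℂ => ((Real.exp (-‖γ‖ ^ 2 / 2) : ℝ) : ℂ) := by fun_prop
  exact h.smul continuous_expVec

lemma inner_coherent_expVec (α γ : ℂ) :
    ⟪coherent α, expVec γ⟫_ℂ = Complex.exp (-‖α‖ ^ 2 / 2 + conj α * γ) := by
  rw [coherent_eq, inner_smul_left, inner_expVec, Complex.conj_ofReal, Complex.exp_add]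
  push_cast
  rfl

lemma inner_expVec_coherent (α γ : ℂ) :
    ⟪expVec γ, coherent α⟫_ℂ = Complex.exp (-‖α‖ ^ 2 / 2 + conj γ * α) := by
  rw [coherent_eq, inner_smul_right, inner_expVec, Complex.exp_add]
  push_cast
  rfl

lemma norm_coherent (α : ℂ) : ‖coherent α‖ = 1 := by
  rw [@norm_eq_sqrt_re_inner ℂ, coherent_eq, inner_smul_left, inner_smul_right, inner_expVec,
    Complex.conj_ofReal, ← mul_assoc, ← Complex.ofReal_mul, ← Real.exp_add,
    ← Complex.normSq_eq_conj_mul_self, Complex.normSq_eq_norm_sq, ← Complex.ofReal_exp,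
    ← Complex.ofReal_mul, ← Real.exp_add]
  simp

/-! ### Displacement operators -/

lemma annihilate_single (n : ℕ) :
    annihilate (Finsupp.single n 1) = Finsupp.single (n - 1) ((√(n : ℝ) : ℝ) : ℂ) := by
  simp [annihilate]

lemma create_single (n : ℕ) :
    create (Finsupp.single n 1) = Finsupp.single (n + 1) ((√((n : ℝ) + 1) : ℝ) : ℂ) := by
  simp [create]

lemma sqrt_le_add_one (n : ℕ) : √((n : ℝ) + 1) ≤ n + 1 := by
  rw [Real.sqrt_le_left (by positivity)]
  have : (0 : ℝ) ≤ n := Nat.cast_nonneg n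
  nlinarith

/-- The generator of the displacement operators. -/
def displacementGen (β : ℂ) : Module.End ℂ (ℕ →₀ ℂ) := β • create - conj β • annihilate

lemma isLadder_displacementGen (β : ℂ) :
    IsLadder (displacementGen β) id (‖β‖ + 1) (fun n => β * ((√((n : ℝ) + 1) : ℝ) : ℂ))
      (fun n => conj β * ((√(n : ℝ) : ℝ) : ℂ)) (· + 1) (· - 1) where
  pos := by positivity
  apply_single n := by
    simp [displacementGen, create_single, annihilate_single]
  norm_x n := by
    rw [norm_mul, Complex.norm_real, Real.norm_of_nonneg (by positivity)]
    have := sqrt_le_add_one n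
    simp only [id]
    gcongr
    linarith
  norm_y n := by
    rw [norm_mul, Complex.norm_real, Real.norm_of_nonneg (by positivity), RCLike.norm_conj]
    have := sqrt_le_add_one n
    have h2 : √(n : ℝ) ≤ √((n : ℝ) + 1) := by gcongr; linarith
    simp only [id]
    gcongr
    · linarith
    · linarith
  deg_r n := by simp
  deg_l n := by simp only [id]; lia
  left_right n := by right; simp
  right_left n := by
    cases n with
    | zero => simp
    | succ n => right; simp

lemma analyticOnNhd_comp_ofReal {F : ℂ → ℂ} (hF : Differentiable ℂ F) :
    AnalyticOnNhd ℝ (fun t : ℝ => F t) Set.univ := fun t _ =>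
  AnalyticAt.fun_comp (g := F) (f := fun t : ℝ => (t : ℂ)) (hF.analyticAt _).restrictScalars
    (Complex.ofRealCLM.analyticAt t)

lemma sqrt_mul_pow_div_succ (z : ℂ) (n : ℕ) :
    ((√((n : ℝ) + 1) : ℝ) : ℂ) * (z ^ (n + 1) / sqrtFact (n + 1)) = z * (z ^ n / sqrtFact n) := by
  have h0 := sqrtFact_ne_zero n
  have h1 := sqrtFact_ne_zero (n + 1)
  rw [sqrtFact_succ] at h1 ⊢
  have h2 := left_ne_zero_of_mul h1
  rw [pow_succ]
  field_simp

lemma sqrt_mul_pow_div_pred (z : ℂ) (n : ℕ) :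
    ((√(n : ℝ) : ℝ) : ℂ) * (z ^ (n - 1) / sqrtFact (n - 1)) = n * z ^ (n - 1) / sqrtFact n := by
  have h0 := sqrtFact_ne_zero n
  cases n with
  | zero => simp
  | succ n =>
    have h3 := sqrtFact_ne_zero n
    rw [sqrtFact_succ] at h0 ⊢
    have h2 := left_ne_zero_of_mul h0
    have h4 : ((√((n : ℝ) + 1) : ℝ) : ℂ) * ((√((n : ℝ) + 1) : ℝ) : ℂ) = n + 1 := by
      rw [← Complex.ofReal_mul, Real.mul_self_sqrt (by positivity)]; simp
    push_cast
    rw [mul_div_assoc', div_eq_div_iff h3 h0]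
    linear_combination (z ^ n * sqrtFact n) * h4

/-- The ansatz exp(c(t)) · `expVec (γ + t * β)` solves the ladder system when c' = -t|β|² - β*γ: the
creation part comes from moving the argument, the annihilation part from the scalar factor. -/
lemma displacementGroup_expVec {β : ℂ} {U : ℝ → (Fock →L[ℂ] Fock)}
    (hU : IsUnitaryGroupOf (displacementGen β) U) (t : ℝ) (γ : ℂ) :
    U t (expVec γ) =
      Complex.exp (-(t ^ 2 * (β * conj β) / 2) - t * conj β * γ) • expVec (γ + t * β) := by
  have hd : ∀ (z : ℂ) (n : ℕ), HasDerivAt (fun z : ℂ =>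
      Complex.exp (-(z ^ 2 * (β * conj β) / 2) - z * conj β * γ) * ((γ + z * β) ^ n / sqrtFact n))
      (Complex.exp (-(z ^ 2 * (β * conj β) / 2) - z * conj β * γ) *
        (-(z * (β * conj β)) - conj β * γ) * ((γ + z * β) ^ n / sqrtFact n) +
        Complex.exp (-(z ^ 2 * (β * conj β) / 2) - z * conj β * γ) *
          (n * (γ + z * β) ^ (n - 1) * β / sqrtFact n)) z := by
    intro z n
    have h1 : HasDerivAt (fun z : ℂ => -(z ^ 2 * (β * conj β) / 2) - z * conj β * γ)
        (-(z * (β * conj β)) - conj β * γ) z := by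
      have h := ((((hasDerivAt_pow 2 z).mul_const (β * conj β)).div_const 2).neg).sub
        (((hasDerivAt_id z).mul_const (conj β)).mul_const γ)
      refine h.congr_deriv ?_
      simp
      ring
    have h2 : HasDerivAt (fun z : ℂ => γ + z * β) β z := by
      simpa using ((hasDerivAt_id z).mul_const β).const_add γ
    exact h1.cexp.mul ((h2.pow n).div_const _)
  ext n
  rw [lp.coeFn_smul, Pi.smul_apply, expVec_apply, smul_eq_mul]
  refine hU.apply_eq_of_ladder (isLadder_displacementGen β) (f := fun t n =>
    Complex.exp (-(t ^ 2 * (β * conj β) / 2) - t * conj β * γ) * ((γ + t * β) ^ n / sqrtFact n))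
    (fun n => ?_) (fun t n => ?_) (fun n => ?_) t n
  · exact analyticOnNhd_comp_ofReal (fun z => (hd z n).differentiableAt)
  · refine (hd t n).comp_ofReal.congr_deriv ?_
    have e1 := sqrt_mul_pow_div_succ (γ + t * β) n
    have e2 := sqrt_mul_pow_div_pred (γ + t * β) n
    simp only [map_mul, Complex.conj_conj, Complex.conj_ofReal]
    linear_combination (-β * Complex.exp (-(t ^ 2 * (β * conj β) / 2) - t * conj β * γ)) * e2 +
      conj β * Complex.exp (-(t ^ 2 * (β * conj β) / 2) - t * conj β * γ) * e1
  · simp [expVec_apply]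

lemma exists_displacement_eq (β : ℂ) :
    ∃ U, IsUnitaryGroupOf (displacementGen β) U ∧ displacement β = U 1 :=
  (isLadder_displacementGen β).isAnalyticSkew.exists_opExp_eq

lemma displacement_expVec (β γ : ℂ) : displacement β (expVec γ) =
    Complex.exp (-(β * conj β / 2) - conj β * γ) • expVec (γ + β) := by
  obtain ⟨U, hU, h⟩ := exists_displacement_eq β
  rw [h, displacementGroup_expVec hU]
  simp

lemma displacement_mem_unitary (β : ℂ) : displacement β ∈ unitary (Fock →L[ℂ] Fock) := by
  obtain ⟨U, hU, h⟩ := exists_displacement_eq β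
  rw [h]
  exact hU.mem_unitary 1

lemma norm_displacement_apply (β : ℂ) (ψ : Fock) : ‖displacement β ψ‖ = ‖ψ‖ :=
  ContinuousLinearMap.norm_map_of_mem_unitary (displacement_mem_unitary β) ψ

lemma norm_displacement_le (β : ℂ) : ‖displacement β‖ ≤ 1 :=
  ContinuousLinearMap.opNorm_le_bound _ zero_le_one fun ψ => by
    rw [norm_displacement_apply, one_mul]

lemma ext_expVec {S T : Fock →L[ℂ] Fock} (h : ∀ γ, S (expVec γ) = T (expVec γ)) : S = T :=
  ContinuousLinearMap.ext_on dense_span_expVec (by rintro _ ⟨γ, rfl⟩; exact h γ)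

/-- Weyl's form of the canonical commutation relations. -/
lemma displacement_mul (β γ : ℂ) : displacement β * displacement γ =
    Complex.exp ((β * conj γ - conj β * γ) / 2) • displacement (β + γ) := by
  refine ext_expVec fun ζ => ?_
  rw [mul_apply_eq_comp, smul_apply, displacement_expVec, displacement_expVec, map_smul,
    displacement_expVec, smul_smul, smul_smul, ← Complex.exp_add, ← Complex.exp_add, add_assoc ζ,
    add_comm γ β]
  congr 2
  rw [map_add]
  ring

lemma displacement_zero : displacement 0 = 1 :=
  ext_expVec fun γ => by simp [displacement_expVec]

lemma displacement_ofReal_mul {β : ℂ} {U : ℝ → (Fock →L[ℂ] Fock)}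
    (hU : IsUnitaryGroupOf (displacementGen β) U) (t : ℝ) : displacement (t * β) = U t := by
  refine ext_expVec fun γ => ?_
  rw [displacement_expVec, displacementGroup_expVec hU, map_mul, Complex.conj_ofReal]
  congr 2
  ring

lemma continuous_displacement (ψ : Fock) : Continuous fun β => displacement β ψ := by
  refine continuous_apply_of_dense displacement 1 norm_displacement_le dense_span_expVec ?_ ψ
  rintro _ ⟨γ, rfl⟩
  simp_rw [displacement_expVec]
  have h : Continuous fun β : ℂ => Complex.exp (-(β * conj β / 2) - conj β * γ) := by fun_prop
  exact h.smul (continuous_expVec.comp (by fun_prop))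

lemma adjoint_displacement (β : ℂ) : (displacement β).adjoint = displacement (-β) := by
  have h1 : displacement β * displacement (-β) = 1 := by
    rw [displacement_mul]
    simp [displacement_zero]
    ring_nf
    simp
  have h2 : star (displacement β) * displacement β = 1 :=
    Unitary.star_mul_self_of_mem (displacement_mem_unitary β)
  calc (displacement β).adjoint = star (displacement β) * (displacement β * displacement (-β)) := by
        rw [h1, mul_one]; rfl
    _ = displacement (-β) := by rw [← mul_assoc, h2, one_mul]

lemma hasDerivAt_displacement (β : ℂ) (v : ℕ →₀ ℂ) :
    HasDerivAt (fun t : ℝ => displacement (t * β) (finVec v)) (finVec (displacementGen β v)) 0 := by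
  obtain ⟨U, hU, -⟩ := exists_displacement_eq β
  simp_rw [displacement_ofReal_mul hU]
  exact hU.hasDerivAt v

/-! ### Beam splitter and two-mode squeezing -/

lemma create₁_single (m n : ℕ) :
    create₁ (Finsupp.single (m, n) 1) = Finsupp.single (m + 1, n) ((√((m : ℝ) + 1) : ℝ) : ℂ) := by
  simp [create₁]

lemma create₂_single (m n : ℕ) :
    create₂ (Finsupp.single (m, n) 1) = Finsupp.single (m, n + 1) ((√((n : ℝ) + 1) : ℝ) : ℂ) := by
  simp [create₂]

lemma annihilate₁_single (m n : ℕ) :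
    annihilate₁ (Finsupp.single (m, n) 1) = Finsupp.single (m - 1, n) ((√(m : ℝ) : ℝ) : ℂ) := by
  simp [annihilate₁]

lemma annihilate₂_single (m n : ℕ) :
    annihilate₂ (Finsupp.single (m, n) 1) = Finsupp.single (m, n - 1) ((√(n : ℝ) : ℝ) : ℂ) := by
  simp [annihilate₂]

lemma apply_single_eq {ι : Type} (G : Module.End ℂ (ι →₀ ℂ)) (i : ι) (c : ℂ) :
    G (Finsupp.single i c) = c • G (Finsupp.single i 1) := by
  rw [← map_smul, Finsupp.smul_single, smul_eq_mul, mul_one]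

lemma sqrt_mul_sqrt_le {a b c : ℝ} (ha : 0 ≤ a) (hb : 0 ≤ b) (h : a + b ≤ 2 * c) :
    √a * √b ≤ c := by
  nlinarith [sq_nonneg (√a - √b), Real.sq_sqrt ha, Real.sq_sqrt hb]

lemma isLadder_beamSplitter : IsLadder (create₁ * annihilate₂ - annihilate₁ * create₂)
    (fun p => p.1 + p.2) 1
    (fun p => ((√(p.2 : ℝ) : ℝ) : ℂ) * ((√((p.1 : ℝ) + 1) : ℝ) : ℂ))
    (fun p => ((√(p.1 : ℝ) : ℝ) : ℂ) * ((√((p.2 : ℝ) + 1) : ℝ) : ℂ))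
    (fun p => (p.1 + 1, p.2 - 1)) (fun p => (p.1 - 1, p.2 + 1)) where
  pos := one_pos
  apply_single p := by
    rw [LinearMap.sub_apply, Module.End.mul_apply, Module.End.mul_apply, annihilate₂_single,
      create₂_single, apply_single_eq create₁, apply_single_eq annihilate₁, create₁_single,
      annihilate₁_single, Finsupp.smul_single, Finsupp.smul_single, smul_eq_mul, smul_eq_mul,
      mul_comm ((√((p.2 : ℝ) + 1) : ℝ) : ℂ)]
  norm_x p := by
    rw [← Complex.ofReal_mul, Complex.norm_real, Real.norm_of_nonneg (by positivity), one_mul]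
    refine sqrt_mul_sqrt_le (by positivity) (by positivity) ?_
    have h1 : (0 : ℝ) ≤ p.1 := Nat.cast_nonneg _
    have h2 : (0 : ℝ) ≤ p.2 := Nat.cast_nonneg _
    push_cast
    linarith
  norm_y p := by
    rw [← Complex.ofReal_mul, Complex.norm_real, Real.norm_of_nonneg (by positivity), one_mul]
    refine sqrt_mul_sqrt_le (by positivity) (by positivity) ?_
    have h1 : (0 : ℝ) ≤ p.1 := Nat.cast_nonneg _
    have h2 : (0 : ℝ) ≤ p.2 := Nat.cast_nonneg _
    push_cast
    linarith
  deg_r p := by simp only; lia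
  deg_l p := by simp only; lia
  left_right := by
    rintro ⟨m, n⟩
    cases n with
    | zero => simp
    | succ n => right; simp [-Complex.ofReal_add, mul_comm]
  right_left := by
    rintro ⟨m, n⟩
    cases m with
    | zero => simp
    | succ m => right; simp [mul_comm]

lemma isLadder_squeezing : IsLadder (create₁ * create₂ - annihilate₁ * annihilate₂)
    (fun p => p.1 + p.2) 1
    (fun p => ((√((p.1 : ℝ) + 1) : ℝ) : ℂ) * ((√((p.2 : ℝ) + 1) : ℝ) : ℂ))
    (fun p => ((√(p.1 : ℝ) : ℝ) : ℂ) * ((√(p.2 : ℝ) : ℝ) : ℂ))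
    (fun p => (p.1 + 1, p.2 + 1)) (fun p => (p.1 - 1, p.2 - 1)) where
  pos := one_pos
  apply_single p := by
    rw [LinearMap.sub_apply, Module.End.mul_apply, Module.End.mul_apply, annihilate₂_single,
      create₂_single, apply_single_eq create₁, apply_single_eq annihilate₁, create₁_single,
      annihilate₁_single, Finsupp.smul_single, Finsupp.smul_single, smul_eq_mul, smul_eq_mul,
      mul_comm ((√((p.2 : ℝ) + 1) : ℝ) : ℂ), mul_comm ((√((p.2 : ℝ)) : ℝ) : ℂ)]
  norm_x p := by
    rw [← Complex.ofReal_mul, Complex.norm_real, Real.norm_of_nonneg (by positivity), one_mul]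
    refine sqrt_mul_sqrt_le (by positivity) (by positivity) ?_
    have h1 : (0 : ℝ) ≤ p.1 := Nat.cast_nonneg _
    have h2 : (0 : ℝ) ≤ p.2 := Nat.cast_nonneg _
    push_cast
    linarith
  norm_y p := by
    rw [← Complex.ofReal_mul, Complex.norm_real, Real.norm_of_nonneg (by positivity), one_mul]
    refine sqrt_mul_sqrt_le (by positivity) (by positivity) ?_
    have h1 : (0 : ℝ) ≤ p.1 := Nat.cast_nonneg _
    have h2 : (0 : ℝ) ≤ p.2 := Nat.cast_nonneg _
    push_cast
    linarith
  deg_r p := by simp only; lia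
  deg_l p := by simp only; lia
  left_right := by
    rintro ⟨m, n⟩
    right
    simp
  right_left := by
    rintro ⟨m, n⟩
    cases m with
    | zero => simp
    | succ m =>
      cases n with
      | zero => simp
      | succ n => right; simp

lemma tensor_apply (ψ χ : Fock) (p : ℕ × ℕ) : tensor ψ χ p = ψ p.1 * χ p.2 := rfl

/-- The beam splitter maps coherent states to products of coherent states. -/
lemma beamSplitterGroup_tensor {a : ℝ} {U : ℝ → (Fock2 →L[ℂ] Fock2)}
    (hU : IsUnitaryGroupOf ((a : ℂ) • (create₁ * annihilate₂ - annihilate₁ * create₂)) U) (t : ℝ)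
    (γ : ℂ) : U t (tensor (expVec γ) (ket 0)) =
      tensor (expVec (γ * Complex.cos (t * a))) (expVec (-γ * Complex.sin (t * a))) := by
  have hc : ∀ (z : ℂ) (m : ℕ), HasDerivAt (fun z : ℂ => (γ * Complex.cos (z * a)) ^ m / sqrtFact m)
      (a * (-γ * Complex.sin (z * a)) * (m * (γ * Complex.cos (z * a)) ^ (m - 1) / sqrtFact m)) z := by
    intro z m
    have h1 : HasDerivAt (fun z : ℂ => z * (a : ℂ)) (a : ℂ) z := by
      simpa using (hasDerivAt_id z).mul_const (a : ℂ)
    exact (((h1.ccos.const_mul γ).pow m).div_const _).congr_deriv (by ring)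
  have hs : ∀ (z : ℂ) (m : ℕ), HasDerivAt (fun z : ℂ => (-γ * Complex.sin (z * a)) ^ m / sqrtFact m)
      (-a * (γ * Complex.cos (z * a)) * (m * (-γ * Complex.sin (z * a)) ^ (m - 1) / sqrtFact m)) z := by
    intro z m
    have h1 : HasDerivAt (fun z : ℂ => z * (a : ℂ)) (a : ℂ) z := by
      simpa using (hasDerivAt_id z).mul_const (a : ℂ)
    exact (((h1.csin.const_mul (-γ)).pow m).div_const _).congr_deriv (by ring)
  ext p
  rw [tensor_apply, expVec_apply, expVec_apply]
  refine hU.apply_eq_of_ladder (isLadder_beamSplitter.smul a) (f := fun t p =>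
    (γ * Complex.cos (t * a)) ^ p.1 / sqrtFact p.1 *
      ((-γ * Complex.sin (t * a)) ^ p.2 / sqrtFact p.2)) (fun p => ?_) (fun t p => ?_)
    (fun p => ?_) t p
  · exact analyticOnNhd_comp_ofReal fun z => ((hc z p.1).mul (hs z p.2)).differentiableAt
  · refine ((hc t p.1).mul (hs t p.2)).comp_ofReal.congr_deriv ?_
    have e1 := sqrt_mul_pow_div_succ (γ * Complex.cos (t * a)) p.1
    have e2 := sqrt_mul_pow_div_pred (γ * Complex.cos (t * a)) p.1
    have e3 := sqrt_mul_pow_div_succ (-γ * Complex.sin (t * a)) p.2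
    have e4 := sqrt_mul_pow_div_pred (-γ * Complex.sin (t * a)) p.2
    simp only [map_mul, Complex.conj_ofReal]
    rw [← e2, ← e4]
    linear_combination
      (-(a : ℂ) * (((√(p.1 : ℝ) : ℝ) : ℂ) * ((γ * Complex.cos (t * a)) ^ (p.1 - 1) /
        sqrtFact (p.1 - 1)))) * e3 + ((a : ℂ) * (((√(p.2 : ℝ) : ℝ) : ℂ) *
        ((-γ * Complex.sin (t * a)) ^ (p.2 - 1) / sqrtFact (p.2 - 1)))) * e1
  · rw [tensor_apply, expVec_apply, ket_apply]
    rcases p with ⟨m, n⟩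
    cases n with
    | zero => simp [sqrtFact_zero]
    | succ n => simp

/-- Two-mode squeezing of the number states of the first mode. -/
lemma squeezingGroup_tensor {a : ℝ} {U : ℝ → (Fock2 →L[ℂ] Fock2)}
    (hU : IsUnitaryGroupOf ((a : ℂ) • (create₁ * create₂ - annihilate₁ * annihilate₂)) U) (t : ℝ)
    (m : ℕ) (p : ℕ × ℕ) : (U t (tensor (ket m) (ket 0))) p =
      if p.1 = p.2 + m then ((√(p.1.choose p.2 : ℝ) *
        (Real.sinh (t * a) ^ p.2 / Real.cosh (t * a) ^ (p.1 + 1)) : ℝ) : ℂ) else 0 := by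
  have hd : ∀ (t : ℝ) (i j : ℕ), HasDerivAt
      (fun t => Real.sinh (t * a) ^ j / Real.cosh (t * a) ^ (i + 1))
      (a * (j * (Real.sinh (t * a) ^ (j - 1) / Real.cosh (t * a) ^ i)) -
        a * ((i + 1) * (Real.sinh (t * a) ^ (j + 1) / Real.cosh (t * a) ^ (i + 2)))) t := by
    intro t i j
    have h1 : HasDerivAt (fun t : ℝ => t * a) a t := by
      simpa using (hasDerivAt_id t).mul_const a
    have hc : Real.cosh (t * a) ≠ 0 := (Real.cosh_pos _).ne'
    refine ((h1.sinh.pow j).div (h1.cosh.pow (i + 1)) (pow_ne_zero _ hc)).congr_deriv ?_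
    simp only [Nat.add_sub_cancel, Pi.pow_apply]
    push_cast
    field_simp
    ring
  refine hU.apply_eq_of_ladder (isLadder_squeezing.smul a) (f := fun t p =>
    if p.1 = p.2 + m then ((√(p.1.choose p.2 : ℝ) *
        (Real.sinh (t * a) ^ p.2 / Real.cosh (t * a) ^ (p.1 + 1)) : ℝ) : ℂ) else 0)
    (fun p => ?_) (fun t p => ?_) (fun p => ?_) t p
  · by_cases hp : p.1 = p.2 + m
    · simp only [if_pos hp]
      intro t _
      refine AnalyticAt.fun_comp (g := fun x : ℝ => (x : ℂ)) (Complex.ofRealCLM.analyticAt _) ?_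
      have h1 : AnalyticAt ℝ (fun t : ℝ => t * a) t := by fun_prop
      refine analyticAt_const.mul (AnalyticAt.div ?_ ?_ (pow_ne_zero _ (Real.cosh_pos _).ne'))
      · exact (Real.analyticAt_sinh.fun_comp h1).pow _
      · exact (Real.analyticAt_cosh.fun_comp h1).pow _
    · simp only [if_neg hp]
      exact analyticOnNhd_const
  · rcases p with ⟨i, j⟩
    by_cases hp : i = j + m
    · simp only [if_pos hp, Complex.conj_ofReal, map_mul]
      have h1 : (i + 1 = j + 1 + m) := by lia
      refine (((hd t i j).const_mul (√(i.choose j : ℝ))).ofReal_comp).congr_deriv ?_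
      rw [if_pos h1]
      -- Both ladder terms reduce to (i + 1) · C(i, j) = (j + 1) · C(i + 1, j + 1): `e1` treats the
      -- state above, `e2` the state below.
      have e1 : √((i : ℝ) + 1) * √((j : ℝ) + 1) * √((i + 1).choose (j + 1) : ℝ) =
          (i + 1) * √(i.choose j : ℝ) := by
        have h : ((i : ℝ) + 1) * (i.choose j : ℝ) = ((i + 1).choose (j + 1) : ℝ) * (j + 1) := by
          exact_mod_cast Nat.add_one_mul_choose_eq i j
        rw [mul_assoc, ← Real.sqrt_mul (by positivity), mul_comm ((j : ℝ) + 1), ← h,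
          Real.sqrt_mul (by positivity), ← mul_assoc, Real.mul_self_sqrt (by positivity)]
      have e2 : √(i : ℝ) * √(j : ℝ) * ((if i - 1 = j - 1 + m then √((i - 1).choose (j - 1) : ℝ) *
          (Real.sinh (t * a) ^ (j - 1) / Real.cosh (t * a) ^ (i - 1 + 1)) else 0)) =
          j * √(i.choose j : ℝ) * (Real.sinh (t * a) ^ (j - 1) / Real.cosh (t * a) ^ i) := by
        cases j with
        | zero => simp
        | succ j =>
          obtain ⟨i, rfl⟩ : ∃ k, i = k + 1 := ⟨i - 1, by lia⟩
          simp only [Nat.add_sub_cancel]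
          rw [if_pos (by lia)]
          have h : ((i : ℝ) + 1) * (i.choose j : ℝ) = ((i + 1).choose (j + 1) : ℝ) * (j + 1) := by
            exact_mod_cast Nat.add_one_mul_choose_eq i j
          have h2 : √((i : ℝ) + 1) * √((j : ℝ) + 1) * √(i.choose j : ℝ) =
              (j + 1) * √((i + 1).choose (j + 1) : ℝ) := by
            rw [mul_right_comm, ← Real.sqrt_mul (by positivity), h, Real.sqrt_mul (by positivity),
              mul_assoc, Real.mul_self_sqrt (by positivity), mul_comm]
          push_cast
          linear_combination (Real.sinh (t * a) ^ j / Real.cosh (t * a) ^ (i + 1)) * h2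
      have e3 : ∀ (q : Prop) [Decidable q] (x : ℝ), (if q then (x : ℂ) else 0) =
          ((if q then x else 0 : ℝ) : ℂ) := fun q _ x => by split_ifs <;> simp
      rw [e3]
      norm_cast
      push_cast
      linear_combination a * (Real.sinh (t * a) ^ (j + 1) / Real.cosh (t * a) ^ (i + 2)) * e1 -
        a * e2
    · have h1 : ¬ (i + 1 = j + 1 + m) := by lia
      simp only [if_neg hp, if_neg h1, mul_zero, sub_zero]
      refine (hasDerivAt_const t (0 : ℂ)).congr_deriv ?_
      rcases Nat.eq_zero_or_pos i with rfl | hi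
      · simp
      rcases Nat.eq_zero_or_pos j with rfl | hj
      · simp
      rw [if_neg (by lia), mul_zero]
  · rw [tensor_apply, ket_apply, ket_apply]
    rcases p with ⟨i, j⟩
    cases j with
    | zero => simp
    | succ j => simp

/-- The beam splitter of transmissivity `1/2`. -/
lemma beamSplitter_tensor (γ : ℂ) : beamSplitter (1 / 2) (tensor (expVec γ) (ket 0)) =
    tensor (expVec (γ / ((√2 : ℝ) : ℂ))) (expVec (-γ / ((√2 : ℝ) : ℂ))) := by
  obtain ⟨U, hU, h⟩ := (isLadder_beamSplitter.smul (Real.arccos √(1 / 2))).isAnalyticSkew.exists_opExp_eq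
  rw [beamSplitter, h, beamSplitterGroup_tensor hU]
  have h1 : √(1 / 2 : ℝ) ≤ 1 := Real.sqrt_le_one.2 (by norm_num)
  have h0 : 0 ≤ √(1 / 2 : ℝ) := Real.sqrt_nonneg _
  have h2 : √(1 - √(1 / 2 : ℝ) ^ 2) = (√2)⁻¹ := by
    rw [Real.sq_sqrt (by norm_num), ← Real.sqrt_inv]; norm_num
  have h3 : √(1 / 2 : ℝ) = (√2)⁻¹ := by rw [← Real.sqrt_inv]; norm_num
  rw [Complex.ofReal_one, one_mul, ← Complex.ofReal_cos, ← Complex.ofReal_sin,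
    Real.cos_arccos (by linarith) h1, Real.sin_arccos, h2, h3, Complex.ofReal_inv, div_eq_mul_inv,
    div_eq_mul_inv]

/-- Two-mode squeezing with gain `2`. -/
lemma squeezing_tensor (m : ℕ) (p : ℕ × ℕ) : (squeezing 2 (tensor (ket m) (ket 0))) p =
    if p.1 = p.2 + m then ((√(p.1.choose p.2 : ℝ) / √2 ^ (p.1 + 1) : ℝ) : ℂ) else 0 := by
  obtain ⟨U, hU, h⟩ := (isLadder_squeezing.smul (Real.arcosh √2)).isAnalyticSkew.exists_opExp_eq
  have h1 : (1 : ℝ) ≤ √2 := by rw [Real.one_le_sqrt]; norm_num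
  rw [squeezing, h, squeezingGroup_tensor hU, one_mul, Real.cosh_arcosh h1, Real.sinh_arcosh h1,
    Real.sq_sqrt (by norm_num)]
  norm_num [div_eq_mul_inv]

lemma beamSplitter_mem_unitary (θ : ℝ) : beamSplitter θ ∈ unitary (Fock2 →L[ℂ] Fock2) := by
  obtain ⟨U, hU, h⟩ := (isLadder_beamSplitter.smul (Real.arccos √θ)).isAnalyticSkew.exists_opExp_eq
  rw [beamSplitter, h]
  exact hU.mem_unitary 1

lemma squeezing_mem_unitary (κ : ℝ) : squeezing κ ∈ unitary (Fock2 →L[ℂ] Fock2) := by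
  obtain ⟨U, hU, h⟩ := (isLadder_squeezing.smul (Real.arcosh √κ)).isAnalyticSkew.exists_opExp_eq
  rw [squeezing, h]
  exact hU.mem_unitary 1

/-! ### Bounded sesquilinear forms -/

/-- `F` is a bounded sesquilinear form on the Fock space, antilinear in the first argument. -/
structure IsBddSesq (F : Fock → Fock → ℂ) : Prop where
  add_left : ∀ φ φ' ψ, F (φ + φ') ψ = F φ ψ + F φ' ψ
  smul_left : ∀ (c : ℂ) φ ψ, F (c • φ) ψ = conj c * F φ ψ
  add_right : ∀ φ ψ ψ', F φ (ψ + ψ') = F φ ψ + F φ ψ'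
  smul_right : ∀ (c : ℂ) φ ψ, F φ (c • ψ) = c * F φ ψ
  bound : ∃ C : ℝ, ∀ φ ψ, ‖F φ ψ‖ ≤ C * ‖φ‖ * ‖ψ‖

namespace IsBddSesq

variable {F G : Fock → Fock → ℂ}

lemma inner_apply (T : Fock →L[ℂ] Fock) : IsBddSesq (fun φ ψ => ⟪φ, T ψ⟫_ℂ) where
  add_left _ _ _ := inner_add_left _ _ _
  smul_left _ _ _ := inner_smul_left _ _ _
  add_right _ _ _ := by rw [map_add, inner_add_right]
  smul_right _ _ _ := by rw [map_smul, inner_smul_right]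
  bound := ⟨‖T‖, fun φ ψ => (norm_inner_le_norm _ _).trans <| by
    calc ‖φ‖ * ‖T ψ‖ ≤ ‖φ‖ * (‖T‖ * ‖ψ‖) := by gcongr; exact T.le_opNorm ψ
      _ = _ := by ring⟩

lemma const_mul (c : ℂ) (hF : IsBddSesq F) : IsBddSesq (fun φ ψ => c * F φ ψ) where
  add_left _ _ _ := by rw [hF.add_left, mul_add]
  smul_left _ _ _ := by rw [hF.smul_left, mul_left_comm]
  add_right _ _ _ := by rw [hF.add_right, mul_add]
  smul_right _ _ _ := by rw [hF.smul_right, mul_left_comm]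
  bound := by
    obtain ⟨C, hC⟩ := hF.bound
    refine ⟨‖c‖ * C, fun φ ψ => ?_⟩
    rw [norm_mul, mul_assoc, mul_assoc, ← mul_assoc C]
    gcongr
    exact hC φ ψ

lemma integral {α : Type*} [MeasurableSpace α] {μ : Measure α} {H : α → Fock → Fock → ℂ}
    (add_left : ∀ x φ φ' ψ, H x (φ + φ') ψ = H x φ ψ + H x φ' ψ)
    (smul_left : ∀ x (c : ℂ) φ ψ, H x (c • φ) ψ = conj c * H x φ ψ)
    (add_right : ∀ x φ ψ ψ', H x φ (ψ + ψ') = H x φ ψ + H x φ ψ')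
    (smul_right : ∀ x (c : ℂ) φ ψ, H x φ (c • ψ) = c * H x φ ψ)
    (hint : ∀ φ ψ, Integrable (fun x => H x φ ψ) μ) {C : ℝ}
    (hC : ∀ φ ψ, ∫ x, ‖H x φ ψ‖ ∂μ ≤ C * ‖φ‖ * ‖ψ‖) :
    IsBddSesq (fun φ ψ => ∫ x, H x φ ψ ∂μ) where
  add_left φ φ' ψ := by simp_rw [add_left]; exact integral_add (hint _ _) (hint _ _)
  smul_left c φ ψ := by simp_rw [smul_left]; exact integral_const_mul _ _
  add_right φ φ' ψ := by simp_rw [add_right]; exact integral_add (hint _ _) (hint _ _)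
  smul_right c φ ψ := by simp_rw [smul_right]; exact integral_const_mul _ _
  bound := ⟨C, fun φ ψ => (norm_integral_le_integral_norm _).trans (hC φ ψ)⟩

lemma tsum {ι : Type*} {H : ι → Fock → Fock → ℂ} (hH : ∀ i, IsBddSesq (H i))
    (hint : ∀ φ ψ, Summable (fun i => ‖H i φ ψ‖)) {C : ℝ}
    (hC : ∀ φ ψ, ∑' i, ‖H i φ ψ‖ ≤ C * ‖φ‖ * ‖ψ‖) :
    IsBddSesq (fun φ ψ => ∑' i, H i φ ψ) where
  add_left φ φ' ψ := by
    simp_rw [(hH _).add_left]; exact (hint _ _).of_norm.tsum_add (hint _ _).of_norm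
  smul_left c φ ψ := by simp_rw [(hH _).smul_left]; exact tsum_mul_left
  add_right φ φ' ψ := by
    simp_rw [(hH _).add_right]; exact (hint _ _).of_norm.tsum_add (hint _ _).of_norm
  smul_right c φ ψ := by simp_rw [(hH _).smul_right]; exact tsum_mul_left
  bound := ⟨C, fun φ ψ => (norm_tsum_le_tsum_norm (hint φ ψ)).trans (hC φ ψ)⟩

lemma exists_clm (hF : IsBddSesq F) :
    ∃ T : Fock →L[ℂ] Fock, ∀ φ ψ, ⟪φ, T ψ⟫_ℂ = F φ ψ := by
  obtain ⟨C, hC⟩ := hF.bound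
  let B : Fock →ₗ⋆[ℂ] Fock →ₗ[ℂ] ℂ :=
    LinearMap.mk₂'ₛₗ (starRingEnd ℂ) (RingHom.id ℂ) F hF.add_left hF.smul_left hF.add_right
      hF.smul_right
  let B' : Fock →L⋆[ℂ] Fock →L[ℂ] ℂ := LinearMap.mkContinuous₂ B C hC
  refine ⟨(InnerProductSpace.continuousLinearMapOfBilin B').adjoint, fun φ ψ => ?_⟩
  rw [ContinuousLinearMap.adjoint_inner_right,
    InnerProductSpace.continuousLinearMapOfBilin_apply]
  rfl

lemma ext_dense (hF : IsBddSesq F) (hG : IsBddSesq G) {s : Set Fock}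
    (hs : Dense (Submodule.span ℂ s : Set Fock))
    (h : ∀ φ ∈ s, ∀ ψ ∈ s, F φ ψ = G φ ψ) (φ ψ : Fock) : F φ ψ = G φ ψ := by
  obtain ⟨S, hS⟩ := hF.exists_clm
  obtain ⟨T, hT⟩ := hG.exists_clm
  have : S = T := by
    refine ContinuousLinearMap.ext_on hs fun ψ hψ => ?_
    have : (innerSL ℂ (S ψ) : Fock →L[ℂ] ℂ) = innerSL ℂ (T ψ) := by
      refine ContinuousLinearMap.ext_on hs fun φ hφ => ?_
      have := h φ hφ ψ hψ
      rw [← hS, ← hT] at this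
      rw [innerSL_apply_apply, innerSL_apply_apply, ← inner_conj_symm, this, inner_conj_symm]
    have h2 : ∀ φ, ⟪φ, S ψ⟫_ℂ = ⟪φ, T ψ⟫_ℂ := fun φ => by
      rw [← inner_conj_symm, ← innerSL_apply_apply, this, innerSL_apply_apply, inner_conj_symm]
    exact ext_inner_left ℂ h2
  rw [← hS, ← hT, this]

/-- The tool by which operator identities become identities between scalar Gaussians. Boundedness of
both forms is what carries them from exponential vectors to all vectors. -/
lemma ext_expVec (hF : IsBddSesq F) (hG : IsBddSesq G)
    (h : ∀ γ δ : ℂ, F (expVec γ) (expVec δ) = G (expVec γ) (expVec δ)) (φ ψ : Fock) :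
    F φ ψ = G φ ψ := by
  refine hF.ext_dense hG dense_span_expVec ?_ φ ψ
  rintro _ ⟨γ, rfl⟩ _ ⟨δ, rfl⟩
  exact h γ δ

end IsBddSesq

/-! ### Kraus families -/

lemma summable_mul_of_sq {ι : Type*} {f g : ι → ℝ} (hf0 : ∀ i, 0 ≤ f i) (hg0 : ∀ i, 0 ≤ g i)
    {a b : ℝ} (ha : 0 ≤ a) (hb : 0 ≤ b) (hf : HasSum (fun i => f i ^ 2) (a ^ 2))
    (hg : HasSum (fun i => g i ^ 2) (b ^ 2)) :
    Summable (fun i => f i * g i) ∧ ∑' i, f i * g i ≤ a * b := by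
  obtain ⟨C, -, hC, hs⟩ := Real.inner_le_Lp_mul_Lq_hasSum_of_nonneg
    (Real.HolderConjugate.two_two) ha hb hf0 hg0 (by simpa using hf) (by simpa using hg)
  exact ⟨hs.summable, hs.tsum_eq.trans_le hC⟩

/-- A family of operators with `∑ᵢ Mᵢ† Mᵢ = c ^ 2`. -/
def IsKraus {ι : Type} (c : ℝ) (M : ι → Fock →L[ℂ] Fock) : Prop :=
  0 ≤ c ∧ ∀ φ, HasSum (fun i => ‖M i φ‖ ^ 2) ((c * ‖φ‖) ^ 2)

namespace IsKraus

variable {ι : Type} {c : ℝ} {M : ι → Fock →L[ℂ] Fock}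

lemma summable_norm_mul (hM : IsKraus c M) (φ ψ : Fock) :
    Summable (fun i => ‖M i φ‖ * ‖M i ψ‖) :=
  (summable_mul_of_sq (fun _ => norm_nonneg _) (fun _ => norm_nonneg _)
    (mul_nonneg hM.1 (norm_nonneg _)) (mul_nonneg hM.1 (norm_nonneg _)) (hM.2 φ) (hM.2 ψ)).1

lemma tsum_norm_mul_le (hM : IsKraus c M) (φ ψ : Fock) :
    ∑' i, ‖M i φ‖ * ‖M i ψ‖ ≤ c ^ 2 * (‖φ‖ * ‖ψ‖) :=
  (summable_mul_of_sq (fun _ => norm_nonneg _) (fun _ => norm_nonneg _)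
    (mul_nonneg hM.1 (norm_nonneg _)) (mul_nonneg hM.1 (norm_nonneg _)) (hM.2 φ)
    (hM.2 ψ)).2.trans_eq (by ring)

lemma norm_inner_le (X : Fock →L[ℂ] Fock) (φ ψ : Fock) :
    ‖⟪φ, X ψ⟫_ℂ‖ ≤ ‖X‖ * (‖φ‖ * ‖ψ‖) :=
  (norm_inner_le_norm _ _).trans <| by
    calc ‖φ‖ * ‖X ψ‖ ≤ ‖φ‖ * (‖X‖ * ‖ψ‖) := by gcongr; exact X.le_opNorm ψ
      _ = _ := by ring

lemma summable_norm_inner (hM : IsKraus c M) (X : Fock →L[ℂ] Fock) (φ ψ : Fock) :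
    Summable (fun i => ‖⟪M i φ, X (M i ψ)⟫_ℂ‖) :=
  ((hM.summable_norm_mul φ ψ).mul_left ‖X‖).of_nonneg_of_le (fun _ => norm_nonneg _)
    fun _ => norm_inner_le _ _ _

lemma tsum_norm_inner_le (hM : IsKraus c M) (X : Fock →L[ℂ] Fock) (φ ψ : Fock) :
    ∑' i, ‖⟪M i φ, X (M i ψ)⟫_ℂ‖ ≤ c ^ 2 * ‖X‖ * ‖φ‖ * ‖ψ‖ := by
  calc ∑' i, ‖⟪M i φ, X (M i ψ)⟫_ℂ‖ ≤ ∑' i, ‖X‖ * (‖M i φ‖ * ‖M i ψ‖) :=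
        (hM.summable_norm_inner X φ ψ).tsum_le_tsum (fun _ => norm_inner_le _ _ _)
          ((hM.summable_norm_mul φ ψ).mul_left ‖X‖)
    _ ≤ ‖X‖ * (c ^ 2 * (‖φ‖ * ‖ψ‖)) := by
        rw [tsum_mul_left]; gcongr; exact hM.tsum_norm_mul_le φ ψ
    _ = _ := by ring

/-- By Cauchy–Schwarz over the index, the series ∑ Mᵢ† X Mᵢ converges absolutely in every matrix
element for every bounded `X`, with a bound c²‖X‖. -/
lemma exists_clm (hM : IsKraus c M) (X : Fock →L[ℂ] Fock) :
    ∃ T : Fock →L[ℂ] Fock, ∀ φ ψ, HasSum (fun i => ⟪M i φ, X (M i ψ)⟫_ℂ) ⟪φ, T ψ⟫_ℂ := by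
  have hB : IsBddSesq (fun φ ψ => ∑' i, ⟪M i φ, X (M i ψ)⟫_ℂ) := by
    refine IsBddSesq.tsum (H := fun i φ ψ => ⟪M i φ, X (M i ψ)⟫_ℂ) (fun i => ?_)
      (hM.summable_norm_inner X) (C := c ^ 2 * ‖X‖) (hM.tsum_norm_inner_le X)
    have := IsBddSesq.inner_apply ((M i).adjoint ∘L X ∘L M i)
    simpa only [ContinuousLinearMap.comp_apply, ContinuousLinearMap.adjoint_inner_right] using this
  obtain ⟨T, hT⟩ := hB.exists_clm
  refine ⟨T, fun φ ψ => ?_⟩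
  rw [hT]
  exact (hM.summable_norm_inner X φ ψ).of_norm.hasSum

lemma smul (hM : IsKraus c M) {z : ι → ℂ} {r : ℝ} (hr : 0 ≤ r) (hz : ∀ i, ‖z i‖ = r) :
    IsKraus (r * c) (fun i => z i • M i) := by
  refine ⟨mul_nonneg hr hM.1, fun φ => ?_⟩
  have := (hM.2 φ).mul_left (r ^ 2)
  rw [← mul_pow, ← mul_assoc] at this
  refine this.congr_fun fun i => ?_
  rw [smul_apply, norm_smul, hz, mul_pow]

end IsKraus

lemma norm_sq_eq_hasSum {ι : Type} (φ : Ell2 ι) : HasSum (fun i => ‖φ i‖ ^ 2) (‖φ‖ ^ 2) := by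
  have := lp.hasSum_norm (p := 2) (by norm_num) φ
  simpa using this

/-! ### Stinespring dilations -/

/-- The operator `(1 ⊗ ⟨n|) V (1 ⊗ |0⟩)`. -/
def kraus (V : Fock2 →L[ℂ] Fock2) (n : ℕ) : Fock →L[ℂ] Fock :=
  (tensorKet (ket n)).adjoint ∘L V ∘L tensorKet (ket 0)

lemma tensorKet_apply (χ ψ : Fock) : tensorKet χ ψ = tensor ψ χ := rfl

lemma tensor_ket_ket (i j : ℕ) : tensor (ket i) (ket j) = ket (i, j) := by
  ext p
  simp only [tensor_apply, ket_apply]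
  rcases p with ⟨a, b⟩
  by_cases h1 : a = i <;> by_cases h2 : b = j <;> simp [h1, h2]

lemma kraus_apply (V : Fock2 →L[ℂ] Fock2) (n : ℕ) (ψ : Fock) (i : ℕ) :
    kraus V n ψ i = V (tensor ψ (ket 0)) (i, n) := by
  rw [← inner_ket_left, kraus, ContinuousLinearMap.comp_apply,
    ContinuousLinearMap.adjoint_inner_right, tensorKet_apply, tensor_ket_ket, inner_ket_left]
  rfl

/-- The squared norm of V(φ ⊗ |0⟩), equal to ‖φ‖², splits over the number states of the second mode.
-/
lemma isKraus_kraus {V : Fock2 →L[ℂ] Fock2} (hV : V ∈ unitary (Fock2 →L[ℂ] Fock2)) :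
    IsKraus 1 (kraus V) := by
  refine ⟨zero_le_one, fun φ => ?_⟩
  have h := norm_sq_eq_hasSum (V (tensor φ (ket 0)))
  rw [ContinuousLinearMap.norm_map_of_mem_unitary hV, norm_tensor, norm_ket, mul_one] at h
  rw [one_mul]
  have h' := (Equiv.prodComm ℕ ℕ).hasSum_iff.2 h
  refine h'.prod_fiberwise fun n => ?_
  have := norm_sq_eq_hasSum (kraus V n φ)
  simp only [kraus_apply] at this
  exact this

/-- For a merely bounded `X` the partial trace need not converge on account of unitarity alone,
which controls ∑ Kₙ†Kₙ. What is needed is control of ∑ KₙKₙ†, whence the hypothesis on the adjoints.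
-/
lemma hasSum_partialTrace₂ {V : Fock2 →L[ℂ] Fock2} {c : ℝ}
    (hV : IsKraus c (fun n => (kraus V n).adjoint)) (X : Fock →L[ℂ] Fock) (φ ψ : Fock) :
    HasSum (fun n => ⟪(kraus V n).adjoint φ, X ((kraus V n).adjoint ψ)⟫_ℂ)
      ⟪φ, partialTrace₂ (V ∘L withVacuum X ∘L V.adjoint) ψ⟫_ℂ := by
  obtain ⟨T, hT⟩ := hV.exists_clm X
  -- Summability in the weak operator topology has to be established for the `∑'` in `partialTrace₂`
  -- to be a genuine sum rather than the default value 0.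
  have key : HasSum (fun n : ℕ => ContinuousLinearMapWOT.ofCLM
      ((tensorKet (ket n)).adjoint ∘L (V ∘L withVacuum X ∘L V.adjoint) ∘L tensorKet (ket n)))
      (ContinuousLinearMapWOT.ofCLM T) := by
    refine (ContinuousLinearMapWOT.tendsto_iff_forall_inner_apply_tendsto).2 fun φ ψ => ?_
    refine (hT ψ φ).congr fun s => ?_
    induction s using Finset.induction_on with
    | empty => simp
    | insert n s hn ih =>
      rw [Finset.sum_insert hn, Finset.sum_insert hn, ContinuousLinearMapWOT.add_apply,
        inner_add_right, ← ih]
      congr 1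
      simp only [kraus, withVacuum, ContinuousLinearMapWOT.ofCLM_apply,
        ContinuousLinearMap.adjoint_comp, ContinuousLinearMap.adjoint_adjoint,
        ContinuousLinearMap.comp_apply, ContinuousLinearMap.adjoint_inner_left,
        ContinuousLinearMap.adjoint_inner_right]
  rw [partialTrace₂, key.tsum_eq]
  exact hT φ ψ


/-! ### The Kraus operators of the attenuator and of the amplifier -/

/-- Kraus operators of the beam splitter. -/
abbrev attKraus (n : ℕ) : Fock →L[ℂ] Fock := kraus (beamSplitter (1 / 2)) n

/-- Kraus operators of the two-mode squeezer. -/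
abbrev ampKraus (n : ℕ) : Fock →L[ℂ] Fock := kraus (squeezing 2) n

/-- `1 / √2` as a complex number. -/
def invSqrtTwo : ℂ := (((√2 : ℝ) : ℂ))⁻¹

lemma invSqrtTwo_mul_self : invSqrtTwo * invSqrtTwo = 1 / 2 := by
  rw [invSqrtTwo, ← mul_inv, ← Complex.ofReal_mul, Real.mul_self_sqrt (by norm_num)]
  norm_num

lemma conj_invSqrtTwo : conj invSqrtTwo = invSqrtTwo := by
  rw [invSqrtTwo, map_inv₀, Complex.conj_ofReal]

lemma attKraus_expVec (n : ℕ) (γ : ℂ) :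
    attKraus n (expVec γ) = ((-(γ * invSqrtTwo)) ^ n / sqrtFact n) • expVec (γ * invSqrtTwo) := by
  ext i
  rw [kraus_apply, beamSplitter_tensor, tensor_apply, expVec_apply, lp.coeFn_smul, Pi.smul_apply,
    expVec_apply, expVec_apply, smul_eq_mul, invSqrtTwo, ← div_eq_mul_inv]
  simp only [neg_div]
  ring

lemma ampKraus_ket (n m : ℕ) (i : ℕ) :
    ampKraus n (ket m) i =
      if i = n + m then ((√(i.choose n : ℝ) / √2 ^ (i + 1) : ℝ) : ℂ) else 0 := by
  rw [kraus_apply, squeezing_tensor]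

lemma sqrtFact_eq (n : ℕ) : sqrtFact n = ((√(n.factorial : ℝ) : ℝ) : ℂ) := rfl

/-- The coincidence behind the theorem: gain 2 and transmissivity 1/2 are reciprocal, so both
families are built from the same binomial weights. It is verified on exponential vectors, coordinate
by coordinate. -/
lemma adjoint_ampKraus (n : ℕ) :
    (ampKraus n).adjoint = ((-1) ^ n * invSqrtTwo) • attKraus n := by
  refine QuantumOptics.ext_expVec fun γ => ?_
  ext m
  rw [← inner_ket_left m, ContinuousLinearMap.adjoint_inner_right, ← inner_conj_symm]
  have h : ⟪expVec γ, ampKraus n (ket m)⟫_ℂ =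
      conj (expVec γ (n + m)) * (ampKraus n (ket m) (n + m)) := by
    have h1 := lp.hasSum_inner (𝕜 := ℂ) (G := fun _ : ℕ => ℂ) (expVec γ) (ampKraus n (ket m))
    refine h1.unique ?_
    have h2 := hasSum_single (f := fun i => (⟪(expVec γ i : ℂ), (ampKraus n (ket m) i : ℂ)⟫_ℂ : ℂ)) (n + m)
      (fun i hi => by rw [ampKraus_ket, if_neg hi, inner_zero_right])
    simpa [mul_comm] using h2
  rw [h, map_mul, Complex.conj_conj, ampKraus_ket, if_pos rfl, Complex.conj_ofReal, expVec_apply,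
    smul_apply, attKraus_expVec, smul_smul, lp.coeFn_smul, Pi.smul_apply, expVec_apply,
    smul_eq_mul]
  -- The binomial amplitude of the squeezer splits into the normalisations of the three number
  -- states involved, which cancel those of the exponential vectors.
  have hch : ((√((n + m).choose n : ℝ) : ℝ) : ℂ) = sqrtFact (n + m) / (sqrtFact n * sqrtFact m) := by
    rw [sqrtFact_eq, sqrtFact_eq, sqrtFact_eq, ← Complex.ofReal_mul, ← Complex.ofReal_div,
      ← Real.sqrt_mul (by positivity), ← Real.sqrt_div (by positivity), Nat.choose_symm_add,
      Nat.add_choose,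
      Nat.cast_div (Nat.factorial_mul_factorial_dvd_factorial_add n m) (by positivity),
      Nat.cast_mul]
  push_cast
  rw [hch, invSqrtTwo]
  have e1 := sqrtFact_ne_zero n
  have e2 := sqrtFact_ne_zero m
  have e3 := sqrtFact_ne_zero (n + m)
  have e4 : ((√2 : ℝ) : ℂ) ≠ 0 := by simp
  rw [neg_pow (γ * _)]
  have e5 : ((-1 : ℂ) ^ n) * (-1) ^ n = 1 := by rw [← mul_pow]; simp
  simp only [mul_pow, inv_pow]
  rw [pow_succ, pow_add, pow_add]
  generalize (-1 : ℂ) ^ n = s at e5 ⊢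
  field_simp
  linear_combination -(γ ^ n * γ ^ m) * e5

lemma adjoint_attKraus (n : ℕ) :
    (attKraus n).adjoint = ((-1) ^ n * ((√2 : ℝ) : ℂ)) • ampKraus n := by
  have e4 : ((√2 : ℝ) : ℂ) ≠ 0 := by simp
  have h : attKraus n = ((-1) ^ n * ((√2 : ℝ) : ℂ)) • (ampKraus n).adjoint := by
    rw [adjoint_ampKraus, smul_smul, invSqrtTwo]
    have e5 : ((-1 : ℂ) ^ n) * (-1) ^ n = 1 := by rw [← mul_pow]; simp
    rw [mul_mul_mul_comm, e5, mul_inv_cancel₀ e4, one_mul, one_smul]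
  conv_lhs => rw [h]
  rw [map_smulₛₗ, ContinuousLinearMap.adjoint_adjoint]
  simp

lemma isKraus_attKraus : IsKraus 1 attKraus := isKraus_kraus (beamSplitter_mem_unitary _)

lemma isKraus_ampKraus : IsKraus 1 ampKraus := isKraus_kraus (squeezing_mem_unitary _)

lemma isKraus_adjoint_attKraus : IsKraus (√2) (fun n => (attKraus n).adjoint) := by
  simp_rw [adjoint_attKraus]
  simpa using isKraus_ampKraus.smul (Real.sqrt_nonneg 2)
    (z := fun n => (-1) ^ n * ((√2 : ℝ) : ℂ)) (fun n => by simp)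

lemma isKraus_adjoint_ampKraus : IsKraus (√2)⁻¹ (fun n => (ampKraus n).adjoint) := by
  simp_rw [adjoint_ampKraus]
  simpa using isKraus_attKraus.smul (inv_nonneg.2 (Real.sqrt_nonneg 2))
    (z := fun n => (-1) ^ n * invSqrtTwo) (fun n => by simp [invSqrtTwo])

lemma hasSum_attenuator' (X : Fock →L[ℂ] Fock) (φ ψ : Fock) :
    HasSum (fun n => ⟪(attKraus n).adjoint φ, X ((attKraus n).adjoint ψ)⟫_ℂ)
      ⟪φ, attenuator (1 / 2) X ψ⟫_ℂ :=
  hasSum_partialTrace₂ isKraus_adjoint_attKraus X φ ψ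

lemma hasSum_amplifier' (X : Fock →L[ℂ] Fock) (φ ψ : Fock) :
    HasSum (fun n => ⟪(ampKraus n).adjoint φ, X ((ampKraus n).adjoint ψ)⟫_ℂ)
      ⟪φ, amplifier 2 X ψ⟫_ℂ :=
  hasSum_partialTrace₂ isKraus_adjoint_ampKraus X φ ψ

/-- Together with `hasSum_amplifier` this identifies the trace duals: the dual of the amplifier is
half the attenuator, and the dual of the attenuator is twice the amplifier. The signs (-1)^n occur
twice and cancel. -/
lemma hasSum_attenuator (X : Fock →L[ℂ] Fock) (φ ψ : Fock) :
    HasSum (fun n => ⟪ampKraus n φ, X (ampKraus n ψ)⟫_ℂ)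
      ((1 / 2) * ⟪φ, attenuator (1 / 2) X ψ⟫_ℂ) := by
  refine ((hasSum_attenuator' X φ ψ).mul_left (1 / 2)).congr_fun fun n => ?_
  have e4 : ((√2 : ℝ) : ℂ) * ((√2 : ℝ) : ℂ) = 2 := by
    rw [← Complex.ofReal_mul, Real.mul_self_sqrt (by norm_num)]; norm_num
  have e5 : ((-1 : ℂ) ^ n) * (-1) ^ n = 1 := by rw [← mul_pow]; simp
  rw [adjoint_attKraus, smul_apply, smul_apply, map_smul, inner_smul_left, inner_smul_right]
  simp only [map_mul, map_pow, map_neg, map_one, Complex.conj_ofReal]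
  linear_combination -(1 / 2 * ⟪ampKraus n φ, X (ampKraus n ψ)⟫_ℂ) *
    (((-1 : ℂ) ^ n * (-1) ^ n) * e4 + 2 * e5)

lemma hasSum_amplifier (X : Fock →L[ℂ] Fock) (φ ψ : Fock) :
    HasSum (fun n => ⟪attKraus n φ, X (attKraus n ψ)⟫_ℂ)
      (2 * ⟪φ, amplifier 2 X ψ⟫_ℂ) := by
  refine ((hasSum_amplifier' X φ ψ).mul_left 2).congr_fun fun n => ?_
  have e4 := invSqrtTwo_mul_self
  have e5 : ((-1 : ℂ) ^ n) * (-1) ^ n = 1 := by rw [← mul_pow]; simp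
  rw [adjoint_ampKraus, smul_apply, smul_apply, map_smul, inner_smul_left, inner_smul_right]
  simp only [map_mul, map_pow, map_neg, map_one, conj_invSqrtTwo]
  linear_combination -(2 * ⟪attKraus n φ, X (attKraus n ψ)⟫_ℂ) *
    (((-1 : ℂ) ^ n * (-1) ^ n) * e4 + (1 / 2) * e5)

/-! ### Completely positive maps given by Kraus families -/

/-- Convergence of a norm-bounded sequence of operators in the weak operator topology. -/
def WeakTendsto (Xs : ℕ → Fock →L[ℂ] Fock) (X : Fock →L[ℂ] Fock) : Prop :=
  (∃ B : ℝ, ∀ k, ‖Xs k‖ ≤ B) ∧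
    ∀ φ ψ, Tendsto (fun k => ⟪φ, Xs k ψ⟫_ℂ) atTop (𝓝 ⟪φ, X ψ⟫_ℂ)

/-- `Φ(X) = ∑ᵢ Mᵢ† X Mᵢ` weakly. -/
structure IsKrausMap (c : ℝ) (M : ℕ → Fock →L[ℂ] Fock)
    (Φ : (Fock →L[ℂ] Fock) → (Fock →L[ℂ] Fock)) : Prop where
  isKraus : IsKraus c M
  hasSum : ∀ X φ ψ, HasSum (fun n => ⟪M n φ, X (M n ψ)⟫_ℂ) ⟪φ, Φ X ψ⟫_ℂ

lemma clm_ext_inner {S T : Fock →L[ℂ] Fock} (h : ∀ φ ψ, ⟪φ, S ψ⟫_ℂ = ⟪φ, T ψ⟫_ℂ) : S = T :=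
  ContinuousLinearMap.ext fun ψ => ext_inner_left ℂ fun φ => h φ ψ

namespace IsKrausMap

variable {c : ℝ} {M : ℕ → Fock →L[ℂ] Fock} {Φ : (Fock →L[ℂ] Fock) → (Fock →L[ℂ] Fock)}

lemma isLinearMap (h : IsKrausMap c M Φ) : IsLinearMap ℂ Φ where
  map_add X Y := clm_ext_inner fun φ ψ => by
    rw [add_apply, inner_add_right]
    refine (h.hasSum (X + Y) φ ψ).unique (((h.hasSum X φ ψ).add (h.hasSum Y φ ψ)).congr_fun ?_)
    intro n
    rw [add_apply, inner_add_right]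
  map_smul a X := clm_ext_inner fun φ ψ => by
    rw [smul_apply, inner_smul_right]
    refine (h.hasSum (a • X) φ ψ).unique (((h.hasSum X φ ψ).mul_left a).congr_fun ?_)
    intro n
    rw [smul_apply, inner_smul_right]

lemma norm_le (h : IsKrausMap c M Φ) (X : Fock →L[ℂ] Fock) : ‖Φ X‖ ≤ c ^ 2 * ‖X‖ := by
  refine ContinuousLinearMap.opNorm_le_bound _ (by positivity) fun ψ => ?_
  -- Testing the form bound against `Φ X ψ` itself gives ‖Φ X ψ‖² on the left, from which one factor
  -- is cancelled.
  have h1 : ‖⟪Φ X ψ, Φ X ψ⟫_ℂ‖ ≤ c ^ 2 * ‖X‖ * ‖Φ X ψ‖ * ‖ψ‖ := by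
    rw [← (h.hasSum X (Φ X ψ) ψ).tsum_eq]
    exact (norm_tsum_le_tsum_norm (h.isKraus.summable_norm_inner X _ _)).trans
      (h.isKraus.tsum_norm_inner_le X _ _)
  rw [inner_self_eq_norm_sq_to_K] at h1
  simp only [Complex.coe_algebraMap, norm_pow, Complex.norm_real, norm_norm] at h1
  rcases (norm_nonneg (Φ X ψ)).eq_or_lt with h0 | h0
  · rw [← h0]; positivity
  · nlinarith

/-- Dominated convergence for the Kraus series; the uniform norm bound built into `WeakTendsto`
supplies the majorant. -/
lemma weakTendsto (h : IsKrausMap c M Φ) {Xs : ℕ → Fock →L[ℂ] Fock} {X : Fock →L[ℂ] Fock}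
    (hX : WeakTendsto Xs X) : WeakTendsto (fun k => Φ (Xs k)) (Φ X) := by
  obtain ⟨⟨B, hB⟩, hl⟩ := hX
  refine ⟨⟨c ^ 2 * B, fun k => (h.norm_le _).trans (by gcongr; exact hB k)⟩, fun φ ψ => ?_⟩
  simp_rw [← (h.hasSum _ φ ψ).tsum_eq]
  refine tendsto_tsum_of_dominated_convergence
    ((h.isKraus.summable_norm_mul φ ψ).mul_left B) (fun n => hl _ _) (Eventually.of_forall ?_)
  intro k n
  refine (IsKraus.norm_inner_le _ _ _).trans ?_
  gcongr
  exact hB k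

end IsKrausMap

lemma isKrausMap_attenuator :
    IsKrausMap (√2) (fun n => (attKraus n).adjoint) (attenuator (1 / 2)) :=
  ⟨isKraus_adjoint_attKraus, hasSum_attenuator'⟩

lemma isKrausMap_amplifier :
    IsKrausMap (√2)⁻¹ (fun n => (ampKraus n).adjoint) (amplifier 2) :=
  ⟨isKraus_adjoint_ampKraus, hasSum_amplifier'⟩

lemma isLinearMap_channelC : IsLinearMap ℂ channelC where
  map_add X Y := by
    simp only [channelC, Function.comp_apply, isKrausMap_amplifier.isLinearMap.map_add,
      isKrausMap_attenuator.isLinearMap.map_add]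
  map_smul a X := by
    simp only [channelC, Function.comp_apply, isKrausMap_amplifier.isLinearMap.map_smul,
      isKrausMap_attenuator.isLinearMap.map_smul]

lemma WeakTendsto.channelC {Xs : ℕ → Fock →L[ℂ] Fock} {X : Fock →L[ℂ] Fock}
    (hX : WeakTendsto Xs X) : WeakTendsto (fun k => channelC (Xs k)) (channelC X) :=
  isKrausMap_attenuator.weakTendsto (isKrausMap_amplifier.weakTendsto hX)

lemma norm_channelC_le (X : Fock →L[ℂ] Fock) : ‖channelC X‖ ≤ ‖X‖ := by
  calc ‖channelC X‖ ≤ √2 ^ 2 * ((√2)⁻¹ ^ 2 * ‖X‖) :=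
        (isKrausMap_attenuator.norm_le _).trans
          (by gcongr; exact isKrausMap_amplifier.norm_le _)
    _ = ‖X‖ := by rw [← mul_assoc, ← mul_pow, mul_inv_cancel₀ (by simp), one_pow, one_mul]

/-! ### Nuclear decompositions and traces -/

/-- `X = ∑ₖ |uₖ⟩⟨vₖ|` weakly, with `∑ₖ ‖uₖ‖ ‖vₖ‖ < ∞`. -/
structure IsNuclear {ι : Type} (X : Fock →L[ℂ] Fock) (u v : ι → Fock) : Prop where
  summable : Summable (fun k => ‖u k‖ * ‖v k‖)
  hasSum : ∀ φ ψ, HasSum (fun k => ⟪v k, ψ⟫_ℂ * ⟪φ, u k⟫_ℂ) ⟪φ, X ψ⟫_ℂ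

lemma hasSum_inner_mul_inner {ι : Type} [DecidableEq ι] (φ ψ : Ell2 ι) :
    HasSum (fun n => ⟪φ, (ket n : Ell2 ι)⟫_ℂ * ⟪(ket n : Ell2 ι), ψ⟫_ℂ) ⟪φ, ψ⟫_ℂ := by
  refine (lp.hasSum_inner (𝕜 := ℂ) (G := fun _ : ι => ℂ) φ ψ).congr_fun fun n => ?_
  rw [inner_ket_left, inner_ket_right]
  simp [mul_comm]

lemma summable_norm_inner_mul_inner {ι : Type} [DecidableEq ι] (φ ψ : Ell2 ι) :
    Summable (fun n => ‖⟪φ, (ket n : Ell2 ι)⟫_ℂ * ⟪(ket n : Ell2 ι), ψ⟫_ℂ‖) ∧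
      ∑' n, ‖⟪φ, (ket n : Ell2 ι)⟫_ℂ * ⟪(ket n : Ell2 ι), ψ⟫_ℂ‖ ≤ ‖φ‖ * ‖ψ‖ := by
  have := summable_mul_of_sq (fun i => norm_nonneg (φ i)) (fun i => norm_nonneg (ψ i))
    (norm_nonneg φ) (norm_nonneg ψ) (norm_sq_eq_hasSum φ) (norm_sq_eq_hasSum ψ)
  simpa [inner_ket_left, inner_ket_right] using this

lemma tsum_prod_right {ι : Type} {F : ι × ℕ → ℂ} (hF : Summable F) {a : ι → ℂ}
    (ha : ∀ k, HasSum (fun n => F (k, n)) (a k)) : ∑' p, F p = ∑' k, a k :=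
  (HasSum.prod_fiberwise hF.hasSum ha).tsum_eq.symm

lemma hasSum_prod_left {ι : Type} {F : ι × ℕ → ℂ} (hF : Summable F) {b : ℕ → ℂ}
    (hb : ∀ n, HasSum (fun k => F (k, n)) (b n)) : HasSum b (∑' p, F p) := by
  have h := (Equiv.prodComm ℕ ι).hasSum_iff.2 hF.hasSum
  exact HasSum.prod_fiberwise (f := F ∘ (Equiv.prodComm ℕ ι)) h hb

lemma summable_prod_of_le {ι : Type} {F : ι × ℕ → ℝ} (hF : ∀ p, 0 ≤ F p)
    (h1 : ∀ k, Summable (fun n => F (k, n))) {g : ι → ℝ} (hg : Summable g)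
    (h2 : ∀ k, ∑' n, F (k, n) ≤ g k) : Summable F := by
  rw [summable_prod_of_nonneg hF]
  exact ⟨h1, hg.of_nonneg_of_le (fun _ => tsum_nonneg fun _ => hF _) h2⟩

namespace IsNuclear

variable {ι : Type} {X : Fock →L[ℂ] Fock} {u v : ι → Fock}

lemma summable_norm_inner (h : IsNuclear X u v) (S : Fock →L[ℂ] Fock) :
    Summable (fun k => ‖⟪v k, S (u k)⟫_ℂ‖) :=
  (h.summable.mul_left ‖S‖).of_nonneg_of_le (fun _ => norm_nonneg _) fun k => by
    rw [mul_comm ‖u k‖]; exact IsKraus.norm_inner_le _ _ _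

/-- `Tr[X S] = ∑ₖ ⟨vₖ|S|uₖ⟩`. -/
lemma hasSum_diag (h : IsNuclear X u v) (S : Fock →L[ℂ] Fock) :
    HasSum (fun n : ℕ => ⟪(ket n : Fock), X (S (ket n))⟫_ℂ) (∑' k, ⟪v k, S (u k)⟫_ℂ) := by
  let F : ι × ℕ → ℂ := fun p => ⟪v p.1, S (ket p.2)⟫_ℂ * ⟪(ket p.2 : Fock), u p.1⟫_ℂ
  have hF : ∀ p, F p = ⟪S.adjoint (v p.1), (ket p.2 : Fock)⟫_ℂ * ⟪(ket p.2 : Fock), u p.1⟫_ℂ :=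
    fun p => by rw [ContinuousLinearMap.adjoint_inner_left]
  -- Absolute convergence permits summing in either order: over n first, Parseval gives ⟨vₖ|S|uₖ⟩;
  -- over k first, the nuclear expansion gives the diagonal element of X S.
  have hsum : Summable F := by
    refine Summable.of_norm (summable_prod_of_le (fun _ => norm_nonneg _) (fun k => ?_)
      (h.summable.mul_left ‖S‖) fun k => ?_)
    · simp_rw [hF]
      exact (summable_norm_inner_mul_inner (S.adjoint (v k)) (u k)).1
    · simp_rw [hF]
      refine (summable_norm_inner_mul_inner (S.adjoint (v k)) (u k)).2.trans ?_
      calc ‖S.adjoint (v k)‖ * ‖u k‖ ≤ (‖S‖ * ‖v k‖) * ‖u k‖ := by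
            gcongr
            exact (S.adjoint.le_opNorm _).trans_eq (by rw [LinearIsometryEquiv.norm_map])
        _ = _ := by ring
  rw [← tsum_prod_right hsum (a := fun k => ⟪v k, S (u k)⟫_ℂ) fun k => ?_]
  · exact hasSum_prod_left hsum fun n => h.hasSum (ket n) (S (ket n))
  · simp_rw [hF, ← ContinuousLinearMap.adjoint_inner_left]
    exact hasSum_inner_mul_inner (S.adjoint (v k)) (u k)

lemma summable_map {d : ℝ} {M : ℕ → Fock →L[ℂ] Fock} (h : IsNuclear X u v) (hM : IsKraus d M) :
    Summable (fun p : ι × ℕ => ‖M p.2 (u p.1)‖ * ‖M p.2 (v p.1)‖) :=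
  summable_prod_of_le (fun _ => mul_nonneg (norm_nonneg _) (norm_nonneg _))
    (fun k => hM.summable_norm_mul (u k) (v k)) (h.summable.mul_left (d ^ 2))
    fun k => hM.tsum_norm_mul_le (u k) (v k)

/-- Every Kraus operator is applied to every term of the decomposition. Leaving the index type free
lets the double family stand without being re-enumerated by ℕ. -/
lemma map {c d : ℝ} {M : ℕ → Fock →L[ℂ] Fock} {Φ : (Fock →L[ℂ] Fock) → (Fock →L[ℂ] Fock)}
    (h : IsNuclear X u v) (hΦ : IsKrausMap c (fun n => (M n).adjoint) Φ) (hM : IsKraus d M) :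
    IsNuclear (Φ X) (fun p : ι × ℕ => M p.2 (u p.1)) (fun p => M p.2 (v p.1)) where
  summable := h.summable_map hM
  hasSum φ ψ := by
    let F : ι × ℕ → ℂ := fun p => ⟪M p.2 (v p.1), ψ⟫_ℂ * ⟪φ, M p.2 (u p.1)⟫_ℂ
    have hsum : Summable F := by
      refine Summable.of_norm_bounded ((h.summable_map hM).mul_left (‖ψ‖ * ‖φ‖)) fun p => ?_
      rw [norm_mul]
      calc _ ≤ (‖M p.2 (v p.1)‖ * ‖ψ‖) * (‖φ‖ * ‖M p.2 (u p.1)‖) := by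
            gcongr <;> exact norm_inner_le_norm _ _
        _ = _ := by ring
    have h2 : HasSum (fun n => ⟪(M n).adjoint φ, X ((M n).adjoint ψ)⟫_ℂ) (∑' p, F p) := by
      refine hasSum_prod_left hsum fun n => ?_
      refine (h.hasSum ((M n).adjoint φ) ((M n).adjoint ψ)).congr_fun fun k => ?_
      rw [ContinuousLinearMap.adjoint_inner_left, ContinuousLinearMap.adjoint_inner_right]
    rw [(hΦ.hasSum X φ ψ).unique h2]
    exact hsum.hasSum

/-- Duality of a Kraus map with respect to the trace pairing. -/
lemma tsum_map {c d : ℝ} {M : ℕ → Fock →L[ℂ] Fock} {Φ : (Fock →L[ℂ] Fock) → (Fock →L[ℂ] Fock)}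
    (h : IsNuclear X u v) (hΦ : IsKrausMap c (fun n => (M n).adjoint) Φ) (hM : IsKraus d M)
    {S S' : Fock →L[ℂ] Fock}
    (hS : ∀ φ ψ, HasSum (fun n => ⟪M n φ, S (M n ψ)⟫_ℂ) ⟪φ, S' ψ⟫_ℂ) :
    ∑' p : ι × ℕ, ⟪M p.2 (v p.1), S (M p.2 (u p.1))⟫_ℂ = ∑' k, ⟪v k, S' (u k)⟫_ℂ :=
  tsum_prod_right ((h.map hΦ hM).summable_norm_inner S).of_norm fun k => hS (v k) (u k)

/-- The nuclear decomposition of `𝒞(X)` attached to one of `X`. -/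
lemma channelC (h : IsNuclear X u v) :
    IsNuclear (channelC X) (fun p : (ι × ℕ) × ℕ => attKraus p.2 (ampKraus p.1.2 (u p.1.1)))
      (fun p => attKraus p.2 (ampKraus p.1.2 (v p.1.1))) :=
  (h.map isKrausMap_amplifier isKraus_ampKraus).map isKrausMap_attenuator isKraus_attKraus

/-- `Tr[𝒞(X) S] = Tr[X 𝒞(S)]`. -/
lemma tsum_channelC (h : IsNuclear X u v) (S : Fock →L[ℂ] Fock) :
    ∑' p : (ι × ℕ) × ℕ, ⟪attKraus p.2 (ampKraus p.1.2 (v p.1.1)),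
      S (attKraus p.2 (ampKraus p.1.2 (u p.1.1)))⟫_ℂ =
      ∑' k, ⟪v k, QuantumOptics.channelC S (u k)⟫_ℂ := by
  -- The outer attenuator is moved across the pairing as twice the amplifier, then the inner
  -- amplifier as half the attenuator. The factors cancel and the order is again attenuator after
  -- amplifier.
  rw [(h.map isKrausMap_amplifier isKraus_ampKraus).tsum_map isKrausMap_attenuator
    isKraus_attKraus (S' := (2 : ℂ) • amplifier 2 S) (fun φ ψ => by
      rw [smul_apply, inner_smul_right]; exact hasSum_amplifier S φ ψ)]
  refine h.tsum_map isKrausMap_amplifier isKraus_ampKraus (fun φ ψ => ?_)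
  have := (hasSum_attenuator (amplifier 2 S) φ ψ).mul_left 2
  rw [← mul_assoc, mul_one_div_cancel two_ne_zero, one_mul] at this
  refine this.congr_fun fun n => ?_
  rw [smul_apply, inner_smul_right]

end IsNuclear

/-! ### Gaussian integrals over the complex plane -/

/-- In real coordinates uα + vα* = (u + v) Re α + i(u - v) Im α, which reduces the integrals over ℂ
to real Gaussian integrals in two variables. -/
lemma gaussian_eq_comp (c : ℝ) (u v w : ℂ) (α : ℂ) :
    Complex.exp (-(c * (α * conj α)) + u * α + v * conj α + w) =
      Complex.exp w * (fun x : Fin 2 → ℝ => Complex.exp (-(c : ℂ) * ∑ i, (x i : ℂ) ^ 2 +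
        ∑ i, (![u + v, Complex.I * (u - v)]) i * x i)) (Complex.measurableEquivPi α) := by
  rw [Complex.measurableEquivPi_apply, ← Complex.exp_add]
  congr 1
  simp only [Fin.sum_univ_two, Matrix.cons_val_zero, Matrix.cons_val_one]
  have h1 : α = α.re + α.im * Complex.I := (Complex.re_add_im α).symm
  have h2 : conj α = α.re - α.im * Complex.I := by
    apply Complex.ext <;> simp
  rw [h2]
  linear_combination (-(c : ℂ) * (α.re - α.im * Complex.I) + u) * h1 +
    (c : ℂ) * (α.im : ℂ) ^ 2 * Complex.I_sq

lemma integrable_gaussian {c : ℝ} (hc : 0 < c) (u v w : ℂ) :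
    Integrable (fun α : ℂ => Complex.exp (-(c * (α * conj α)) + u * α + v * conj α + w)) := by
  simp_rw [gaussian_eq_comp]
  refine Integrable.const_mul ?_ _
  exact (Complex.volume_preserving_equiv_pi.integrable_comp_emb
    Complex.measurableEquivPi.measurableEmbedding).2
    (GaussianFourier.integrable_cexp_neg_mul_sum_add (by simpa using hc) _)

lemma integral_gaussian_add {c : ℝ} (hc : 0 < c) (u v w : ℂ) :
    ∫ α : ℂ, Complex.exp (-(c * (α * conj α)) + u * α + v * conj α + w) =
      Real.pi / c * Complex.exp (u * v / c + w) := by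
  have hc' : (c : ℂ) ≠ 0 := by exact_mod_cast hc.ne'
  simp_rw [gaussian_eq_comp]
  rw [integral_const_mul, Complex.volume_preserving_equiv_pi.integral_comp
    Complex.measurableEquivPi.measurableEmbedding (fun x : Fin 2 → ℝ =>
      Complex.exp (-(c : ℂ) * ∑ i, (x i : ℂ) ^ 2 +
        ∑ i, (![u + v, Complex.I * (u - v)]) i * x i)),
    GaussianFourier.integral_cexp_neg_mul_sum_add (by simpa using hc)]
  simp only [Fintype.card_fin, Fin.sum_univ_two, Matrix.cons_val_zero, Matrix.cons_val_one]
  rw [Nat.cast_ofNat, div_self two_ne_zero, Complex.cpow_one, mul_left_comm, ← Complex.exp_add]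
  congr 2
  rw [mul_pow, Complex.I_sq]
  field_simp
  ring

/-! ### Weak integrals of coherent states -/

lemma inner_coherent_expVec' (α γ : ℂ) :
    ⟪coherent α, expVec γ⟫_ℂ = Complex.exp (-(α * conj α) / 2 + conj α * γ) := by
  rw [inner_coherent_expVec, Complex.mul_conj']

lemma inner_expVec_coherent' (α γ : ℂ) :
    ⟪expVec γ, coherent α⟫_ℂ = Complex.exp (-(α * conj α) / 2 + conj γ * α) := by
  rw [inner_expVec_coherent, Complex.mul_conj']

/-- `⟨φ|α⟩⟨α|ψ⟩`. -/
def cohForm (α : ℂ) (φ ψ : Fock) : ℂ := ⟪φ, coherent α⟫_ℂ * ⟪coherent α, ψ⟫_ℂ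

lemma cohForm_add_left (α : ℂ) (φ φ' ψ : Fock) :
    cohForm α (φ + φ') ψ = cohForm α φ ψ + cohForm α φ' ψ := by
  rw [cohForm, inner_add_left, add_mul]; rfl

lemma cohForm_smul_left (α c : ℂ) (φ ψ : Fock) :
    cohForm α (c • φ) ψ = conj c * cohForm α φ ψ := by
  rw [cohForm, inner_smul_left, mul_assoc]; rfl

lemma cohForm_add_right (α : ℂ) (φ ψ ψ' : Fock) :
    cohForm α φ (ψ + ψ') = cohForm α φ ψ + cohForm α φ ψ' := by
  rw [cohForm, inner_add_right, mul_add]; rfl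

lemma cohForm_smul_right (α c : ℂ) (φ ψ : Fock) :
    cohForm α φ (c • ψ) = c * cohForm α φ ψ := by
  rw [cohForm, inner_smul_right, mul_left_comm]; rfl

lemma continuous_cohForm (φ ψ : Fock) : Continuous (fun α => cohForm α φ ψ) :=
  (continuous_const.inner continuous_coherent).mul (continuous_coherent.inner continuous_const)

lemma norm_cohForm_eq (α : ℂ) (φ ψ : Fock) :
    ‖cohForm α φ ψ‖ = ‖⟪coherent α, φ⟫_ℂ‖ * ‖⟪coherent α, ψ⟫_ℂ‖ := by
  rw [cohForm, norm_mul, norm_inner_symm]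

lemma norm_cohForm_le (α : ℂ) (φ ψ : Fock) : ‖cohForm α φ ψ‖ ≤ ‖φ‖ * ‖ψ‖ := by
  rw [norm_cohForm_eq]
  have h : ∀ χ : Fock, ‖⟪coherent α, χ⟫_ℂ‖ ≤ ‖χ‖ := fun χ => by
    simpa [norm_coherent] using norm_inner_le_norm (𝕜 := ℂ) (coherent α) χ
  gcongr <;> exact h _

lemma cohForm_expVec (α γ δ : ℂ) :
    cohForm α (expVec γ) (expVec δ) =
      Complex.exp (-(α * conj α) + conj γ * α + δ * conj α) := by
  rw [cohForm, inner_expVec_coherent', inner_coherent_expVec', ← Complex.exp_add]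
  congr 1; ring

/-- The resolution of the identity by coherent states, on a dense subspace where it is a Gaussian
integral. -/
lemma cohForm_span {φ ψ : Fock} (hφ : φ ∈ Submodule.span ℂ (Set.range expVec))
    (hψ : ψ ∈ Submodule.span ℂ (Set.range expVec)) :
    Integrable (fun α => cohForm α φ ψ) ∧ ∫ α, cohForm α φ ψ = Real.pi * ⟪φ, ψ⟫_ℂ := by
  induction hφ using Submodule.span_induction with
  | mem x hx =>
    obtain ⟨γ, rfl⟩ := hx
    induction hψ using Submodule.span_induction with
    | mem y hy =>
      obtain ⟨δ, rfl⟩ := hy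
      have h : ∀ α, cohForm α (expVec γ) (expVec δ) =
          Complex.exp (-((1 : ℝ) * (α * conj α)) + conj γ * α + δ * conj α + 0) := fun α => by
        rw [cohForm_expVec]; simp
      simp_rw [h]
      refine ⟨integrable_gaussian one_pos _ _ _, ?_⟩
      rw [integral_gaussian_add one_pos, inner_expVec]
      simp
    | zero => simp [cohForm]
    | add x y _ _ hx hy =>
      simp_rw [cohForm_add_right]
      exact ⟨hx.1.add hy.1, by rw [integral_add hx.1 hy.1, hx.2, hy.2, inner_add_right, mul_add]⟩
    | smul a x _ hx =>
      simp_rw [cohForm_smul_right]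
      exact ⟨hx.1.const_mul a, by
        rw [integral_const_mul, hx.2, inner_smul_right, mul_left_comm]⟩
  | zero => simp [cohForm]
  | add x y _ _ hx hy =>
    simp_rw [cohForm_add_left]
    exact ⟨hx.1.add hy.1, by rw [integral_add hx.1 hy.1, hx.2, hy.2, inner_add_left, mul_add]⟩
  | smul a x _ hx =>
    simp_rw [cohForm_smul_left]
    exact ⟨hx.1.const_mul _, by rw [integral_const_mul, hx.2, inner_smul_left, mul_left_comm]⟩

lemma continuous_inner_coherent (φ : Fock) : Continuous (fun α => ⟪coherent α, φ⟫_ℂ) :=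
  continuous_coherent.inner continuous_const

/-- Fatou's lemma extends the resolution of the identity from the dense span as an inequality, which
is enough for integrability and for bounds on forms. -/
lemma lintegral_inner_coherent_le (φ : Fock) :
    ∫⁻ α, ‖⟪coherent α, φ⟫_ℂ‖ₑ ^ 2 ≤ ENNReal.ofReal (Real.pi * ‖φ‖ ^ 2) := by
  have hspan : ∀ ψ ∈ Submodule.span ℂ (Set.range expVec),
      ∫⁻ α, ‖⟪coherent α, ψ⟫_ℂ‖ₑ ^ 2 = ENNReal.ofReal (Real.pi * ‖ψ‖ ^ 2) := fun ψ hψ => by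
    obtain ⟨h1, h2⟩ := cohForm_span hψ hψ
    have h3 : ∀ α, cohForm α ψ ψ = ((‖⟪coherent α, ψ⟫_ℂ‖ ^ 2 : ℝ) : ℂ) := fun α => by
      rw [cohForm, ← inner_conj_symm, Complex.conj_mul', Complex.ofReal_pow]
    simp_rw [h3] at h1 h2
    rw [integral_complex_ofReal, inner_self_eq_norm_sq_to_K] at h2
    have h4 : ∫ α, ‖⟪coherent α, ψ⟫_ℂ‖ ^ 2 = Real.pi * ‖ψ‖ ^ 2 := by
      have h5 : ((∫ α, ‖⟪coherent α, ψ⟫_ℂ‖ ^ 2 : ℝ) : ℂ) = ((Real.pi * ‖ψ‖ ^ 2 : ℝ) : ℂ) := by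
        rw [h2]; simp
      exact_mod_cast h5
    have h1' : Integrable (fun α => ‖⟪coherent α, ψ⟫_ℂ‖ ^ 2) := h1.re
    rw [← h4, ofReal_integral_eq_lintegral_ofReal h1'
      (Eventually.of_forall fun _ => by positivity)]
    refine lintegral_congr fun α => ?_
    rw [ENNReal.ofReal_pow (norm_nonneg _), ofReal_norm]
  obtain ⟨s, hs, hlim⟩ := mem_closure_iff_seq_limit.1 (dense_span_expVec φ)
  have hl : ∀ α, Tendsto (fun n => ‖⟪coherent α, s n⟫_ℂ‖ₑ ^ 2) atTop
      (𝓝 (‖⟪coherent α, φ⟫_ℂ‖ₑ ^ 2)) := fun α =>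
    ((ENNReal.continuous_pow 2).tendsto _).comp (((tendsto_const_nhds).inner hlim).enorm)
  calc ∫⁻ α, ‖⟪coherent α, φ⟫_ℂ‖ₑ ^ 2
      = ∫⁻ α, liminf (fun n => ‖⟪coherent α, s n⟫_ℂ‖ₑ ^ 2) atTop :=
        lintegral_congr fun α => (hl α).liminf_eq.symm
    _ ≤ liminf (fun n => ∫⁻ α, ‖⟪coherent α, s n⟫_ℂ‖ₑ ^ 2) atTop :=
        lintegral_liminf_le fun n => ((continuous_inner_coherent (s n)).enorm.measurable.pow_const 2)
    _ = ENNReal.ofReal (Real.pi * ‖φ‖ ^ 2) := by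
        simp_rw [hspan _ (hs _)]
        exact ((ENNReal.continuous_ofReal.tendsto _).comp
          (((hlim.norm).pow 2).const_mul Real.pi)).liminf_eq

lemma memLp_inner_coherent (φ : Fock) : MemLp (fun α => ⟪coherent α, φ⟫_ℂ) 2 := by
  rw [← integrable_norm_rpow_iff (continuous_inner_coherent φ).aestronglyMeasurable (by simp)
    (by simp)]
  refine ⟨?_, ?_⟩
  · exact ((continuous_inner_coherent φ).norm.rpow_const (by simp)).aestronglyMeasurable
  · refine lt_of_le_of_lt (lintegral_mono fun α => ?_)
      (lt_of_le_of_lt (lintegral_inner_coherent_le φ) ENNReal.ofReal_lt_top)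
    simp

lemma integral_inner_coherent_sq_le (φ : Fock) :
    ∫ α, ‖⟪coherent α, φ⟫_ℂ‖ ^ 2 ≤ Real.pi * ‖φ‖ ^ 2 := by
  rw [integral_eq_lintegral_of_nonneg_ae (Eventually.of_forall fun _ => by positivity)
    (Continuous.aestronglyMeasurable (by have := continuous_inner_coherent φ; fun_prop))]
  refine ENNReal.toReal_le_of_le_ofReal (by positivity) ?_
  refine le_trans (le_of_eq (lintegral_congr fun α => ?_)) (lintegral_inner_coherent_le φ)
  rw [ENNReal.ofReal_pow (norm_nonneg _), ofReal_norm]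

lemma integrable_cohForm (φ ψ : Fock) : Integrable (fun α => cohForm α φ ψ) := by
  have := (memLp_inner_coherent φ).norm.integrable_mul (memLp_inner_coherent ψ).norm
  refine this.mono' (continuous_cohForm φ ψ).aestronglyMeasurable (Eventually.of_forall fun α => ?_)
  rw [norm_cohForm_eq]
  rfl

lemma integral_norm_cohForm_le (φ ψ : Fock) :
    ∫ α, ‖cohForm α φ ψ‖ ≤ Real.pi * ‖φ‖ * ‖ψ‖ := by
  simp_rw [norm_cohForm_eq]
  have h := integral_mul_norm_le_Lp_mul_Lq (μ := (volume : Measure ℂ))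
    (Real.HolderConjugate.two_two)
    (f := fun α => ⟪coherent α, φ⟫_ℂ) (g := fun α => ⟪coherent α, ψ⟫_ℂ)
    (by simpa using memLp_inner_coherent φ) (by simpa using memLp_inner_coherent ψ)
  refine h.trans ?_
  simp only [Real.rpow_ofNat, ← Real.sqrt_eq_rpow]
  calc _ ≤ √(Real.pi * ‖φ‖ ^ 2) * √(Real.pi * ‖ψ‖ ^ 2) := by
        gcongr <;> exact integral_inner_coherent_sq_le _
    _ = Real.pi * ‖φ‖ * ‖ψ‖ := by
        rw [Real.sqrt_mul Real.pi_pos.le, Real.sqrt_mul Real.pi_pos.le,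
          Real.sqrt_sq (norm_nonneg _), Real.sqrt_sq (norm_nonneg _), mul_mul_mul_comm,
          Real.mul_self_sqrt Real.pi_pos.le, mul_assoc]

/-! ### Operators given by weak integrals of coherent states -/

/-- The function `p` defines a bounded operator `∫ d²α p(α) |α⟩⟨α|` by absolutely convergent weak
integrals. -/
def IsSymbol (p : ℂ → ℂ) : Prop :=
  (∀ φ ψ, Integrable (fun α => p α * cohForm α φ ψ)) ∧
    ∃ c, ∀ φ ψ, ∫ α, ‖p α * cohForm α φ ψ‖ ≤ c * ‖φ‖ * ‖ψ‖

lemma isSymbol_of_integrable {p : ℂ → ℂ} (hp : Integrable p) : IsSymbol p := by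
  have h : ∀ φ ψ, ∀ α, ‖p α * cohForm α φ ψ‖ ≤ ‖p α‖ * (‖φ‖ * ‖ψ‖) := fun φ ψ α => by
    rw [norm_mul]; gcongr; exact norm_cohForm_le α φ ψ
  have hi : ∀ φ ψ, Integrable (fun α => p α * cohForm α φ ψ) := fun φ ψ =>
    (hp.norm.mul_const (‖φ‖ * ‖ψ‖)).mono'
      (hp.aestronglyMeasurable.mul (continuous_cohForm φ ψ).aestronglyMeasurable)
      (Eventually.of_forall (h φ ψ))
  refine ⟨hi, ∫ α, ‖p α‖, fun φ ψ => ?_⟩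
  rw [mul_assoc, ← integral_mul_const]
  exact integral_mono (hi φ ψ).norm (hp.norm.mul_const _) (h φ ψ)

/-- Applies to kernels and Husimi functions, which are bounded but need not be integrable: the
integrability comes from the coherent-state matrix elements. -/
lemma isSymbol_of_bounded {p : ℂ → ℂ} (hp : AEStronglyMeasurable p) {B : ℝ}
    (hB : ∀ α, ‖p α‖ ≤ B) : IsSymbol p := by
  have h : ∀ φ ψ, ∀ α, ‖p α * cohForm α φ ψ‖ ≤ B * ‖cohForm α φ ψ‖ := fun φ ψ α => by
    rw [norm_mul]; gcongr; exact hB α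
  have hi : ∀ φ ψ, Integrable (fun α => p α * cohForm α φ ψ) := fun φ ψ =>
    ((integrable_cohForm φ ψ).norm.const_mul B).mono'
      (hp.mul (continuous_cohForm φ ψ).aestronglyMeasurable) (Eventually.of_forall (h φ ψ))
  have hB0 : 0 ≤ B := (norm_nonneg _).trans (hB 0)
  refine ⟨hi, B * Real.pi, fun φ ψ => ?_⟩
  calc ∫ α, ‖p α * cohForm α φ ψ‖ ≤ ∫ α, B * ‖cohForm α φ ψ‖ :=
        integral_mono (hi φ ψ).norm ((integrable_cohForm φ ψ).norm.const_mul B) (h φ ψ)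
    _ ≤ B * (Real.pi * ‖φ‖ * ‖ψ‖) := by
        rw [integral_const_mul]; gcongr; exact integral_norm_cohForm_le φ ψ
    _ = _ := by ring

lemma IsSymbol.isBddSesq {p : ℂ → ℂ} (hp : IsSymbol p) :
    IsBddSesq (fun φ ψ => ∫ α, p α * cohForm α φ ψ) := by
  obtain ⟨h, c, hc⟩ := hp
  refine IsBddSesq.integral (fun x φ φ' ψ => ?_) (fun x a φ ψ => ?_) (fun x φ ψ ψ' => ?_)
    (fun x a φ ψ => ?_) h hc
  · rw [cohForm_add_left, mul_add]
  · rw [cohForm_smul_left, mul_left_comm]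
  · rw [cohForm_add_right, mul_add]
  · rw [cohForm_smul_right, mul_left_comm]

/-- Every Kraus operator sends |α⟩ to a multiple of |s⟩ with s = α/√2. The squared coefficients are
the Poisson weights e^{-|s|²}|s|^{2n}/n!, which add up to 1. -/
lemma hasSum_attKraus_cohForm (α : ℂ) (φ ψ : Fock) :
    HasSum (fun n => cohForm α ((attKraus n).adjoint φ) ((attKraus n).adjoint ψ))
      (cohForm (α * invSqrtTwo) φ ψ) := by
  set s := α * invSqrtTwo with hs
  have h1 : ∀ n, cohForm α ((attKraus n).adjoint φ) ((attKraus n).adjoint ψ) =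
      Complex.exp (-(α * conj α)) * ((s * conj s) ^ n / n.factorial) *
        (⟪φ, expVec s⟫_ℂ * ⟪expVec s, ψ⟫_ℂ) := fun n => by
    rw [cohForm, ContinuousLinearMap.adjoint_inner_left, ContinuousLinearMap.adjoint_inner_right,
      coherent_eq, map_smul, attKraus_expVec, ← hs, inner_smul_right, inner_smul_right,
      inner_smul_left, inner_smul_left, Complex.conj_ofReal, map_div₀, conj_sqrtFact, map_pow,
      map_neg, ← sqrtFact_sq, neg_pow, neg_pow (conj s), mul_pow, Complex.mul_conj']
    have e5 : ((-1 : ℂ) ^ n) * (-1) ^ n = 1 := by rw [← mul_pow]; simp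
    have e6 : ((Real.exp (-‖α‖ ^ 2 / 2) : ℝ) : ℂ) * ((Real.exp (-‖α‖ ^ 2 / 2) : ℝ) : ℂ) =
        Complex.exp (-(‖α‖ : ℂ) ^ 2) := by
      rw [← Complex.ofReal_mul, ← Real.exp_add, Complex.ofReal_exp]
      congr 1; push_cast; ring
    rw [← e6]
    have := sqrtFact_ne_zero n
    field_simp
    generalize (-1 : ℂ) ^ n = t at e5 ⊢
    linear_combination (s ^ n * conj s ^ n * ⟪φ, expVec s⟫_ℂ * ⟪expVec s, ψ⟫_ℂ) * e5
  have h2 : cohForm s φ ψ = Complex.exp (-(α * conj α)) * Complex.exp (s * conj s) *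
      (⟪φ, expVec s⟫_ℂ * ⟪expVec s, ψ⟫_ℂ) := by
    rw [cohForm, coherent_eq, inner_smul_right, inner_smul_left, Complex.conj_ofReal,
      ← Complex.exp_add]
    have e7 : s * conj s = (α * conj α) / 2 := by
      rw [hs, map_mul, conj_invSqrtTwo]; linear_combination α * conj α * invSqrtTwo_mul_self
    have e6 : ((Real.exp (-‖s‖ ^ 2 / 2) : ℝ) : ℂ) * ((Real.exp (-‖s‖ ^ 2 / 2) : ℝ) : ℂ) =
        Complex.exp (-(s * conj s)) := by
      rw [Complex.mul_conj', ← Complex.ofReal_mul, ← Real.exp_add, Complex.ofReal_exp]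
      congr 1; push_cast; ring
    rw [show -(α * conj α) + s * conj s = -(s * conj s) by rw [e7]; ring, ← e6]
    ring
  rw [h2]
  refine HasSum.congr_fun ?_ h1
  refine (HasSum.mul_left _ ?_).mul_right _
  rw [Complex.exp_eq_exp_ℂ]
  exact NormedSpace.expSeries_div_hasSum_exp _

/-- The attenuator maps `|α⟩⟨α|` to `|α/√2⟩⟨α/√2|`, also under weak integrals. -/
lemma attenuator_of_symbol {p : ℂ → ℂ} (hp : IsSymbol p) {Y : Fock →L[ℂ] Fock} {a : ℂ}
    (hY : ∀ φ ψ, ⟪φ, Y ψ⟫_ℂ = a * ∫ α, p α * cohForm α φ ψ) (φ ψ : Fock) :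
    ⟪φ, attenuator (1 / 2) Y ψ⟫_ℂ = a * ∫ α, p α * cohForm (α * invSqrtTwo) φ ψ := by
  obtain ⟨h, c, hc⟩ := hp
  have h1 := hasSum_integral_of_summable_integral_norm
    (F := fun n α => p α * cohForm α ((attKraus n).adjoint φ) ((attKraus n).adjoint ψ))
    (fun n => h _ _)
    (((isKraus_adjoint_attKraus.summable_norm_mul φ ψ).mul_left c).of_nonneg_of_le
      (fun n => integral_nonneg fun _ => norm_nonneg _)
      fun n => (hc _ _).trans_eq (mul_assoc _ _ _))
  have h2 : ∀ α, ∑' n, p α * cohForm α ((attKraus n).adjoint φ) ((attKraus n).adjoint ψ) =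
      p α * cohForm (α * invSqrtTwo) φ ψ := fun α =>
    ((hasSum_attKraus_cohForm α φ ψ).mul_left (p α)).tsum_eq
  simp_rw [h2] at h1
  refine (hasSum_attenuator' Y φ ψ).unique ((h1.mul_left a).congr_fun fun n => ?_)
  rw [hY]

/-! ### Explicit Gaussian formulas -/

lemma inner_expVec_displacement (β γ δ : ℂ) :
    ⟪expVec γ, displacement β (expVec δ)⟫_ℂ =
      Complex.exp (-(β * conj β) / 2 - conj β * δ + conj γ * (δ + β)) := by
  rw [displacement_expVec, inner_smul_right, inner_expVec, ← Complex.exp_add]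
  congr 1; ring

lemma norm_symplecticKernel (α β : ℂ) : ‖symplecticKernel α β‖ = 1 := by
  rw [symplecticKernel, Complex.norm_exp]
  simp [mul_comm]

lemma continuous_symplecticKernel : Continuous (fun p : ℂ × ℂ => symplecticKernel p.1 p.2) := by
  unfold symplecticKernel; fun_prop

lemma continuous_symplecticKernel_left (β : ℂ) : Continuous (fun α => symplecticKernel α β) := by
  unfold symplecticKernel; fun_prop

lemma continuous_symplecticKernel_right (α : ℂ) : Continuous (fun β => symplecticKernel α β) := by
  unfold symplecticKernel; fun_prop

lemma isSymbol_symplecticKernel (β : ℂ) : IsSymbol (fun α => symplecticKernel α β) :=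
  isSymbol_of_bounded (continuous_symplecticKernel_left β).aestronglyMeasurable
    fun α => (norm_symplecticKernel α β).le

/-- The Gaussian `e^{-|β|²/2}`. -/
def gauss (β : ℂ) : ℂ := Complex.exp (-(β * conj β) / 2)

lemma gauss_ne_zero (β : ℂ) : gauss β ≠ 0 := Complex.exp_ne_zero _

lemma gauss_neg (β : ℂ) : gauss (-β) = gauss β := by simp [gauss]

lemma continuous_gauss : Continuous gauss := by unfold gauss; fun_prop

lemma integrable_gauss : Integrable gauss := by
  refine (integrable_gaussian (c := 1 / 2) (by norm_num) 0 0 0).congr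
    (Eventually.of_forall fun β => ?_)
  simp only [gauss]
  congr 1; push_cast; ring

/-- The coherent-state expansion of the displacement operators. -/
lemma integral_symplecticKernel_mul_cohForm (β : ℂ) (φ ψ : Fock) :
    ∫ α, symplecticKernel α β * cohForm α φ ψ =
      Real.pi * gauss β * ⟪φ, displacement (-β) ψ⟫_ℂ := by
  refine (isSymbol_symplecticKernel β).isBddSesq.ext_expVec
    ((IsBddSesq.inner_apply (displacement (-β))).const_mul (Real.pi * gauss β)) (fun γ δ => ?_) φ ψ
  have h : ∀ α, symplecticKernel α β * cohForm α (expVec γ) (expVec δ) =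
      Complex.exp (-((1 : ℝ) * (α * conj α)) + (conj γ + conj β) * α + (δ - β) * conj α + 0) :=
    fun α => by
      rw [symplecticKernel, cohForm_expVec, ← Complex.exp_add]
      congr 1; push_cast; ring
  simp_rw [h]
  rw [integral_gaussian_add one_pos, inner_expVec_displacement, gauss, mul_assoc,
    ← Complex.exp_add]
  push_cast
  rw [div_one, map_neg]
  congr 2; ring

lemma inner_attKraus_expVec (X : Fock →L[ℂ] Fock) (n : ℕ) (γ δ : ℂ) :
    ⟪attKraus n (expVec γ), X (attKraus n (expVec δ))⟫_ℂ =
      ((conj γ * δ / 2) ^ n / n.factorial) *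
        ⟪expVec (γ * invSqrtTwo), X (expVec (δ * invSqrtTwo))⟫_ℂ := by
  rw [attKraus_expVec, attKraus_expVec, map_smul, inner_smul_left, inner_smul_right, map_div₀,
    conj_sqrtFact, map_pow, ← mul_assoc, div_mul_div_comm, ← mul_pow, sqrtFact_sq, map_neg, map_mul,
    conj_invSqrtTwo]
  congr 3
  linear_combination conj γ * δ * invSqrtTwo_mul_self

/-- Exponential vectors are mapped to multiples of exponential vectors by all dual Kraus operators,
so the Kraus series is the scalar exponential series. -/
lemma amplifier_expVec (X : Fock →L[ℂ] Fock) (γ δ : ℂ) :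
    ⟪expVec γ, amplifier 2 X (expVec δ)⟫_ℂ = 1 / 2 * Complex.exp (conj γ * δ / 2) *
      ⟪expVec (γ * invSqrtTwo), X (expVec (δ * invSqrtTwo))⟫_ℂ := by
  have h1 := hasSum_amplifier X (expVec γ) (expVec δ)
  simp_rw [inner_attKraus_expVec] at h1
  have h2 : HasSum (fun n : ℕ => (conj γ * δ / 2) ^ n / n.factorial)
      (Complex.exp (conj γ * δ / 2)) := by
    rw [Complex.exp_eq_exp_ℂ]
    exact NormedSpace.expSeries_div_hasSum_exp _
  have h3 := h1.unique (h2.mul_right _)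
  linear_combination (1 / 2 : ℂ) * h3

lemma amplifier_displacement (γ : ℂ) :
    amplifier 2 (displacement γ) =
      (1 / 2 * Complex.exp (-(γ * conj γ) / 4)) • displacement (γ * invSqrtTwo) := by
  refine clm_ext_inner fun φ ψ => (IsBddSesq.inner_apply _).ext_expVec (IsBddSesq.inner_apply _)
    (fun a b => ?_) φ ψ
  rw [amplifier_expVec, smul_apply, inner_smul_right, inner_expVec_displacement,
    inner_expVec_displacement, mul_assoc, mul_assoc, ← Complex.exp_add, ← Complex.exp_add]
  congr 2
  simp only [map_mul, conj_invSqrtTwo]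
  linear_combination (conj a * b + γ * conj γ / 2) * invSqrtTwo_mul_self

/-- The attenuator acts simply on coherent projectors, so the displacement operator is first
expanded in them; dividing by the Gaussian of that expansion is harmless since it never vanishes. -/
lemma attenuator_displacement (γ : ℂ) :
    attenuator (1 / 2) (displacement (γ * invSqrtTwo)) =
      (2 * Complex.exp (-(γ * conj γ) / 4)) • displacement γ := by
  set s := invSqrtTwo with hs
  have hss : s * s = 1 / 2 := invSqrtTwo_mul_self
  have hY : ∀ φ ψ, ⟪φ, displacement (γ * s) ψ⟫_ℂ = ((Real.pi : ℂ)⁻¹ * (gauss (γ * s))⁻¹) *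
      ∫ α, symplecticKernel α (-(γ * s)) * cohForm α φ ψ := fun φ ψ => by
    rw [integral_symplecticKernel_mul_cohForm, gauss_neg, neg_neg]
    have := gauss_ne_zero (γ * s)
    have : (Real.pi : ℂ) ≠ 0 := by exact_mod_cast Real.pi_ne_zero
    field_simp
  refine clm_ext_inner fun φ ψ => (IsBddSesq.inner_apply _).ext_expVec (IsBddSesq.inner_apply _)
    (fun a b => ?_) φ ψ
  rw [attenuator_of_symbol (isSymbol_symplecticKernel _) hY]
  have h : ∀ α, symplecticKernel α (-(γ * s)) * cohForm (α * s) (expVec a) (expVec b) =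
      Complex.exp (-((1 / 2 : ℝ) * (α * conj α)) + (conj a * s - conj γ * s) * α +
        (b * s + γ * s) * conj α + 0) := fun α => by
    rw [symplecticKernel, cohForm_expVec, ← Complex.exp_add]
    congr 1
    simp only [map_mul, map_neg, hs, conj_invSqrtTwo]
    push_cast
    linear_combination -(α * conj α) * invSqrtTwo_mul_self
  simp_rw [← hs, h]
  rw [integral_gaussian_add (by norm_num), smul_apply, inner_smul_right,
    inner_expVec_displacement, gauss, ← Complex.exp_neg]
  have hpi : (Real.pi : ℂ) ≠ 0 := by exact_mod_cast Real.pi_ne_zero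
  push_cast
  rw [mul_assoc 2, ← Complex.exp_add,
    show ∀ x y : ℂ, (Real.pi : ℂ)⁻¹ * x * (Real.pi / (1 / 2) * y) = 2 * (x * y) by
      intro x y; field_simp, ← Complex.exp_add]
  congr 2
  simp only [map_mul, hs, conj_invSqrtTwo]
  linear_combination ((1 / 2 : ℂ) * γ * conj γ + 2 * (conj a - conj γ) * (b + γ)) *
    invSqrtTwo_mul_self

/-- The displacement operators are eigenvectors of `𝒞`. -/
lemma channelC_displacement (γ : ℂ) :
    channelC (displacement γ) = gauss γ • displacement γ := by
  rw [channelC, Function.comp_apply, amplifier_displacement,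
    isKrausMap_attenuator.isLinearMap.map_smul, attenuator_displacement, smul_smul, gauss]
  congr 1
  rw [show ∀ x y : ℂ, 1 / 2 * x * (2 * y) = x * y by intro x y; ring, ← Complex.exp_add]
  congr 1; ring

open InnerProductSpace in
-- The amplified operator |μ⟩⟨ν| has an integrable Gaussian P symbol, to which the action of the
-- attenuator on coherent projectors applies.
lemma channelC_rankOne_expVec (μ ν γ δ : ℂ) :
    ⟪expVec γ, channelC (rankOne ℂ (expVec μ) (expVec ν)) (expVec δ)⟫_ℂ =
      2 / 3 * Complex.exp ((conj γ * δ + conj ν * μ + 2 * (conj ν * δ + conj γ * μ)) / 3) := by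
  set s := invSqrtTwo with hs
  have hpi : (Real.pi : ℂ) ≠ 0 := by exact_mod_cast Real.pi_ne_zero
  -- The coefficients are found by matching with `amplifier_expVec`: since s² = 1/2, the integral
  -- produces a μν* in the exponent that the constant term removes.
  let p : ℂ → ℂ := fun α => Complex.exp (-((1 : ℝ) * (α * conj α)) + (2 * s * conj ν) * α +
    (2 * s * μ) * conj α + (-(μ * conj ν)))
  have hp : IsSymbol p := isSymbol_of_integrable (integrable_gaussian one_pos _ _ _)
  have hY : ∀ φ ψ, ⟪φ, amplifier 2 (rankOne ℂ (expVec μ) (expVec ν)) ψ⟫_ℂ =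
      (Real.pi : ℂ)⁻¹ * ∫ α, p α * cohForm α φ ψ := by
    refine (IsBddSesq.inner_apply _).ext_expVec (hp.isBddSesq.const_mul _) fun a b => ?_
    have h : ∀ α, p α * cohForm α (expVec a) (expVec b) =
        Complex.exp (-((2 : ℝ) * (α * conj α)) + (2 * s * conj ν + conj a) * α +
          (2 * s * μ + b) * conj α + (-(μ * conj ν))) := fun α => by
      simp only [p]
      rw [cohForm_expVec, ← Complex.exp_add]
      congr 1; push_cast; ring
    simp_rw [h]
    rw [integral_gaussian_add two_pos, amplifier_expVec, rankOne_apply, inner_smul_right,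
      inner_expVec, inner_expVec, mul_assoc, ← Complex.exp_add, ← Complex.exp_add]
    push_cast
    rw [show ∀ y : ℂ, (Real.pi : ℂ)⁻¹ * (Real.pi / 2 * y) = 1 / 2 * y by intro y; field_simp]
    congr 2
    simp only [map_mul, conj_invSqrtTwo, hs]
    linear_combination (-2 * μ * conj ν) * invSqrtTwo_mul_self
  rw [channelC, Function.comp_apply, attenuator_of_symbol hp hY]
  have h : ∀ α, p α * cohForm (α * s) (expVec γ) (expVec δ) =
      Complex.exp (-((3 / 2 : ℝ) * (α * conj α)) + s * (2 * conj ν + conj γ) * α +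
        s * (2 * μ + δ) * conj α + (-(μ * conj ν))) := fun α => by
    simp only [p]
    rw [cohForm_expVec, ← Complex.exp_add]
    congr 1
    simp only [map_mul, hs, conj_invSqrtTwo]
    push_cast
    linear_combination -(α * conj α) * invSqrtTwo_mul_self
  simp_rw [← hs, h]
  rw [integral_gaussian_add (by norm_num)]
  push_cast
  rw [show ∀ y : ℂ, (Real.pi : ℂ)⁻¹ * (Real.pi / (3 / 2) * y) = 2 / 3 * y by
    intro y; field_simp]
  congr 2
  linear_combination (2 / 3) * (2 * conj ν + conj γ) * (2 * μ + δ) * invSqrtTwo_mul_self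


/-! ### Rank-one operators -/

lemma norm_inner_displacement_le (β : ℂ) (φ ψ : Fock) :
    ‖⟪φ, displacement β ψ⟫_ℂ‖ ≤ ‖φ‖ * ‖ψ‖ :=
  (norm_inner_le_norm _ _).trans_eq (by rw [norm_displacement_apply])

lemma continuous_inner_displacement (φ ψ : Fock) :
    Continuous (fun β => ⟪φ, displacement β ψ⟫_ℂ) :=
  continuous_const.inner (continuous_displacement ψ)

/-- Weighting by an integrable function turns the matrix elements of `D(β)` into a bounded form. -/
lemma isBddSesq_integral_displacement {p : ℂ → ℂ} (hp : Integrable p) :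
    IsBddSesq (fun φ ψ => ∫ β, p β * ⟪φ, displacement β ψ⟫_ℂ) := by
  have h : ∀ φ ψ, ∀ α, ‖p α * ⟪φ, displacement α ψ⟫_ℂ‖ ≤ ‖p α‖ * (‖φ‖ * ‖ψ‖) := fun φ ψ α => by
    rw [norm_mul]; gcongr; exact norm_inner_displacement_le α φ ψ
  have hi : ∀ φ ψ, Integrable (fun β => p β * ⟪φ, displacement β ψ⟫_ℂ) := fun φ ψ =>
    (hp.norm.mul_const (‖φ‖ * ‖ψ‖)).mono'
      (hp.aestronglyMeasurable.mul (continuous_inner_displacement φ ψ).aestronglyMeasurable)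
      (Eventually.of_forall (h φ ψ))
  refine IsBddSesq.integral (fun x φ φ' ψ => ?_) (fun x a φ ψ => ?_) (fun x φ ψ ψ' => ?_)
    (fun x a φ ψ => ?_) hi (C := ∫ α, ‖p α‖) (fun φ ψ => ?_)
  · rw [inner_add_left, mul_add]
  · rw [inner_smul_left, mul_left_comm]
  · rw [map_add, inner_add_right, mul_add]
  · rw [map_smul, inner_smul_right, mul_left_comm]
  · rw [mul_assoc, ← integral_mul_const]
    exact integral_mono (hi φ ψ).norm (hp.norm.mul_const _) (h φ ψ)

lemma integrable_mul_inner_displacement {p : ℂ → ℂ} (hp : Integrable p) (φ ψ : Fock) :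
    Integrable (fun β => p β * ⟪φ, displacement β ψ⟫_ℂ) :=
  (hp.norm.mul_const (‖φ‖ * ‖ψ‖)).mono'
    (hp.aestronglyMeasurable.mul (continuous_inner_displacement φ ψ).aestronglyMeasurable)
    (Eventually.of_forall fun β => by
      rw [norm_mul]; gcongr; exact norm_inner_displacement_le β φ ψ)

open InnerProductSpace in
lemma isBddSesq_channelC_rankOne (φ ψ : Fock) :
    IsBddSesq (fun v u => ⟪φ, channelC (rankOne ℂ u v) ψ⟫_ℂ) where
  add_left v v' u := by
    rw [map_add, isLinearMap_channelC.map_add, add_apply, inner_add_right]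
  smul_left c v u := by
    rw [map_smulₛₗ, isLinearMap_channelC.map_smul, smul_apply, inner_smul_right]
  add_right v u u' := by
    rw [map_add, add_apply, isLinearMap_channelC.map_add, add_apply, inner_add_right]
  smul_right c v u := by
    rw [map_smul, smul_apply, isLinearMap_channelC.map_smul, smul_apply, inner_smul_right]
  bound := ⟨‖φ‖ * ‖ψ‖, fun v u => by
    refine (IsKraus.norm_inner_le _ _ _).trans ?_
    calc _ ≤ (‖v‖ * ‖u‖) * (‖φ‖ * ‖ψ‖) := by
          gcongr
          exact (norm_channelC_le _).trans_eq ((norm_rankOne u v).trans (mul_comm _ _))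
      _ = _ := by ring⟩

open InnerProductSpace in
/-- The Weyl expansion of `𝒞(|u⟩⟨v|)`. -/
lemma channelC_rankOne (u v φ ψ : Fock) :
    ⟪φ, channelC (rankOne ℂ u v) ψ⟫_ℂ = (Real.pi : ℂ)⁻¹ *
      ∫ β, gauss β * ⟪φ, displacement (-β) ψ⟫_ℂ * ⟪v, displacement β u⟫_ℂ := by
  have hpi : (Real.pi : ℂ) ≠ 0 := by exact_mod_cast Real.pi_ne_zero
  have hneg : ∀ φ ψ, Continuous (fun β => ⟪φ, displacement (-β) ψ⟫_ℂ) := fun φ ψ =>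
    (continuous_inner_displacement φ ψ).comp continuous_neg
  have hp : ∀ φ ψ, Integrable (fun β => gauss β * ⟪φ, displacement (-β) ψ⟫_ℂ) := fun φ ψ =>
    (integrable_gauss.norm.mul_const (‖φ‖ * ‖ψ‖)).mono'
      (continuous_gauss.mul (hneg φ ψ)).aestronglyMeasurable
      (Eventually.of_forall fun β => by
        rw [norm_mul]; gcongr; exact norm_inner_displacement_le _ φ ψ)
  refine (isBddSesq_channelC_rankOne φ ψ).ext_expVec
    ((isBddSesq_integral_displacement (hp φ ψ)).const_mul _) (fun ν μ => ?_) v u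
  have hq : ∀ v u, Integrable (fun β => gauss β * ⟪v, displacement β u⟫_ℂ) := fun v u =>
    integrable_mul_inner_displacement integrable_gauss v u
  have hq' : ∀ v u, Integrable (fun β => gauss β * ⟪v, displacement (-β) u⟫_ℂ) := hp
  -- The reflection β ↦ -β exchanges the two displacement operators. The integral thereby becomes a
  -- bounded form in (φ, ψ) as well, and these can also be specialised to exponential vectors.
  have e1 : ∀ φ ψ : Fock, ∫ β, gauss β * ⟪φ, displacement (-β) ψ⟫_ℂ *
      ⟪expVec ν, displacement β (expVec μ)⟫_ℂ =
      ∫ β, (gauss β * ⟪expVec ν, displacement (-β) (expVec μ)⟫_ℂ) *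
        ⟪φ, displacement β ψ⟫_ℂ := fun φ ψ => by
    rw [← integral_neg_eq_self]
    refine integral_congr_ae (Eventually.of_forall fun β => ?_)
    simp only [gauss_neg, neg_neg]
    ring
  rw [e1]
  refine (IsBddSesq.inner_apply (channelC (rankOne ℂ (expVec μ) (expVec ν)))).ext_expVec
    ((isBddSesq_integral_displacement (hp (expVec ν) (expVec μ))).const_mul _) (fun γ δ => ?_) φ ψ
  rw [← e1, channelC_rankOne_expVec]
  have h : ∀ β, gauss β * ⟪expVec γ, displacement (-β) (expVec δ)⟫_ℂ *
      ⟪expVec ν, displacement β (expVec μ)⟫_ℂ =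
      Complex.exp (-((3 / 2 : ℝ) * (β * conj β)) + (conj ν - conj γ) * β + (δ - μ) * conj β +
        (conj ν * μ + conj γ * δ)) := fun β => by
    rw [inner_expVec_displacement, inner_expVec_displacement, gauss, ← Complex.exp_add,
      ← Complex.exp_add]
    congr 1
    rw [map_neg]
    push_cast
    ring
  simp_rw [h]
  rw [integral_gaussian_add (by norm_num)]
  push_cast
  rw [show ∀ y : ℂ, (Real.pi : ℂ)⁻¹ * (Real.pi / (3 / 2) * y) = 2 / 3 * y by
    intro y; field_simp]
  congr 2
  ring

/-- The Husimi function of `|u⟩⟨v|` as a symplectic Fourier transform. -/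
lemma cohForm_eq_integral (α : ℂ) (u v : Fock) :
    cohForm α v u = (Real.pi : ℂ)⁻¹ *
      ∫ β, gauss β * symplecticKernel α β * ⟪v, displacement β u⟫_ℂ := by
  have hpi : (Real.pi : ℂ) ≠ 0 := by exact_mod_cast Real.pi_ne_zero
  have hp : Integrable (fun β => gauss β * symplecticKernel α β) :=
    integrable_gauss.norm.mono'
      (continuous_gauss.mul (continuous_symplecticKernel_right α)).aestronglyMeasurable
      (Eventually.of_forall fun β => by rw [norm_mul, norm_symplecticKernel, mul_one])
  have hc : IsBddSesq (cohForm α) := ⟨cohForm_add_left α, cohForm_smul_left α,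
    cohForm_add_right α, cohForm_smul_right α, 1, fun φ ψ => by
      rw [one_mul]; exact norm_cohForm_le α φ ψ⟩
  refine hc.ext_expVec ((isBddSesq_integral_displacement hp).const_mul _) (fun ν μ => ?_) v u
  have h : ∀ β, gauss β * symplecticKernel α β * ⟪expVec ν, displacement β (expVec μ)⟫_ℂ =
      Complex.exp (-((1 : ℝ) * (β * conj β)) + (conj ν - conj α) * β + (α - μ) * conj β +
        (conj ν * μ)) := fun β => by
    rw [inner_expVec_displacement, gauss, symplecticKernel, ← Complex.exp_add,
      ← Complex.exp_add]
    congr 1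
    push_cast
    ring
  simp_rw [h]
  rw [integral_gaussian_add one_pos, cohForm_expVec]
  push_cast
  rw [show ∀ y : ℂ, (Real.pi : ℂ)⁻¹ * (Real.pi / 1 * y) = y by intro y; field_simp]
  congr 1
  ring

/-! ### The symplectic Fourier transform of integrable functions -/

/-- The symplectic Fourier transform `β ↦ ∫ d²α f(α) e^{α β* - α* β}`. -/
def symplecticFourier (f : ℂ → ℂ) (β : ℂ) : ℂ := ∫ α, f α * symplecticKernel α β

lemma integrable_mul_symplecticKernel_right {h : ℂ → ℂ} (hh : Integrable h) (α : ℂ) :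
    Integrable (fun β => h β * symplecticKernel α β) :=
  hh.norm.mono' (hh.aestronglyMeasurable.mul
    (continuous_symplecticKernel_right α).aestronglyMeasurable)
    (Eventually.of_forall fun α => by rw [norm_mul, norm_symplecticKernel, mul_one])

lemma integrable_prod_symplecticKernel {f h : ℂ → ℂ} (hf : Integrable f) (hh : Integrable h) :
    Integrable (fun p : ℂ × ℂ => f p.1 * h p.2 * symplecticKernel p.1 p.2)
      ((volume : Measure ℂ).prod volume) := by
  have h1 := hf.mul_prod hh
  exact h1.norm.mono' (h1.aestronglyMeasurable.mul
    continuous_symplecticKernel.aestronglyMeasurable)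
    (Eventually.of_forall fun p => by rw [norm_mul, norm_symplecticKernel, mul_one])

/-- Fubini for the symplectic kernel. -/
lemma integral_symplecticKernel_swap {f h : ℂ → ℂ} (hf : Integrable f) (hh : Integrable h) :
    ∫ α, f α * ∫ β, h β * symplecticKernel α β = ∫ β, h β * ∫ α, f α * symplecticKernel α β := by
  have e1 : ∀ α, f α * ∫ β, h β * symplecticKernel α β =
      ∫ β, f α * h β * symplecticKernel α β := fun α => by
    rw [← integral_const_mul]; simp_rw [mul_assoc]
  have e2 : ∀ β, h β * ∫ α, f α * symplecticKernel α β =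
      ∫ α, f α * h β * symplecticKernel α β := fun β => by
    rw [← integral_const_mul]
    refine integral_congr_ae (Eventually.of_forall fun α => ?_)
    simp only []; ring
  simp_rw [e1, e2]
  exact integral_integral_swap (integrable_prod_symplecticKernel hf hh)

/-! ### Nuclear operators -/

lemma IsTraceClass.exists_isNuclear {X : Fock →L[ℂ] Fock} (h : IsTraceClass X) :
    ∃ u v : ℕ → Fock, IsNuclear X u v := by
  obtain ⟨u, v, hs, hX⟩ := h
  refine ⟨u, v, hs, fun φ ψ => ?_⟩
  have := (innerSL ℂ φ).hasSum (hX ψ)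
  simpa only [innerSL_apply_apply, inner_smul_right] using this

namespace IsNuclear

variable {ι : Type} {X : Fock →L[ℂ] Fock} {u v : ι → Fock}

lemma charFun_eq (h : IsNuclear X u v) (β : ℂ) :
    charFun X β = ∑' k, ⟪v k, displacement β (u k)⟫_ℂ :=
  (h.hasSum_diag (displacement β)).tsum_eq

lemma summable_weylDiag (h : IsNuclear X u v) (β : ℂ) : Summable (fun n => weylDiag X n β) :=
  (h.hasSum_diag (displacement β)).summable

lemma continuous_charFun (h : IsNuclear X u v) : Continuous (charFun X) := by
  rw [show charFun X = fun β => ∑' k, ⟪v k, displacement β (u k)⟫_ℂ from funext h.charFun_eq]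
  exact continuous_tsum (fun k => continuous_inner_displacement _ _) h.summable
    fun k β => (norm_inner_displacement_le _ _ _).trans_eq (mul_comm _ _)

lemma norm_charFun_le (h : IsNuclear X u v) (β : ℂ) : ‖charFun X β‖ ≤ ∑' k, ‖u k‖ * ‖v k‖ := by
  rw [h.charFun_eq]
  exact tsum_of_norm_bounded h.summable.hasSum
    fun k => (norm_inner_displacement_le _ _ _).trans_eq (mul_comm _ _)

/-- By self-duality Tr[𝒞(X) D(β)] = Tr[X 𝒞(D(β))], and D(β) is an eigenvector of 𝒞. -/
lemma charFun_channelC (h : IsNuclear X u v) (β : ℂ) :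
    charFun (QuantumOptics.channelC X) β = gauss β * charFun X β := by
  rw [h.channelC.charFun_eq, h.tsum_channelC, channelC_displacement, h.charFun_eq, ← tsum_mul_left]
  simp_rw [smul_apply, inner_smul_right]

lemma integrable_mul_charFun (h : IsNuclear X u v) {g : ℂ → ℂ} (hg : Integrable g) :
    Integrable (fun β => g β * charFun X β) :=
  hg.mul_bdd (c := ∑' k, ‖u k‖ * ‖v k‖) h.continuous_charFun.aestronglyMeasurable
    (Eventually.of_forall h.norm_charFun_le)

/-- Term-by-term integration of `Tr[X D(β)]`. -/
lemma hasSum_integral_charFun [Countable ι] (h : IsNuclear X u v) {g : ℂ → ℂ}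
    (hg : Integrable g) :
    HasSum (fun k => ∫ β, g β * ⟪v k, displacement β (u k)⟫_ℂ) (∫ β, g β * charFun X β) := by
  simp_rw [h.charFun_eq, ← tsum_mul_left]
  refine hasSum_integral_of_summable_integral_norm
    (fun k => integrable_mul_inner_displacement hg _ _)
    ((h.summable.mul_left (∫ β, ‖g β‖)).of_nonneg_of_le
      (fun k => integral_nonneg fun _ => norm_nonneg _) fun k => ?_)
  rw [← integral_mul_const]
  refine integral_mono (integrable_mul_inner_displacement hg _ _).norm (hg.norm.mul_const _)
    fun β => ?_
  simp only [norm_mul]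
  rw [mul_comm ‖u k‖]
  gcongr
  exact norm_inner_displacement_le _ _ _

/-- The Weyl expansion of `𝒞(X)`. -/
lemma inner_channelC [Countable ι] (h : IsNuclear X u v) (φ ψ : Fock) :
    ⟪φ, QuantumOptics.channelC X ψ⟫_ℂ = (Real.pi : ℂ)⁻¹ *
      ∫ β, gauss β * ⟪φ, displacement (-β) ψ⟫_ℂ * charFun X β := by
  have hp : Integrable (fun β => gauss β * ⟪φ, displacement (-β) ψ⟫_ℂ) :=
    (integrable_gauss.norm.mul_const (‖φ‖ * ‖ψ‖)).mono'
      (continuous_gauss.mul ((continuous_inner_displacement φ ψ).comp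
        continuous_neg)).aestronglyMeasurable
      (Eventually.of_forall fun β => by
        rw [norm_mul]; gcongr; exact norm_inner_displacement_le _ φ ψ)
  rw [← (h.hasSum_integral_charFun hp).tsum_eq, ← tsum_mul_left]
  -- Self-duality with the test operator |ψ⟩⟨φ| moves 𝒞 from `X` to a rank-one operator, whose Weyl
  -- expansion is known.
  have h1 := h.tsum_channelC (InnerProductSpace.rankOne ℂ ψ φ)
  simp_rw [InnerProductSpace.rankOne_apply, inner_smul_right] at h1
  rw [← (h.channelC.hasSum φ ψ).tsum_eq]
  refine (tsum_congr fun p => mul_comm _ _).trans (h1.trans (tsum_congr fun k => ?_))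
  rw [channelC_rankOne, ← integral_neg_eq_self]
  congr 1
  refine integral_congr_ae (Eventually.of_forall fun β => ?_)
  simp only [gauss_neg, neg_neg]
  ring

/-- The Husimi function as a symplectic Fourier transform. -/
lemma husimi_eq [Countable ι] (h : IsNuclear X u v) (α : ℂ) :
    husimi X α = (Real.pi : ℂ)⁻¹ * ∫ β, gauss β * symplecticKernel α β * charFun X β := by
  rw [← (h.hasSum_integral_charFun
    (integrable_mul_symplecticKernel_right integrable_gauss α)).tsum_eq, ← tsum_mul_left, husimi,
    ← (h.hasSum _ _).tsum_eq]
  refine tsum_congr fun k => ?_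
  rw [← cohForm_eq_integral, cohForm, mul_comm]

lemma isWignerFun_channelC [Countable ι] (h : IsNuclear X u v) :
    IsWignerFun (QuantumOptics.channelC X) (husimi X) := by
  refine ⟨h.channelC.summable_weylDiag, ?_, fun α => ?_⟩
  · simp_rw [show charFun (QuantumOptics.channelC X) = fun β => gauss β * charFun X β from
      funext h.charFun_channelC]
    exact h.integrable_mul_charFun integrable_gauss
  · rw [h.husimi_eq]
    simp_rw [h.charFun_channelC, mul_right_comm]

/-- Fubini places the α-integral inside; there ∫ d²α e^{αβ* - α*β}|α⟩⟨α| = π e^{-|β|²/2} D(-β),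
which reproduces the Weyl expansion of 𝒞(X). Integrability of χ makes `w` continuous and bounded,
hence a symbol. -/
lemma isGlauberPFun_channelC [Countable ι] (h : IsNuclear X u v) {w : ℂ → ℂ}
    (hw : IsWignerFun X w) : IsGlauberPFun (QuantumOptics.channelC X) w := by
  obtain ⟨-, hχ, hw⟩ := hw
  obtain rfl : w = fun α => (Real.pi : ℂ)⁻¹ * ∫ β, charFun X β * symplecticKernel α β :=
    funext hw
  have hpi : (Real.pi : ℂ) ≠ 0 := by exact_mod_cast Real.pi_ne_zero
  intro φ ψ
  refine ⟨?_, ?_⟩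
  · have hc : Continuous (fun α => (Real.pi : ℂ)⁻¹ * ∫ β, charFun X β * symplecticKernel α β) := by
      refine continuous_const.mul (continuous_of_dominated (bound := fun β => ‖charFun X β‖)
        (fun α => (integrable_mul_symplecticKernel_right hχ α).aestronglyMeasurable)
        (fun α => Eventually.of_forall fun β => ?_) hχ.norm (Eventually.of_forall fun β => ?_))
      · rw [norm_mul, norm_symplecticKernel, mul_one]
      · exact continuous_const.mul (continuous_symplecticKernel_left β)
    refine (isSymbol_of_bounded hc.aestronglyMeasurable
      (B := ‖(Real.pi : ℂ)⁻¹‖ * ∫ β, ‖charFun X β‖) fun α => ?_).1 φ ψ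
    rw [norm_mul]
    gcongr
    refine (norm_integral_le_integral_norm _).trans_eq ?_
    simp_rw [norm_mul, norm_symplecticKernel, mul_one]
  · have h1 := integral_symplecticKernel_swap (integrable_cohForm φ ψ) hχ
    have h2 : ∀ α, (Real.pi : ℂ)⁻¹ * (∫ β, charFun X β * symplecticKernel α β) *
        (⟪φ, coherent α⟫_ℂ * ⟪coherent α, ψ⟫_ℂ) =
        (Real.pi : ℂ)⁻¹ * (cohForm α φ ψ * ∫ β, charFun X β * symplecticKernel α β) := fun α => by
      rw [cohForm]; ring
    simp_rw [h2]
    rw [integral_const_mul, h1, h.inner_channelC]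
    congr 1
    rw [← integral_const_mul (Real.pi : ℂ)⁻¹]
    refine integral_congr_ae (Eventually.of_forall fun β => ?_)
    have h3 := integral_symplecticKernel_mul_cohForm β φ ψ
    simp_rw [mul_comm (symplecticKernel _ β)] at h3
    simp only [h3]
    field_simp

/-- `∑ₙ |⟨n|X S|n⟩| ≤ ‖S‖ ‖X‖₁`, in terms of a nuclear decomposition. -/
lemma sum_norm_diag_le (h : IsNuclear X u v) (S : Fock →L[ℂ] Fock) (s : Finset ℕ) :
    ∑ n ∈ s, ‖⟪(ket n : Fock), X (S (ket n))⟫_ℂ‖ ≤ ‖S‖ * ∑' k, ‖u k‖ * ‖v k‖ := by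
  have hF : ∀ n k, ‖⟪v k, S (ket n)⟫_ℂ * ⟪(ket n : Fock), u k⟫_ℂ‖ =
      ‖⟪S.adjoint (v k), (ket n : Fock)⟫_ℂ * ⟪(ket n : Fock), u k⟫_ℂ‖ := fun n k => by
    rw [ContinuousLinearMap.adjoint_inner_left]
  have hb : ∀ n, Summable (fun k => ‖⟪v k, S (ket n)⟫_ℂ * ⟪(ket n : Fock), u k⟫_ℂ‖) :=
    fun n => (h.hasSum (ket n) (S (ket n))).summable.norm
  calc ∑ n ∈ s, ‖⟪(ket n : Fock), X (S (ket n))⟫_ℂ‖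
      ≤ ∑ n ∈ s, ∑' k, ‖⟪v k, S (ket n)⟫_ℂ * ⟪(ket n : Fock), u k⟫_ℂ‖ := by
        refine Finset.sum_le_sum fun n _ => ?_
        rw [← (h.hasSum (ket n) (S (ket n))).tsum_eq]
        exact norm_tsum_le_tsum_norm (hb n)
    _ = ∑' k, ∑ n ∈ s, ‖⟪v k, S (ket n)⟫_ℂ * ⟪(ket n : Fock), u k⟫_ℂ‖ :=
        (Summable.tsum_finsetSum fun n _ => hb n).symm
    _ ≤ ∑' k, ‖S‖ * (‖u k‖ * ‖v k‖) := by
        refine (summable_sum fun n _ => hb n).tsum_le_tsum (fun k => ?_) (h.summable.mul_left _)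
        simp_rw [hF]
        obtain ⟨h1, h2⟩ := summable_norm_inner_mul_inner (S.adjoint (v k)) (u k)
        refine (h1.sum_le_tsum s fun _ _ => norm_nonneg _).trans (h2.trans ?_)
        calc ‖S.adjoint (v k)‖ * ‖u k‖ ≤ (‖S‖ * ‖v k‖) * ‖u k‖ := by
              gcongr
              exact (S.adjoint.le_opNorm _).trans_eq (by rw [LinearIsometryEquiv.norm_map])
          _ = _ := by ring
    _ = _ := tsum_mul_left

lemma continuous_weylDiag (X : Fock →L[ℂ] Fock) (n : ℕ) : Continuous (weylDiag X n) :=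
  continuous_const.inner (X.continuous.comp (continuous_displacement _))

lemma integrable_weylDiag_mul (X : Fock →L[ℂ] Fock) (n : ℕ) {g : ℂ → ℂ} (hg : Integrable g) :
    Integrable (fun β => weylDiag X n β * g β) :=
  hg.bdd_mul (c := ‖X‖) (continuous_weylDiag X n).aestronglyMeasurable
    (Eventually.of_forall fun β => (IsKraus.norm_inner_le X _ _).trans_eq (by
      rw [norm_displacement_apply, norm_ket, mul_one, mul_one]))

/-- Reconciles the distributional definition, which integrates before summing over n, with the
trace. The sums of the diagonal moduli are bounded uniformly in β because D(β) is unitary. -/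
lemma hasSum_integral_weylDiag (h : IsNuclear X u v) {g : ℂ → ℂ} (hg : Integrable g) :
    HasSum (fun n => (Real.pi : ℂ)⁻¹ * ∫ β, weylDiag X n β * g β)
      ((Real.pi : ℂ)⁻¹ * ∫ β, charFun X β * g β) := by
  refine HasSum.mul_left _ ?_
  have h1 : ∀ β, charFun X β * g β = ∑' n, weylDiag X n β * g β := fun β => by
    rw [tsum_mul_right]; rfl
  simp_rw [h1]
  refine hasSum_integral_of_summable_integral_norm (fun n => integrable_weylDiag_mul X n hg)
    (summable_of_sum_le (c := (∑' k, ‖u k‖ * ‖v k‖) * ∫ β, ‖g β‖)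
      (fun n => integral_nonneg fun _ => norm_nonneg _) fun s => ?_)
  rw [← integral_finsetSum _ fun n _ => (integrable_weylDiag_mul X n hg).norm,
    ← integral_const_mul]
  refine integral_mono (integrable_finsetSum _ fun n _ => (integrable_weylDiag_mul X n hg).norm)
    (hg.norm.const_mul _) fun β => ?_
  simp only [norm_mul, ← Finset.sum_mul]
  gcongr
  refine (h.sum_norm_diag_le (displacement β) s).trans ?_
  exact mul_le_of_le_one_left (tsum_nonneg fun _ => by positivity) (norm_displacement_le β)

end IsNuclear

/-! ### Approximation of bounded operators by finite-rank operators -/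

/-- The projection onto the span of `|0⟩, …, |N - 1⟩`. -/
def cutoff (N : ℕ) : Fock →L[ℂ] Fock :=
  ∑ j ∈ Finset.range N, InnerProductSpace.rankOne ℂ (ket j) (ket j)

lemma cutoff_apply (N : ℕ) (ψ : Fock) :
    cutoff N ψ = ∑ j ∈ Finset.range N, (ψ j) • (ket j : Fock) := by
  rw [cutoff, sum_apply]
  simp_rw [InnerProductSpace.rankOne_apply, inner_ket_left]

lemma tendsto_cutoff (ψ : Fock) : Tendsto (fun N => cutoff N ψ) atTop (𝓝 ψ) := by
  simp_rw [cutoff_apply]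
  exact (hasSum_ket ψ).tendsto_sum_nat

lemma norm_cutoff_le (N : ℕ) : ‖cutoff N‖ ≤ 1 := by
  refine ContinuousLinearMap.opNorm_le_bound _ zero_le_one fun ψ => ?_
  rw [one_mul]
  refine (sq_le_sq₀ (norm_nonneg _) (norm_nonneg _)).1 ?_
  refine hasSum_le (fun i => ?_) (norm_sq_eq_hasSum (cutoff N ψ)) (norm_sq_eq_hasSum ψ)
  have h : cutoff N ψ i = if i < N then ψ i else 0 := by
    rw [← inner_ket_left, cutoff_apply, inner_sum]
    simp_rw [inner_smul_right, inner_ket_left, ket_apply]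
    simp
  rw [h]
  split_ifs <;> simp

lemma isNuclear_comp_cutoff (X : Fock →L[ℂ] Fock) (N : ℕ) :
    IsNuclear (X ∘L cutoff N) (fun j : Fin N => X (ket j)) (fun j : Fin N => (ket j : Fock)) where
  summable := Summable.of_finite
  hasSum φ ψ := by
    have h : ⟪φ, (X ∘L cutoff N) ψ⟫_ℂ = ∑ j : Fin N, ⟪(ket (j : ℕ) : Fock), ψ⟫_ℂ *
        ⟪φ, X (ket (j : ℕ))⟫_ℂ := by
      rw [ContinuousLinearMap.comp_apply, cutoff_apply, map_sum, inner_sum, Finset.sum_range]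
      simp_rw [map_smul, inner_smul_right, inner_ket_left]
    rw [h]
    exact hasSum_fintype _

lemma weakTendsto_comp_cutoff (X : Fock →L[ℂ] Fock) :
    WeakTendsto (fun N => X ∘L cutoff N) X := by
  refine ⟨⟨‖X‖, fun N => ?_⟩, fun φ ψ => ?_⟩
  · exact (ContinuousLinearMap.opNorm_comp_le _ _).trans
      (mul_le_of_le_one_right (norm_nonneg _) (norm_cutoff_le N))
  · exact tendsto_const_nhds.inner ((X.continuous.tendsto ψ).comp (tendsto_cutoff ψ))

/-! ### The Husimi function of a bounded operator -/

lemma continuous_husimi (X : Fock →L[ℂ] Fock) : Continuous (husimi X) :=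
  continuous_coherent.inner (X.continuous.comp continuous_coherent)

lemma norm_husimi_le (X : Fock →L[ℂ] Fock) (α : ℂ) : ‖husimi X α‖ ≤ ‖X‖ :=
  (IsKraus.norm_inner_le X _ _).trans_eq (by rw [norm_coherent, mul_one, mul_one])

/-- For the cut-off operators Q is the Wigner function of 𝒞(X), hence a P function of 𝒞²(X). Both
sides pass to the limit, the Husimi functions being bounded by ‖X‖. -/
lemma isGlauberPFun_channelC_channelC (X : Fock →L[ℂ] Fock) :
    IsGlauberPFun (channelC (channelC X)) (husimi X) := by
  intro φ ψ
  refine ⟨(isSymbol_of_bounded (continuous_husimi X).aestronglyMeasurable (norm_husimi_le X)).1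
    φ ψ, ?_⟩
  have hX := weakTendsto_comp_cutoff X
  have h1 := hX.channelC.channelC.2 φ ψ
  have h2 : Tendsto (fun N => (Real.pi : ℂ)⁻¹ * ∫ α : ℂ, husimi (X ∘L cutoff N) α *
      cohForm α φ ψ) atTop (𝓝 ((Real.pi : ℂ)⁻¹ * ∫ α : ℂ, husimi X α * cohForm α φ ψ)) := by
    refine Tendsto.const_mul _ (tendsto_integral_of_dominated_convergence
      (fun α => ‖X‖ * ‖cohForm α φ ψ‖) (fun N => ?_) ((integrable_cohForm φ ψ).norm.const_mul _)
      (fun N => Eventually.of_forall fun α => ?_) (Eventually.of_forall fun α => ?_))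
    · exact ((continuous_husimi _).mul (continuous_cohForm φ ψ)).aestronglyMeasurable
    · rw [norm_mul]
      gcongr
      exact (norm_husimi_le _ α).trans ((ContinuousLinearMap.opNorm_comp_le _ _).trans
        (mul_le_of_le_one_right (norm_nonneg _) (norm_cutoff_le N)))
    · exact (hX.2 _ _).mul_const _
  refine tendsto_nhds_unique (h1.congr fun N => ?_) h2
  have h := isNuclear_comp_cutoff X N
  exact (h.channelC.isGlauberPFun_channelC h.isWignerFun_channelC φ ψ).2

/-! ### The symplectic Fourier transform of Schwartz functions -/

/-- Multiplication by a nonzero complex number. -/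
def mulCLE (c : ℂ) (hc : c ≠ 0) : ℂ ≃L[ℝ] ℂ :=
  (ContinuousLinearEquiv.unitsEquivAut ℂ (Units.mk0 c hc)).restrictScalars ℝ

lemma mulCLE_apply (c : ℂ) (hc : c ≠ 0) (z : ℂ) : mulCLE c hc z = z * c := rfl

/-- With this factor e^{-2πi Re(α* β')}, where β' = -iβ/π, is the symplectic kernel, so the
transform is the usual Fourier transform after a real-linear change of variable. -/
lemma sft_const_ne_zero : -Complex.I / (Real.pi : ℂ) ≠ 0 :=
  div_ne_zero (neg_ne_zero.2 Complex.I_ne_zero) (by exact_mod_cast Real.pi_ne_zero)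

/-- The symplectic Fourier transform on the Schwartz space. -/
def sft : 𝓢(ℂ, ℂ) →L[ℂ] 𝓢(ℂ, ℂ) :=
  (SchwartzMap.compCLMOfContinuousLinearEquiv ℂ (mulCLE _ sft_const_ne_zero)) ∘L
    (SchwartzMap.fourierTransformCLM ℂ)

lemma sft_apply (f : 𝓢(ℂ, ℂ)) (β : ℂ) : sft f β = symplecticFourier f β := by
  change (FourierTransform.fourier f) (mulCLE _ sft_const_ne_zero β) = _
  rw [SchwartzMap.fourier_coe, Real.fourier_eq', mulCLE_apply, symplecticFourier]
  refine integral_congr_ae (Eventually.of_forall fun α => ?_)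
  simp only [smul_eq_mul]
  rw [mul_comm, symplecticKernel]
  congr 2
  have hpi : (Real.pi : ℂ) ≠ 0 := by exact_mod_cast Real.pi_ne_zero
  rw [Complex.inner, show β * (-Complex.I / Real.pi) * conj α =
    (-Complex.I * (conj α * β)) / Real.pi by ring, Complex.div_ofReal_re]
  push_cast
  rw [show ∀ x : ℂ, -2 * (Real.pi : ℂ) * (x / Real.pi) * Complex.I = -2 * x * Complex.I by
    intro x; field_simp]
  apply Complex.ext
  · simp [mul_comm]
  · simp
    ring

lemma sft_surjective : Function.Surjective sft := by
  intro f
  refine ⟨FourierTransformInv.fourierInv (SchwartzMap.compCLMOfContinuousLinearEquiv ℂ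
    (mulCLE _ sft_const_ne_zero).symm f), ?_⟩
  ext β
  change (FourierTransform.fourier (FourierTransformInv.fourierInv
    (SchwartzMap.compCLMOfContinuousLinearEquiv ℂ
      (mulCLE _ sft_const_ne_zero).symm f)) : 𝓢(ℂ, ℂ)) _ = _
  rw [FourierTransform.fourier_fourierInv_eq]
  simp

/-! ### Smeared displacement operators -/

lemma displacement_add_ofReal_mul (β η : ℂ) (t : ℝ) (ψ : Fock) :
    displacement (β + t • η) ψ =
      Complex.exp (t * ((conj β * η - β * conj η) / 2)) •
        displacement β (displacement (t * η) ψ) := by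
  have h := DFunLike.congr_fun (displacement_mul β (t * η)) ψ
  rw [mul_apply_eq_comp, smul_apply] at h
  rw [h, smul_smul, ← Complex.exp_add, Complex.real_smul, map_mul, Complex.conj_ofReal]
  rw [show (t : ℂ) * ((conj β * η - β * conj η) / 2) +
    (β * (t * conj η) - conj β * (t * η)) / 2 = 0 by ring, Complex.exp_zero, one_smul]

/-- The Weyl relation factors D(β + tη) as a phase times D(β) D(tη). The phase gives the term linear
in β, and the generator applied to |n⟩ gives the neighbouring number states. -/
lemma hasLineDerivAt_displacement (φ : Fock) (n : ℕ) (β η : ℂ) :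
    HasLineDerivAt ℝ (fun β => ⟪φ, displacement β (ket n)⟫_ℂ)
      ((conj β * η - β * conj η) / 2 * ⟪φ, displacement β (ket n)⟫_ℂ +
        η * ((√((n : ℝ) + 1) : ℝ) : ℂ) * ⟪φ, displacement β (ket (n + 1))⟫_ℂ -
        conj η * ((√(n : ℝ) : ℝ) : ℂ) * ⟪φ, displacement β (ket (n - 1))⟫_ℂ) β η := by
  have h0 : (ket n : Fock) = finVec (Finsupp.single n 1) := by rw [finVec_single, one_smul]
  have h1 := hasDerivAt_displacement η (Finsupp.single n 1)
  rw [← h0] at h1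
  have h2 : (finVec (displacementGen η (Finsupp.single n 1)) : Fock) =
      (η * ((√((n : ℝ) + 1) : ℝ) : ℂ)) • ket (n + 1) -
        (conj η * ((√(n : ℝ) : ℝ) : ℂ)) • ket (n - 1) := by
    rw [displacementGen, LinearMap.sub_apply, LinearMap.smul_apply, LinearMap.smul_apply,
      annihilate_single, create_single, map_sub, map_smul, map_smul, finVec_single, finVec_single,
      smul_smul, smul_smul]
  rw [h2] at h1
  set c := (conj β * η - β * conj η) / 2 with hc
  have h3 : HasDerivAt (fun t : ℝ => Complex.exp (t * c)) c 0 := by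
    have := ((hasDerivAt_id (0 : ℂ)).mul_const c).cexp.comp_ofReal (z := 0)
    simpa using this
  have h4 := (((innerSL ℂ φ).restrictScalars ℝ).hasFDerivAt.comp_hasDerivAt (0 : ℝ)
    (((displacement β).restrictScalars ℝ).hasFDerivAt.comp_hasDerivAt (0 : ℝ) h1))
  have h5 := h3.mul h4
  refine HasDerivAt.congr_deriv (h5.congr_of_eventuallyEq (Eventually.of_forall fun t => ?_)) ?_
  · simp only [Pi.mul_apply, Function.comp_apply, ContinuousLinearMap.coe_restrictScalars',
      innerSL_apply_apply]
    rw [displacement_add_ofReal_mul, inner_smul_right]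
  · simp only [Function.comp_apply, ContinuousLinearMap.coe_restrictScalars', innerSL_apply_apply,
      map_sub, map_smul, Complex.ofReal_zero, zero_mul,
      Complex.exp_zero, displacement_zero, one_mul, one_apply_eq_self]
    ring

/-- `∫ d²β h(β) ⟨φ|D(β)|n⟩`. -/
def smear (φ : Fock) (n : ℕ) (h : 𝓢(ℂ, ℂ)) : ℂ := ∫ β, h β * ⟪φ, displacement β (ket n)⟫_ℂ

lemma integrable_smear (φ : Fock) (n : ℕ) (h : 𝓢(ℂ, ℂ)) :
    Integrable (fun β => h β * ⟪φ, displacement β (ket n)⟫_ℂ) :=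
  integrable_mul_inner_displacement h.integrable _ _

lemma smear_add (φ : Fock) (n : ℕ) (h k : 𝓢(ℂ, ℂ)) :
    smear φ n (h + k) = smear φ n h + smear φ n k := by
  rw [smear, smear, smear, ← integral_add (integrable_smear φ n h) (integrable_smear φ n k)]
  refine integral_congr_ae (Eventually.of_forall fun β => ?_)
  simp only [add_apply]
  ring

lemma smear_smul (φ : Fock) (n : ℕ) (c : ℂ) (h : 𝓢(ℂ, ℂ)) :
    smear φ n (c • h) = c * smear φ n h := by
  rw [smear, smear, ← integral_const_mul]
  refine integral_congr_ae (Eventually.of_forall fun β => ?_)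
  simp only [smul_apply, smul_eq_mul]
  ring

lemma norm_smear_le (φ : Fock) (n : ℕ) (h : 𝓢(ℂ, ℂ)) :
    ‖smear φ n h‖ ≤ ‖φ‖ * ∫ β, ‖h β‖ := by
  rw [smear, mul_comm, ← integral_mul_const]
  refine (norm_integral_le_integral_norm _).trans
    (integral_mono (integrable_smear φ n h).norm (h.integrable.norm.mul_const _) fun β => ?_)
  simp only [norm_mul]
  gcongr
  simpa [norm_ket] using norm_inner_displacement_le β φ (ket n)

lemma hasTemperateGrowth_id : Function.HasTemperateGrowth (fun β : ℂ => β) :=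
  Function.HasTemperateGrowth.id'

lemma hasTemperateGrowth_conj : Function.HasTemperateGrowth (fun β : ℂ => conj β) :=
  (Complex.conjCLE : ℂ ≃L[ℝ] ℂ).hasTemperateGrowth

/-- Multiplication by `β` on the Schwartz space. -/
def mulId : 𝓢(ℂ, ℂ) →L[ℂ] 𝓢(ℂ, ℂ) := SchwartzMap.smulLeftCLM ℂ (fun β : ℂ => β)

/-- Multiplication by `β*` on the Schwartz space. -/
def mulConj : 𝓢(ℂ, ℂ) →L[ℂ] 𝓢(ℂ, ℂ) := SchwartzMap.smulLeftCLM ℂ (fun β : ℂ => conj β)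

lemma mulId_apply (h : 𝓢(ℂ, ℂ)) (β : ℂ) : mulId h β = β * h β :=
  SchwartzMap.smulLeftCLM_apply_apply hasTemperateGrowth_id h β

lemma mulConj_apply (h : 𝓢(ℂ, ℂ)) (β : ℂ) : mulConj h β = conj β * h β :=
  SchwartzMap.smulLeftCLM_apply_apply hasTemperateGrowth_conj h β

open LineDeriv in
/-- Integration by parts against `⟨φ|D(β)|n⟩`. -/
lemma smear_lineDeriv (φ : Fock) (n : ℕ) (η : ℂ) (h : 𝓢(ℂ, ℂ)) :
    -smear φ n (lineDerivOpCLM ℂ 𝓢(ℂ, ℂ) η h) =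
      η / 2 * smear φ n (mulConj h) - conj η / 2 * smear φ n (mulId h) +
        η * ((√((n : ℝ) + 1) : ℝ) : ℂ) * smear φ (n + 1) h -
        conj η * ((√(n : ℝ) : ℝ) : ℂ) * smear φ (n - 1) h := by
  have e : ∀ β, h β * ((conj β * η - β * conj η) / 2 * ⟪φ, displacement β (ket n)⟫_ℂ +
        η * ((√((n : ℝ) + 1) : ℝ) : ℂ) * ⟪φ, displacement β (ket (n + 1))⟫_ℂ -
        conj η * ((√(n : ℝ) : ℝ) : ℂ) * ⟪φ, displacement β (ket (n - 1))⟫_ℂ) =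
      η / 2 * (mulConj h β * ⟪φ, displacement β (ket n)⟫_ℂ) -
        conj η / 2 * (mulId h β * ⟪φ, displacement β (ket n)⟫_ℂ) +
        η * ((√((n : ℝ) + 1) : ℝ) : ℂ) * (h β * ⟪φ, displacement β (ket (n + 1))⟫_ℂ) -
        conj η * ((√(n : ℝ) : ℝ) : ℂ) * (h β * ⟪φ, displacement β (ket (n - 1))⟫_ℂ) := fun β => by
    rw [mulConj_apply, mulId_apply]; ring
  have i1 := (integrable_smear φ n (mulConj h)).const_mul (η / 2)
  have i2 := (integrable_smear φ n (mulId h)).const_mul (conj η / 2)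
  have i3 := (integrable_smear φ (n + 1) h).const_mul (η * ((√((n : ℝ) + 1) : ℝ) : ℂ))
  have i4 := (integrable_smear φ (n - 1) h).const_mul (conj η * ((√(n : ℝ) : ℝ) : ℂ))
  have i12 : Integrable (fun β => η / 2 * (mulConj h β * ⟪φ, displacement β (ket n)⟫_ℂ) -
      conj η / 2 * (mulId h β * ⟪φ, displacement β (ket n)⟫_ℂ)) := i1.sub i2
  have i123 : Integrable (fun β => η / 2 * (mulConj h β * ⟪φ, displacement β (ket n)⟫_ℂ) -
      conj η / 2 * (mulId h β * ⟪φ, displacement β (ket n)⟫_ℂ) +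
      η * ((√((n : ℝ) + 1) : ℝ) : ℂ) * (h β * ⟪φ, displacement β (ket (n + 1))⟫_ℂ)) := i12.add i3
  have key := integral_bilinear_hasLineDerivAt_right_eq_neg_left_of_integrable
    (μ := (volume : Measure ℂ)) (f := h) (f' := lineDerivOpCLM ℂ 𝓢(ℂ, ℂ) η h)
    (g := fun β => ⟪φ, displacement β (ket n)⟫_ℂ) (v := η) (B := ContinuousLinearMap.mul ℝ ℂ)
    (g' := fun β => ((conj β * η - β * conj η) / 2 * ⟪φ, displacement β (ket n)⟫_ℂ +
        η * ((√((n : ℝ) + 1) : ℝ) : ℂ) * ⟪φ, displacement β (ket (n + 1))⟫_ℂ -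
        conj η * ((√(n : ℝ) : ℝ) : ℂ) * ⟪φ, displacement β (ket (n - 1))⟫_ℂ))
    (integrable_smear φ n _) ?_ (integrable_smear φ n h) (fun β _ => ?_)
    (fun β _ => hasLineDerivAt_displacement φ n β η)
  · simp only [ContinuousLinearMap.mul_apply', e] at key
    rw [integral_sub i123 i4, integral_add i12 i3, integral_sub i1 i2,
      integral_const_mul, integral_const_mul, integral_const_mul, integral_const_mul] at key
    exact key.symm
  · simp only [ContinuousLinearMap.mul_apply', e]
    exact i123.sub i4
  · rw [lineDerivOpCLM_apply, SchwartzMap.lineDerivOp_apply]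
    exact (h.differentiableAt.lineDifferentiableAt).hasLineDerivAt

open LineDeriv in
/-- The transpose of right multiplication of `D(β)` by `a†`. -/
def smearCreate : 𝓢(ℂ, ℂ) →L[ℂ] 𝓢(ℂ, ℂ) :=
  (-(1 / 2 : ℂ)) • (lineDerivOpCLM ℂ 𝓢(ℂ, ℂ) (1 : ℂ)) +
    (Complex.I / 2) • (lineDerivOpCLM ℂ 𝓢(ℂ, ℂ) Complex.I) + (-(1 / 2 : ℂ)) • mulConj

open LineDeriv in
/-- The transpose of right multiplication of `D(β)` by `a`. -/
def smearAnnihilate : 𝓢(ℂ, ℂ) →L[ℂ] 𝓢(ℂ, ℂ) :=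
  (1 / 2 : ℂ) • (lineDerivOpCLM ℂ 𝓢(ℂ, ℂ) (1 : ℂ)) +
    (Complex.I / 2) • (lineDerivOpCLM ℂ 𝓢(ℂ, ℂ) Complex.I) + (-(1 / 2 : ℂ)) • mulId

/-- The integrations by parts in the directions 1 and i are two linear equations for the terms with
n + 1 and n - 1. The combination used here eliminates n - 1; the one in `smear_smearAnnihilate`
eliminates n + 1. -/
lemma smear_smearCreate (φ : Fock) (n : ℕ) (h : 𝓢(ℂ, ℂ)) :
    smear φ n (smearCreate h) = ((√((n : ℝ) + 1) : ℝ) : ℂ) * smear φ (n + 1) h := by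
  have h1 := smear_lineDeriv φ n 1 h
  have h2 := smear_lineDeriv φ n Complex.I h
  rw [Complex.conj_I] at h2
  rw [map_one] at h1
  simp only [smearCreate, add_apply, smul_apply, smear_add, smear_smul]
  linear_combination (1 / 2 : ℂ) * h1 - (Complex.I / 2) * h2 -
    (1 / 2 : ℂ) * (1 / 2 * smear φ n (mulConj h) + 1 / 2 * smear φ n (mulId h) +
      ((√((n : ℝ) + 1) : ℝ) : ℂ) * smear φ (n + 1) h +
      ((√(n : ℝ) : ℝ) : ℂ) * smear φ (n - 1) h) * Complex.I_sq

lemma smear_smearAnnihilate (φ : Fock) (n : ℕ) (h : 𝓢(ℂ, ℂ)) :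
    smear φ n (smearAnnihilate h) = ((√(n : ℝ) : ℝ) : ℂ) * smear φ (n - 1) h := by
  have h1 := smear_lineDeriv φ n 1 h
  have h2 := smear_lineDeriv φ n Complex.I h
  rw [Complex.conj_I] at h2
  rw [map_one] at h1
  simp only [smearAnnihilate, add_apply, smul_apply, smear_add, smear_smul]
  linear_combination (-1 / 2 : ℂ) * h1 - (Complex.I / 2) * h2 -
    (1 / 2 : ℂ) * (1 / 2 * smear φ n (mulConj h) + 1 / 2 * smear φ n (mulId h) +
      ((√((n : ℝ) + 1) : ℝ) : ℂ) * smear φ (n + 1) h +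
      ((√(n : ℝ) : ℝ) : ℂ) * smear φ (n - 1) h) * Complex.I_sq

/-- The transpose of right multiplication of `D(β)` by `a a†`. -/
def smearNumber : 𝓢(ℂ, ℂ) →L[ℂ] 𝓢(ℂ, ℂ) := smearCreate ∘L smearAnnihilate

lemma smear_smearNumber (φ : Fock) (n : ℕ) (h : 𝓢(ℂ, ℂ)) :
    smear φ n (smearNumber h) = ((n : ℂ) + 1) * smear φ n h := by
  rw [smearNumber, ContinuousLinearMap.comp_apply, smear_smearCreate, smear_smearAnnihilate,
    Nat.add_sub_cancel, ← mul_assoc, Nat.cast_succ, ← Complex.ofReal_mul,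
    Real.mul_self_sqrt (by positivity)]
  push_cast
  rfl

lemma smear_smearNumber_pow (φ : Fock) (n k : ℕ) (h : 𝓢(ℂ, ℂ)) :
    smear φ n ((smearNumber ^ k) h) = ((n : ℂ) + 1) ^ k * smear φ n h := by
  induction k with
  | zero => simp
  | succ k ih => rw [pow_succ', mul_apply_eq_comp, smear_smearNumber, ih, pow_succ']; ring

/-- The eigenvalue n + 1 of a a† on |n⟩ can be exchanged for a differential operator on `h`, which
gives decay in n of any order, uniformly for bounded `φ`. -/
lemma norm_smear_le_pow (φ : Fock) (n k : ℕ) (h : 𝓢(ℂ, ℂ)) :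
    ((n : ℝ) + 1) ^ k * ‖smear φ n h‖ ≤ ‖φ‖ * ∫ β, ‖(smearNumber ^ k) h β‖ := by
  have h1 := norm_smear_le φ n ((smearNumber ^ k) h)
  rw [smear_smearNumber_pow, norm_mul, norm_pow] at h1
  have h2 : ‖(n : ℂ) + 1‖ = (n : ℝ) + 1 := by
    rw [← Nat.cast_succ, Complex.norm_natCast]; push_cast; rfl
  rwa [h2] at h1

/-! ### Tempered distributions dominated by an `L¹` norm -/

lemma continuous_integral_norm (A : 𝓢(ℂ, ℂ) →L[ℂ] 𝓢(ℂ, ℂ)) :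
    Continuous (fun f : 𝓢(ℂ, ℂ) => ∫ β, ‖A f β‖) := by
  have h : ∀ f : 𝓢(ℂ, ℂ), ∫ β, ‖A f β‖ = ‖(A f).toLp 1 (volume : Measure ℂ)‖ := fun f => by
    rw [SchwartzMap.norm_toLp_one]
  simp_rw [h]
  exact (SchwartzMap.continuous_toLp.comp A.continuous).norm

lemma exists_temperedDistribution {L : 𝓢(ℂ, ℂ) → ℂ} (hadd : ∀ f g, L (f + g) = L f + L g)
    (hsmul : ∀ (c : ℂ) f, L (c • f) = c * L f) (A : 𝓢(ℂ, ℂ) →L[ℂ] 𝓢(ℂ, ℂ)) {K : ℝ}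
    (hL : ∀ f, ‖L f‖ ≤ K * ∫ β, ‖A f β‖) :
    ∃ W : 𝓢'(ℂ, ℂ), ∀ f, W f = L f := by
  let L' : 𝓢(ℂ, ℂ) →ₗ[ℂ] ℂ := ⟨⟨L, hadd⟩, hsmul⟩
  have hc : Continuous L' := by
    refine continuous_of_continuousAt_zero L' ?_
    rw [ContinuousAt, map_zero]
    have h0 : Tendsto (fun f : 𝓢(ℂ, ℂ) => K * ∫ β, ‖A f β‖) (𝓝 0) (𝓝 0) := by
      have := ((continuous_integral_norm A).tendsto 0).const_mul K
      simpa using this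
    exact squeeze_zero_norm hL h0
  exact ⟨ContinuousLinearMap.toPointwiseConvergenceCLM _ _ _ _ ⟨L', hc⟩, fun f => rfl⟩

/-! ### Wigner distributions of bounded operators -/

lemma weylDiag_eq (X : Fock →L[ℂ] Fock) (n : ℕ) (β : ℂ) :
    weylDiag X n β = ⟪X.adjoint (ket n), displacement β (ket n)⟫_ℂ := by
  rw [weylDiag, ContinuousLinearMap.adjoint_inner_left]

/-- The value of the Wigner distribution of `X` on `f`. -/
def wigner (X : Fock →L[ℂ] Fock) (f : 𝓢(ℂ, ℂ)) : ℂ :=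
  ∑' n : ℕ, (Real.pi : ℂ)⁻¹ * ∫ β : ℂ, weylDiag X n β * sft f β

lemma integral_weylDiag_eq (X : Fock →L[ℂ] Fock) (n : ℕ) (h : 𝓢(ℂ, ℂ)) :
    ∫ β : ℂ, weylDiag X n β * h β = smear (X.adjoint (ket n)) n h := by
  rw [smear]
  refine integral_congr_ae (Eventually.of_forall fun β => ?_)
  simp only [weylDiag_eq, mul_comm]

/-- Two powers of n + 1 already make the series over n summable. The vector X†|n⟩ varies with n, but
its norm stays below ‖X‖. -/
lemma norm_integral_weylDiag_le (X : Fock →L[ℂ] Fock) (n : ℕ) (h : 𝓢(ℂ, ℂ)) :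
    ‖∫ β : ℂ, weylDiag X n β * h β‖ ≤
      ‖X‖ * (∫ β, ‖(smearNumber ^ 2) h β‖) * (1 / ((n : ℝ) + 1) ^ 2) := by
  rw [integral_weylDiag_eq, mul_one_div, le_div_iff₀ (by positivity), mul_comm]
  refine (norm_smear_le_pow _ n 2 h).trans ?_
  gcongr
  calc ‖X.adjoint (ket n)‖ ≤ ‖X.adjoint‖ * ‖(ket n : Fock)‖ := X.adjoint.le_opNorm _
    _ = ‖X‖ := by rw [norm_ket, mul_one, LinearIsometryEquiv.norm_map]

lemma summable_one_div_add_one_sq : Summable (fun n : ℕ => 1 / ((n : ℝ) + 1) ^ 2) := by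
  have := (summable_nat_add_iff 1).2 (Real.summable_one_div_nat_pow.2 one_lt_two)
  simpa using this

lemma norm_wignerTerm_le (X : Fock →L[ℂ] Fock) (n : ℕ) (f : 𝓢(ℂ, ℂ)) :
    ‖(Real.pi : ℂ)⁻¹ * ∫ β : ℂ, weylDiag X n β * sft f β‖ ≤
      ‖(Real.pi : ℂ)⁻¹‖ * (‖X‖ * (∫ β, ‖(smearNumber ^ 2) (sft f) β‖)) *
        (1 / ((n : ℝ) + 1) ^ 2) := by
  rw [norm_mul, mul_assoc]
  gcongr
  exact norm_integral_weylDiag_le X n (sft f)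

lemma hasSum_wigner (X : Fock →L[ℂ] Fock) (f : 𝓢(ℂ, ℂ)) :
    HasSum (fun n : ℕ => (Real.pi : ℂ)⁻¹ * ∫ β : ℂ, weylDiag X n β * sft f β) (wigner X f) :=
  (Summable.of_norm_bounded (summable_one_div_add_one_sq.mul_left _)
    fun n => norm_wignerTerm_le X n f).hasSum

lemma wigner_add (X : Fock →L[ℂ] Fock) (f g : 𝓢(ℂ, ℂ)) :
    wigner X (f + g) = wigner X f + wigner X g := by
  refine (hasSum_wigner X (f + g)).unique (((hasSum_wigner X f).add
    (hasSum_wigner X g)).congr_fun fun n => ?_)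
  simp only [integral_weylDiag_eq]
  rw [map_add, smear_add, mul_add]

lemma wigner_smul (X : Fock →L[ℂ] Fock) (c : ℂ) (f : 𝓢(ℂ, ℂ)) :
    wigner X (c • f) = c * wigner X f := by
  refine (hasSum_wigner X (c • f)).unique (((hasSum_wigner X f).mul_left c).congr_fun fun n => ?_)
  simp only [integral_weylDiag_eq]
  rw [map_smul, smear_smul]
  ring

lemma norm_wigner_le (X : Fock →L[ℂ] Fock) (f : 𝓢(ℂ, ℂ)) :
    ‖wigner X f‖ ≤ (‖(Real.pi : ℂ)⁻¹‖ * ‖X‖ * ∑' n : ℕ, 1 / ((n : ℝ) + 1) ^ 2) *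
      ∫ β, ‖((smearNumber ^ 2 : 𝓢(ℂ, ℂ) →L[ℂ] 𝓢(ℂ, ℂ)) ∘L sft) f β‖ := by
  refine (tsum_of_norm_bounded (summable_one_div_add_one_sq.mul_left _).hasSum
    fun n => norm_wignerTerm_le X n f).trans_eq ?_
  rw [tsum_mul_left, ContinuousLinearMap.comp_apply]
  ring

lemma isWignerDist_iff (X : Fock →L[ℂ] Fock) (W : 𝓢'(ℂ, ℂ)) :
    IsWignerDist X W ↔ ∀ f, W f = wigner X f := by
  have h : ∀ f : 𝓢(ℂ, ℂ), (fun n : ℕ => (Real.pi : ℂ)⁻¹ *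
      ∫ β : ℂ, weylDiag X n β * ∫ α : ℂ, f α * symplecticKernel α β) =
      fun n : ℕ => (Real.pi : ℂ)⁻¹ * ∫ β : ℂ, weylDiag X n β * sft f β := fun f => by
    simp_rw [sft_apply]; rfl
  unfold IsWignerDist
  simp_rw [h]
  exact ⟨fun hW f => (hW f).unique (hasSum_wigner X f), fun hW f => hW f ▸ hasSum_wigner X f⟩

lemma exists_isWignerDist (X : Fock →L[ℂ] Fock) : ∃ W : 𝓢'(ℂ, ℂ), IsWignerDist X W := by
  obtain ⟨W, hW⟩ := exists_temperedDistribution (wigner_add X) (wigner_smul X) _ (norm_wigner_le X)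
  exact ⟨W, (isWignerDist_iff X W).2 hW⟩

/-- Dominated convergence twice: in β for fixed n with the unitary bound, and in n with the decay (n
+ 1)⁻², uniform along the sequence. -/
lemma WeakTendsto.wigner {Xs : ℕ → Fock →L[ℂ] Fock} {X : Fock →L[ℂ] Fock}
    (hX : WeakTendsto Xs X) (f : 𝓢(ℂ, ℂ)) :
    Tendsto (fun k => wigner (Xs k) f) atTop (𝓝 (wigner X f)) := by
  obtain ⟨⟨B, hB⟩, hl⟩ := hX
  have hB0 : 0 ≤ B := (norm_nonneg _).trans (hB 0)
  refine tendsto_tsum_of_dominated_convergence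
    (summable_one_div_add_one_sq.mul_left (‖(Real.pi : ℂ)⁻¹‖ *
      (B * (∫ β, ‖(smearNumber ^ 2) (sft f) β‖)))) (fun n => ?_)
    (Eventually.of_forall fun k n => (norm_wignerTerm_le (Xs k) n f).trans ?_)
  · refine Tendsto.const_mul _ (tendsto_integral_of_dominated_convergence
      (fun β => B * ‖sft f β‖) (fun k => ?_) ((sft f).integrable.norm.const_mul B)
      (fun k => Eventually.of_forall fun β => ?_) (Eventually.of_forall fun β => ?_))
    · exact (IsNuclear.integrable_weylDiag_mul (Xs k) n (sft f).integrable).aestronglyMeasurable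
    · rw [norm_mul]
      gcongr
      refine (IsKraus.norm_inner_le _ _ _).trans ?_
      rw [norm_displacement_apply, norm_ket, mul_one, mul_one]
      exact hB k
    · exact (hl _ _).mul_const _
  · have : 0 ≤ ∫ β, ‖(smearNumber ^ 2) (sft f) β‖ := integral_nonneg fun _ => norm_nonneg _
    gcongr
    exact hB k

lemma IsNuclear.wigner_eq {ι : Type} {X : Fock →L[ℂ] Fock} {u v : ι → Fock}
    (h : IsNuclear X u v) (f : 𝓢(ℂ, ℂ)) :
    wigner X f = (Real.pi : ℂ)⁻¹ * ∫ β, charFun X β * sft f β :=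
  (hasSum_wigner X f).unique (h.hasSum_integral_weylDiag (sft f).integrable)

/-- The Wigner distribution of `𝒞(X)` is the Husimi function of `X`. -/
lemma wigner_channelC (X : Fock →L[ℂ] Fock) (f : 𝓢(ℂ, ℂ)) :
    wigner (channelC X) f = ∫ α, f α * husimi X α := by
  have hX := weakTendsto_comp_cutoff X
  have h2 : Tendsto (fun N => ∫ α : ℂ, f α * husimi (X ∘L cutoff N) α) atTop
      (𝓝 (∫ α : ℂ, f α * husimi X α)) := by
    refine tendsto_integral_of_dominated_convergence (fun α => ‖f α‖ * ‖X‖) (fun N => ?_)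
      (f.integrable.norm.mul_const _)
      (fun N => Eventually.of_forall fun α => ?_) (Eventually.of_forall fun α => ?_)
    · exact (f.continuous.mul (continuous_husimi _)).aestronglyMeasurable
    · rw [norm_mul]
      gcongr
      exact (norm_husimi_le _ α).trans ((ContinuousLinearMap.opNorm_comp_le _ _).trans
        (mul_le_of_le_one_right (norm_nonneg _) (norm_cutoff_le N)))
    · exact (hX.2 _ _).const_mul _
  -- The identity is known for the cut-off operators, where characteristic functions exist, and both
  -- sides converge.
  refine tendsto_nhds_unique ((hX.channelC.wigner f).congr fun N => ?_) h2
  have h := isNuclear_comp_cutoff X N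
  obtain ⟨-, hχ, hw⟩ := h.isWignerFun_channelC
  rw [h.channelC.wigner_eq]
  simp_rw [hw, sft_apply, symplecticFourier]
  rw [← integral_symplecticKernel_swap f.integrable hχ, ← integral_const_mul]
  refine integral_congr_ae (Eventually.of_forall fun α => ?_)
  simp only []
  ring

/-- The Wigner distribution of `X` is a P distribution of `𝒞(X)`. -/
lemma wigner_cohForm (X : Fock →L[ℂ] Fock) {φ ψ : Fock} {f : 𝓢(ℂ, ℂ)}
    (hf : ∀ α, f α = cohForm α φ ψ) :
    wigner X f = Real.pi * ⟪φ, channelC X ψ⟫_ℂ := by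
  have hpi : (Real.pi : ℂ) ≠ 0 := by exact_mod_cast Real.pi_ne_zero
  have hX := weakTendsto_comp_cutoff X
  refine tendsto_nhds_unique ((hX.wigner f).congr fun N => ?_)
    ((hX.channelC.2 φ ψ).const_mul (Real.pi : ℂ))
  have h := isNuclear_comp_cutoff X N
  rw [h.wigner_eq, h.inner_channelC, ← mul_assoc, mul_inv_cancel₀ hpi, one_mul,
    ← integral_const_mul]
  refine integral_congr_ae (Eventually.of_forall fun β => ?_)
  have h1 := integral_symplecticKernel_mul_cohForm β φ ψ
  simp only [sft_apply, symplecticFourier, hf]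
  simp_rw [mul_comm (cohForm _ φ ψ), h1]
  field_simp

/-! ### The matrix elements of coherent states as Schwartz functions -/

/-- `⟨m|α⟩⟨α|n⟩`. -/
def cohMatrix (m n : ℕ) (α : ℂ) : ℂ := cohForm α (ket m) (ket n)

lemma cohMatrix_eq (m n : ℕ) (α : ℂ) :
    cohMatrix m n α = Complex.exp (-(α * conj α)) * α ^ m * conj α ^ n /
      (sqrtFact m * sqrtFact n) := by
  rw [cohMatrix, cohForm, inner_ket_left, inner_ket_right, coherent_eq, lp.coeFn_smul,
    Pi.smul_apply, Pi.smul_apply, expVec_apply, expVec_apply, smul_eq_mul, smul_eq_mul, map_mul,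
    Complex.conj_ofReal, map_div₀, map_pow, conj_sqrtFact, Complex.mul_conj']
  have e6 : ((Real.exp (-‖α‖ ^ 2 / 2) : ℝ) : ℂ) * ((Real.exp (-‖α‖ ^ 2 / 2) : ℝ) : ℂ) =
      Complex.exp (-(‖α‖ : ℂ) ^ 2) := by
    rw [← Complex.ofReal_mul, ← Real.exp_add, Complex.ofReal_exp]
    congr 1; push_cast; ring
  rw [← e6]
  have := sqrtFact_ne_zero n
  have := sqrtFact_ne_zero m
  field_simp

lemma norm_cohMatrix_le (m n : ℕ) (α : ℂ) : ‖cohMatrix m n α‖ ≤ 1 := by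
  simpa [norm_ket, cohMatrix] using norm_cohForm_le α (ket m) (ket n)

lemma mul_cohMatrix (m n : ℕ) (α : ℂ) :
    α * cohMatrix m n α = ((√((m : ℝ) + 1) : ℝ) : ℂ) * cohMatrix (m + 1) n α := by
  rw [cohMatrix_eq, cohMatrix_eq, sqrtFact_succ, pow_succ]
  have h1 := sqrtFact_ne_zero n
  have h2 := sqrtFact_ne_zero m
  have h3 : ((√((m : ℝ) + 1) : ℝ) : ℂ) ≠ 0 := by
    rw [Complex.ofReal_ne_zero]; positivity
  field_simp

lemma conj_mul_cohMatrix (m n : ℕ) (α : ℂ) :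
    conj α * cohMatrix m n α = ((√((n : ℝ) + 1) : ℝ) : ℂ) * cohMatrix m (n + 1) α := by
  rw [cohMatrix_eq, cohMatrix_eq, sqrtFact_succ, pow_succ]
  have h1 := sqrtFact_ne_zero n
  have h2 := sqrtFact_ne_zero m
  have h3 : ((√((n : ℝ) + 1) : ℝ) : ℂ) ≠ 0 := by
    rw [Complex.ofReal_ne_zero]; positivity
  field_simp

lemma sqrt_mul_cohMatrix_pred_left (m n : ℕ) (α : ℂ) :
    ((√(m : ℝ) : ℝ) : ℂ) * cohMatrix (m - 1) n α =
      Complex.exp (-(α * conj α)) * (m * α ^ (m - 1)) * conj α ^ n /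
        (sqrtFact m * sqrtFact n) := by
  cases m with
  | zero => simp
  | succ m =>
    rw [cohMatrix_eq, Nat.add_sub_cancel, sqrtFact_succ]
    have h1 := sqrtFact_ne_zero n
    have h2 := sqrtFact_ne_zero m
    have h3 : ((√((m : ℝ) + 1) : ℝ) : ℂ) ≠ 0 := by
      rw [Complex.ofReal_ne_zero]; positivity
    have h4 : ((√((m : ℝ) + 1) : ℝ) : ℂ) ^ 2 = m + 1 := by
      rw [← Complex.ofReal_pow, Real.sq_sqrt (by positivity)]; push_cast; rfl
    push_cast
    rw [← h4]
    field_simp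

lemma sqrt_mul_cohMatrix_pred_right (m n : ℕ) (α : ℂ) :
    ((√(n : ℝ) : ℝ) : ℂ) * cohMatrix m (n - 1) α =
      Complex.exp (-(α * conj α)) * α ^ m * (n * conj α ^ (n - 1)) /
        (sqrtFact m * sqrtFact n) := by
  cases n with
  | zero => simp
  | succ n =>
    rw [cohMatrix_eq, Nat.add_sub_cancel, sqrtFact_succ]
    have h1 := sqrtFact_ne_zero n
    have h2 := sqrtFact_ne_zero m
    have h3 : ((√((n : ℝ) + 1) : ℝ) : ℂ) ≠ 0 := by
      rw [Complex.ofReal_ne_zero]; positivity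
    have h4 : ((√((n : ℝ) + 1) : ℝ) : ℂ) ^ 2 = n + 1 := by
      rw [← Complex.ofReal_pow, Real.sq_sqrt (by positivity)]; push_cast; rfl
    push_cast
    rw [← h4]
    field_simp

lemma contDiff_cohMatrix (m n : ℕ) {k : WithTop ℕ∞} : ContDiff ℝ k (cohMatrix m n) := by
  rw [show cohMatrix m n = fun α => Complex.exp (-(α * conj α)) * α ^ m * conj α ^ n /
      (sqrtFact m * sqrtFact n) from funext (cohMatrix_eq m n)]
  have hc : ContDiff ℝ k (fun α : ℂ => conj α) := (Complex.conjCLE : ℂ ≃L[ℝ] ℂ).contDiff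
  have he : ContDiff ℝ k (fun α : ℂ => Complex.exp (-(α * conj α))) :=
    (contDiff_id.mul hc).neg.cexp
  exact ((he.mul (contDiff_id.pow m)).mul (hc.pow n)).div_const _

/-- Multiplication by the first argument. -/
def mulCLM : ℂ →L[ℝ] ℂ →L[ℝ] ℂ := ContinuousLinearMap.mul ℝ ℂ

/-- `z ↦ (w ↦ z w*)`. -/
def mulConjCLM : ℂ →L[ℝ] ℂ →L[ℝ] ℂ :=
  ((ContinuousLinearMap.compL ℝ ℂ ℂ ℂ).flip (Complex.conjCLE : ℂ →L[ℝ] ℂ)) ∘L mulCLM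

/-- Differentiation only shifts the indices, with square-root coefficients, so derivatives of all
orders stay within the family. The truncated `m - 1` and `n - 1` occur with coefficient 0 at index
0. -/
lemma hasFDerivAt_cohMatrix (m n : ℕ) (α : ℂ) :
    HasFDerivAt (cohMatrix m n)
      (mulCLM (((√(m : ℝ) : ℝ) : ℂ) * cohMatrix (m - 1) n α -
          ((√((n : ℝ) + 1) : ℝ) : ℂ) * cohMatrix m (n + 1) α) +
        mulConjCLM (((√(n : ℝ) : ℝ) : ℂ) * cohMatrix m (n - 1) α -
          ((√((m : ℝ) + 1) : ℝ) : ℂ) * cohMatrix (m + 1) n α)) α := by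
  have hid : HasFDerivAt (fun α : ℂ => α) (ContinuousLinearMap.id ℝ ℂ) α := hasFDerivAt_id α
  have hconj : HasFDerivAt (fun α : ℂ => conj α) (Complex.conjCLE : ℂ →L[ℝ] ℂ) α :=
    (Complex.conjCLE : ℂ ≃L[ℝ] ℂ).hasFDerivAt
  have h := (((hid.mul hconj).neg.cexp.mul (hid.pow m)).mul (hconj.pow n)).mul_const
    (sqrtFact m * sqrtFact n)⁻¹
  rw [show cohMatrix m n = fun α => Complex.exp (-(α * conj α)) * α ^ m * conj α ^ n *
      (sqrtFact m * sqrtFact n)⁻¹ from funext fun α => by rw [cohMatrix_eq, div_eq_mul_inv]]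
  refine HasFDerivAt.congr_fderiv h ?_
  rw [sqrt_mul_cohMatrix_pred_left, sqrt_mul_cohMatrix_pred_right, ← mul_cohMatrix,
    ← conj_mul_cohMatrix, cohMatrix_eq]
  ext w
  simp [mulCLM, mulConjCLM]
  ring

/-- One index shift: the coefficient `r` is at most the weight `x`, and the shifted weight `y` at
most doubles it, so the polynomial degree rises by one. -/
lemma growth_step {C x r y : ℝ} {q : ℕ} (hC : 0 ≤ C) (hr0 : 0 ≤ r) (hr : r ≤ x) (hy : 0 ≤ y)
    (hyx : y ≤ 2 * x) : r * (C * y ^ q) ≤ C * 2 ^ q * x ^ (q + 1) := by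
  calc r * (C * y ^ q) ≤ x * (C * (2 * x) ^ q) := by
        have : 0 ≤ x := hr0.trans hr
        gcongr
    _ = _ := by rw [mul_pow]; ring

lemma cohMatrix_decay (k : ℕ) :
    ∃ C : ℝ, 0 ≤ C ∧ ∃ q : ℕ, ∀ (m n : ℕ) (α : ℂ),
      ‖α‖ ^ k * ‖cohMatrix m n α‖ ≤ C * (1 + m + n : ℝ) ^ q := by
  induction k with
  | zero => exact ⟨1, zero_le_one, 0, fun m n α => by simpa using norm_cohMatrix_le m n α⟩
  | succ k ih =>
    obtain ⟨C, hC, q, h⟩ := ih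
    refine ⟨C * 2 ^ q, by positivity, q + 1, fun m n α => ?_⟩
    have e : ‖α‖ * ‖cohMatrix m n α‖ = √((m : ℝ) + 1) * ‖cohMatrix (m + 1) n α‖ := by
      rw [← norm_mul, mul_cohMatrix, norm_mul, Complex.norm_real,
        Real.norm_of_nonneg (Real.sqrt_nonneg _)]
    calc ‖α‖ ^ (k + 1) * ‖cohMatrix m n α‖
        = √((m : ℝ) + 1) * (‖α‖ ^ k * ‖cohMatrix (m + 1) n α‖) := by
          rw [pow_succ, mul_assoc, e]; ring
      _ ≤ √((m : ℝ) + 1) * (C * (1 + (m + 1 : ℕ) + n : ℝ) ^ q) :=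
          mul_le_mul_of_nonneg_left (h _ _ _) (Real.sqrt_nonneg _)
      _ ≤ _ := by
          refine growth_step hC (Real.sqrt_nonneg _) ?_ (by positivity) ?_
          · exact (sqrt_le_add_one m).trans (by linarith [(n.cast_nonneg : (0 : ℝ) ≤ n)])
          · push_cast
            linarith [(n.cast_nonneg : (0 : ℝ) ≤ n), (m.cast_nonneg : (0 : ℝ) ≤ m)]

lemma sqrt_natCast_le (n : ℕ) : √(n : ℝ) ≤ n + 1 :=
  (Real.sqrt_le_sqrt (by linarith)).trans (sqrt_le_add_one n)

/-- Induction on the order of differentiation, the first derivative being a combination of four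
members of the family. The constant has to be uniform in m and n, since it is summed against rapidly
decaying coefficients. -/
lemma cohMatrix_iteratedFDeriv_decay (k j : ℕ) :
    ∃ C : ℝ, 0 ≤ C ∧ ∃ q : ℕ, ∀ (m n : ℕ) (α : ℂ),
      ‖α‖ ^ k * ‖iteratedFDeriv ℝ j (cohMatrix m n) α‖ ≤ C * (1 + m + n : ℝ) ^ q := by
  induction j with
  | zero => simpa using cohMatrix_decay k
  | succ j ih =>
    obtain ⟨C, hC, q, h⟩ := ih
    refine ⟨(2 * ‖mulCLM‖ + 2 * ‖mulConjCLM‖) * (C * 2 ^ q), by positivity, q + 1,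
      fun m n α => ?_⟩
    set x : ℝ := 1 + m + n with hx
    let g₁ : ℂ → ℂ := fun α => ((√(m : ℝ) : ℝ) : ℂ) • cohMatrix (m - 1) n α -
          ((√((n : ℝ) + 1) : ℝ) : ℂ) • cohMatrix m (n + 1) α
    let g₂ : ℂ → ℂ := fun α => ((√(n : ℝ) : ℝ) : ℂ) • cohMatrix m (n - 1) α -
          ((√((m : ℝ) + 1) : ℝ) : ℂ) • cohMatrix (m + 1) n α
    have hd : fderiv ℝ (cohMatrix m n) = (mulCLM ∘ g₁) + (mulConjCLM ∘ g₂) :=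
      funext fun α => (hasFDerivAt_cohMatrix m n α).fderiv
    have hg₁ : ContDiff ℝ j g₁ := ((contDiff_cohMatrix _ _).const_smul _).sub
      ((contDiff_cohMatrix _ _).const_smul _)
    have hg₂ : ContDiff ℝ j g₂ := ((contDiff_cohMatrix _ _).const_smul _).sub
      ((contDiff_cohMatrix _ _).const_smul _)
    have hm : (0 : ℝ) ≤ m := m.cast_nonneg
    have hn : (0 : ℝ) ≤ n := n.cast_nonneg
    have hsub : ∀ (a b : ℝ) (m₁ n₁ m₂ n₂ : ℕ), 0 ≤ a → 0 ≤ b → a ≤ x → b ≤ x →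
        (1 + m₁ + n₁ : ℝ) ≤ 2 * x → (1 + m₂ + n₂ : ℝ) ≤ 2 * x →
        ‖α‖ ^ k * ‖iteratedFDeriv ℝ j (fun α => (a : ℂ) • cohMatrix m₁ n₁ α -
          (b : ℂ) • cohMatrix m₂ n₂ α) α‖ ≤ 2 * (C * 2 ^ q * x ^ (q + 1)) := by
      intro a b m₁ n₁ m₂ n₂ ha hb hax hbx h1 h2
      have e : iteratedFDeriv ℝ j (fun α => (a : ℂ) • cohMatrix m₁ n₁ α -
          (b : ℂ) • cohMatrix m₂ n₂ α) α = (a : ℂ) • iteratedFDeriv ℝ j (cohMatrix m₁ n₁) α -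
          (b : ℂ) • iteratedFDeriv ℝ j (cohMatrix m₂ n₂) α := by
        have c1 : ContDiffAt ℝ j (cohMatrix m₁ n₁) α := (contDiff_cohMatrix _ _).contDiffAt
        have c2 : ContDiffAt ℝ j (cohMatrix m₂ n₂) α := (contDiff_cohMatrix _ _).contDiffAt
        rw [← iteratedFDeriv_const_smul_apply' c1, ← iteratedFDeriv_const_smul_apply' c2]
        exact fun_iteratedFDeriv_sub_apply (c1.const_smul _) (c2.const_smul _)
      rw [e]
      calc _ ≤ ‖α‖ ^ k * (a * ‖iteratedFDeriv ℝ j (cohMatrix m₁ n₁) α‖ +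
            b * ‖iteratedFDeriv ℝ j (cohMatrix m₂ n₂) α‖) := by
            gcongr
            refine (norm_sub_le _ _).trans_eq ?_
            rw [norm_smul, norm_smul, Complex.norm_real, Complex.norm_real,
              Real.norm_of_nonneg ha, Real.norm_of_nonneg hb]
        _ = a * (‖α‖ ^ k * ‖iteratedFDeriv ℝ j (cohMatrix m₁ n₁) α‖) +
            b * (‖α‖ ^ k * ‖iteratedFDeriv ℝ j (cohMatrix m₂ n₂) α‖) := by ring
        _ ≤ a * (C * (1 + m₁ + n₁ : ℝ) ^ q) + b * (C * (1 + m₂ + n₂ : ℝ) ^ q) :=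
            add_le_add (mul_le_mul_of_nonneg_left (h m₁ n₁ α) ha)
              (mul_le_mul_of_nonneg_left (h m₂ n₂ α) hb)
        _ ≤ C * 2 ^ q * x ^ (q + 1) + C * 2 ^ q * x ^ (q + 1) :=
            add_le_add (growth_step hC ha hax (by positivity) h1)
              (growth_step hC hb hbx (by positivity) h2)
        _ = _ := by ring
    have hm1 : ((m - 1 : ℕ) : ℝ) ≤ m := by exact_mod_cast Nat.sub_le m 1
    have hn1 : ((n - 1 : ℕ) : ℝ) ≤ n := by exact_mod_cast Nat.sub_le n 1
    have b1 := hsub (√(m : ℝ)) (√((n : ℝ) + 1)) (m - 1) n m (n + 1) (Real.sqrt_nonneg _)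
      (Real.sqrt_nonneg _) ((sqrt_natCast_le m).trans (by linarith))
      ((sqrt_le_add_one n).trans (by linarith)) (by linarith) (by push_cast; linarith)
    have b2 := hsub (√(n : ℝ)) (√((m : ℝ) + 1)) m (n - 1) (m + 1) n (Real.sqrt_nonneg _)
      (Real.sqrt_nonneg _) ((sqrt_natCast_le n).trans (by linarith))
      ((sqrt_le_add_one m).trans (by linarith)) (by linarith) (by push_cast; linarith)
    rw [← norm_iteratedFDeriv_fderiv, hd, iteratedFDeriv_add_apply
      (mulCLM.contDiff.comp hg₁).contDiffAt (mulConjCLM.contDiff.comp hg₂).contDiffAt]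
    calc _ ≤ ‖α‖ ^ k * (‖mulCLM‖ * ‖iteratedFDeriv ℝ j g₁ α‖ +
          ‖mulConjCLM‖ * ‖iteratedFDeriv ℝ j g₂ α‖) := by
          gcongr
          refine (norm_add_le _ _).trans (add_le_add ?_ ?_)
          · exact mulCLM.norm_iteratedFDeriv_comp_left hg₁.contDiffAt le_rfl
          · exact mulConjCLM.norm_iteratedFDeriv_comp_left hg₂.contDiffAt le_rfl
      _ = ‖mulCLM‖ * (‖α‖ ^ k * ‖iteratedFDeriv ℝ j g₁ α‖) +
          ‖mulConjCLM‖ * (‖α‖ ^ k * ‖iteratedFDeriv ℝ j g₂ α‖) := by ring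
      _ ≤ ‖mulCLM‖ * (2 * (C * 2 ^ q * x ^ (q + 1))) +
          ‖mulConjCLM‖ * (2 * (C * 2 ^ q * x ^ (q + 1))) := by gcongr
      _ = _ := by ring

/-- `α ↦ ⟨m|α⟩⟨α|n⟩` as a Schwartz function. -/
def cohSchwartz (m n : ℕ) : 𝓢(ℂ, ℂ) where
  toFun := cohMatrix m n
  smooth' := contDiff_cohMatrix m n
  decay' k j := by
    obtain ⟨C, -, q, h⟩ := cohMatrix_iteratedFDeriv_decay k j
    exact ⟨_, h m n⟩

lemma cohSchwartz_apply (m n : ℕ) (α : ℂ) : cohSchwartz m n α = cohForm α (ket m) (ket n) := rfl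

lemma exists_seminorm_cohSchwartz_le (k j : ℕ) :
    ∃ C : ℝ, 0 ≤ C ∧ ∃ q : ℕ, ∀ m n : ℕ,
      SchwartzMap.seminorm ℂ k j (cohSchwartz m n) ≤ C * (1 + m + n : ℝ) ^ q := by
  obtain ⟨C, hC, q, h⟩ := cohMatrix_iteratedFDeriv_decay k j
  exact ⟨C, hC, q, fun m n => SchwartzMap.seminorm_le_bound ℂ k j _ (by positivity) (h m n)⟩

/-! ### Convergence in the Schwartz space -/

lemma tendsto_schwartz_iff {ι : Type*} {l : Filter ι} {u : ι → 𝓢(ℂ, ℂ)} {g : 𝓢(ℂ, ℂ)} :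
    Tendsto u l (𝓝 g) ↔
      ∀ k j : ℕ, Tendsto (fun i => SchwartzMap.seminorm ℂ k j (u i - g)) l (𝓝 0) := by
  rw [(schwartz_withSeminorms ℂ ℂ ℂ).tendsto_nhds]
  constructor
  · intro h k j
    rw [Metric.tendsto_nhds]
    intro ε hε
    filter_upwards [h (k, j) ε hε] with i hi
    rw [dist_zero_right, Real.norm_of_nonneg (apply_nonneg _ _)]
    exact hi
  · rintro h ⟨k, j⟩ ε hε
    exact (h k j).eventually_lt_const hε

/-- The error of a partial sum is the tail of the series; differentiating it term by term bounds
each seminorm by the tail of a convergent numerical series. -/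
lemma hasSum_schwartz {ι : Type} {f : ι → 𝓢(ℂ, ℂ)} {G : 𝓢(ℂ, ℂ)}
    (hG : ∀ x, HasSum (fun i => f i x) (G x))
    (hf : ∀ k j : ℕ, Summable fun i => SchwartzMap.seminorm ℂ k j (f i)) : HasSum f G := by
  rw [HasSum, tendsto_schwartz_iff]
  intro k j
  refine squeeze_zero (fun s => apply_nonneg _ _) (fun s => ?_)
    (tendsto_tsum_compl_atTop_zero fun i => SchwartzMap.seminorm ℂ k j (f i))
  rw [map_sub_rev]
  have hs : ∀ k j : ℕ, Summable fun i : { i // i ∉ s } => SchwartzMap.seminorm ℂ k j (f i) :=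
    fun k j => (hf k j).subtype _
  have e : (⇑(G - ∑ i ∈ s, f i) : ℂ → ℂ) = fun x => ∑' i : { i // i ∉ s }, f i x := by
    funext x
    rw [sub_apply, sum_apply, sub_eq_iff_eq_add', ← (hG x).tsum_eq,
      (hG x).summable.sum_add_tsum_subtype_compl s]
  refine SchwartzMap.seminorm_le_bound ℂ k j _ (tsum_nonneg fun i => apply_nonneg _ _) fun x => ?_
  rw [e, iteratedFDeriv_tsum_apply (N := ⊤) (v := fun j (i : { i // i ∉ s }) =>
    SchwartzMap.seminorm ℂ 0 j (f i)) (fun i => (f i).smooth _) (fun j _ => hs 0 j)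
    (fun j i x _ => SchwartzMap.norm_iteratedFDeriv_le_seminorm ℂ (f i) j x) le_top]
  have hn : Summable fun i : { i // i ∉ s } => ‖iteratedFDeriv ℝ j (f i) x‖ :=
    Summable.of_nonneg_of_le (fun _ => norm_nonneg _)
      (fun i => SchwartzMap.norm_iteratedFDeriv_le_seminorm ℂ (f i) j x) (hs 0 j)
  calc _ ≤ ‖x‖ ^ k * ∑' i : { i // i ∉ s }, ‖iteratedFDeriv ℝ j (f i) x‖ := by
        gcongr
        exact norm_tsum_le_tsum_norm hn
    _ = ∑' i : { i // i ∉ s }, ‖x‖ ^ k * ‖iteratedFDeriv ℝ j (f i) x‖ := tsum_mul_left.symm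
    _ ≤ _ := (hn.mul_left _).tsum_le_tsum
        (fun i => SchwartzMap.le_seminorm ℂ k j (f i) x) (hs k j)

/-! ### Density of the compactly supported functions -/

/-- A bump function on the complex plane. -/
def bump : ContDiffBump (0 : ℂ) := ⟨1, 2, one_pos, one_lt_two⟩

/-- The bump function as a Schwartz function. -/
def bumpSchwartz : 𝓢(ℂ, ℂ) :=
  (bump.hasCompactSupport.comp_left (g := ((↑) : ℝ → ℂ)) Complex.ofReal_zero).toSchwartzMap
    (Complex.ofRealCLM.contDiff.comp bump.contDiff)

lemma bumpSchwartz_apply (x : ℂ) : bumpSchwartz x = (bump x : ℂ) := rfl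

lemma bumpSchwartz_eq_one {x : ℂ} (hx : ‖x‖ ≤ 1) : bumpSchwartz x = 1 := by
  rw [bumpSchwartz_apply, bump.one_of_mem_closedBall (by simpa [bump] using hx)]
  rfl

/-- The dilated cutoff functions. -/
def bumpDilation (N : ℕ) (x : ℂ) : ℂ := bumpSchwartz ((((N : ℝ) + 1)⁻¹ : ℝ) • x)

lemma contDiff_bumpDilation (N : ℕ) {k : ℕ∞} : ContDiff ℝ k (bumpDilation N) :=
  (bumpSchwartz.smooth k).comp (contDiff_const_smul _)

lemma hasCompactSupport_bumpDilation (N : ℕ) : HasCompactSupport (bumpDilation N) :=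
  HasCompactSupport.comp_smul
    (bump.hasCompactSupport.comp_left (g := ((↑) : ℝ → ℂ)) Complex.ofReal_zero) (by positivity)

lemma bumpDilation_eventuallyEq {N : ℕ} {x : ℂ} (hx : ‖x‖ < N + 1) :
    bumpDilation N =ᶠ[𝓝 x] fun _ => 1 := by
  filter_upwards [(isOpen_lt continuous_norm continuous_const).mem_nhds hx] with y hy
  refine bumpSchwartz_eq_one ?_
  rw [norm_smul, norm_inv, Real.norm_of_nonneg (by positivity), inv_mul_le_one₀ (by positivity)]
  exact le_of_lt hy

lemma norm_iteratedFDeriv_bumpDilation_le (N i : ℕ) (x : ℂ) :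
    ‖iteratedFDeriv ℝ i (bumpDilation N) x‖ ≤ SchwartzMap.seminorm ℂ 0 i bumpSchwartz := by
  let L : ℂ →L[ℝ] ℂ := (((N : ℝ) + 1)⁻¹ : ℝ) • ContinuousLinearMap.id ℝ ℂ
  have hL : ‖L‖ ≤ 1 := by
    have h1 : ‖((N : ℝ) + 1)⁻¹‖ ≤ 1 := by
      rw [norm_inv, Real.norm_of_nonneg (by positivity)]
      exact inv_le_one_of_one_le₀ (by linarith [(N.cast_nonneg : (0 : ℝ) ≤ N)])
    refine ContinuousLinearMap.opNorm_le_bound _ zero_le_one fun y => ?_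
    change ‖((N : ℝ) + 1)⁻¹ • y‖ ≤ _
    rw [norm_smul]
    gcongr
  have e : bumpDilation N = bumpSchwartz ∘ L := rfl
  have h := L.iteratedFDeriv_comp_right (bumpSchwartz.smooth i) x (i := i) le_rfl
  rw [e, h]
  refine (ContinuousMultilinearMap.norm_compContinuousLinearMap_le _ _).trans ?_
  rw [Finset.prod_const]
  exact (mul_le_of_le_one_right (norm_nonneg _) (pow_le_one₀ (norm_nonneg _) hL)).trans
    (SchwartzMap.norm_iteratedFDeriv_le_seminorm ℂ bumpSchwartz i _)

/-- The truncation of a Schwartz function. -/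
def truncate (f : 𝓢(ℂ, ℂ)) (N : ℕ) : 𝓢(ℂ, ℂ) :=
  ((hasCompactSupport_bumpDilation N).mul_right (f' := f)).toSchwartzMap
    ((contDiff_bumpDilation N).mul (f.smooth _))

lemma truncate_apply (f : 𝓢(ℂ, ℂ)) (N : ℕ) (x : ℂ) : truncate f N x = bumpDilation N x * f x := rfl

lemma hasCompactSupport_truncate (f : 𝓢(ℂ, ℂ)) (N : ℕ) : HasCompactSupport (truncate f N) :=
  (hasCompactSupport_bumpDilation N).mul_right

/-- The difference vanishes where ‖x‖ < N + 1. Elsewhere one more power of ‖x‖ gains the factor 1/(N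
+ 1), at the price of the seminorm of index k + 1; the derivatives of the cutoff are bounded
uniformly in N. -/
lemma tendsto_truncate (f : 𝓢(ℂ, ℂ)) : Tendsto (truncate f) atTop (𝓝 f) := by
  rw [tendsto_schwartz_iff]
  intro k j
  set C : ℝ := ∑ i ∈ Finset.range (j + 1), (j.choose i : ℝ) *
    SchwartzMap.seminorm ℂ 0 i bumpSchwartz * SchwartzMap.seminorm ℂ (k + 1) (j - i) f +
      SchwartzMap.seminorm ℂ (k + 1) j f with hC
  have hC0 : 0 ≤ C := by positivity
  have h0 : Tendsto (fun N : ℕ => C * (1 / ((N : ℝ) + 1))) atTop (𝓝 0) := by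
    simpa using tendsto_one_div_add_atTop_nhds_zero_nat.const_mul C
  refine squeeze_zero (fun _ => apply_nonneg _ _) (fun N => ?_) h0
  refine SchwartzMap.seminorm_le_bound ℂ k j _ (by positivity) fun x => ?_
  rcases lt_or_ge ‖x‖ (N + 1) with hx | hx
  · have h1 : (⇑(truncate f N - f) : ℂ → ℂ) =ᶠ[𝓝 x] fun _ => 0 := by
      filter_upwards [bumpDilation_eventuallyEq hx] with y hy
      rw [sub_apply, truncate_apply, hy, one_mul, sub_self]
    rw [(Filter.EventuallyEq.iteratedFDeriv ℝ h1 j).self_of_nhds, iteratedFDeriv_fun_zero, Pi.zero_apply, norm_zero, mul_zero]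
    positivity
  · have hN : (0 : ℝ) < N + 1 := by positivity
    rw [mul_one_div, le_div_iff₀ hN]
    have e : (⇑(truncate f N - f) : ℂ → ℂ) = fun y => bumpDilation N y * f y - f y := rfl
    have c1 : ContDiff ℝ j (fun y => bumpDilation N y * f y) :=
      (contDiff_bumpDilation N (k := j)).mul (f.smooth j)
    rw [e, fun_iteratedFDeriv_sub_apply c1.contDiffAt (f.smooth j).contDiffAt]
    have hx0 : 0 ≤ ‖x‖ ^ (k + 1) := by positivity
    calc _ ≤ ‖x‖ ^ k * ‖iteratedFDeriv ℝ j (fun y => bumpDilation N y * f y) x -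
            iteratedFDeriv ℝ j f x‖ * ‖x‖ := by gcongr
      _ = ‖x‖ ^ (k + 1) * ‖iteratedFDeriv ℝ j (fun y => bumpDilation N y * f y) x -
            iteratedFDeriv ℝ j f x‖ := by ring
      _ ≤ ‖x‖ ^ (k + 1) * (∑ i ∈ Finset.range (j + 1), (j.choose i : ℝ) *
            ‖iteratedFDeriv ℝ i (bumpDilation N) x‖ * ‖iteratedFDeriv ℝ (j - i) f x‖ +
            ‖iteratedFDeriv ℝ j f x‖) := by
          gcongr
          refine (norm_sub_le _ _).trans (add_le_add_left ?_ _)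
          exact norm_iteratedFDeriv_mul_le (contDiff_bumpDilation N (k := j)) (f.smooth j) x le_rfl
      _ = ∑ i ∈ Finset.range (j + 1), (j.choose i : ℝ) *
            ‖iteratedFDeriv ℝ i (bumpDilation N) x‖ *
              (‖x‖ ^ (k + 1) * ‖iteratedFDeriv ℝ (j - i) f x‖) +
            ‖x‖ ^ (k + 1) * ‖iteratedFDeriv ℝ j f x‖ := by
          rw [mul_add, Finset.mul_sum]
          congr 1
          exact Finset.sum_congr rfl fun i _ => by ring
      _ ≤ C := by
          refine add_le_add (Finset.sum_le_sum fun i _ => ?_) (f.le_seminorm ℂ _ _ x)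
          have h1 := norm_iteratedFDeriv_bumpDilation_le N i x
          have h2 := f.le_seminorm ℂ (k + 1) (j - i) x
          gcongr

/-! ### Matrix elements of smeared displacement operators -/

/-- `β ↦ h(-β)*`. -/
def conjNeg (h : 𝓢(ℂ, ℂ)) : 𝓢(ℂ, ℂ) :=
  SchwartzMap.postcompCLM (𝕜 := ℝ) (Complex.conjCLE : ℂ →L[ℝ] ℂ)
    (SchwartzMap.compCLMOfContinuousLinearEquiv ℝ (ContinuousLinearEquiv.neg ℝ : ℂ ≃L[ℝ] ℂ) h)

lemma conjNeg_apply (h : 𝓢(ℂ, ℂ)) (β : ℂ) : conjNeg h β = conj (h (-β)) := rfl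

lemma conj_smear_ket (m n : ℕ) (h : 𝓢(ℂ, ℂ)) :
    conj (smear (ket m) n h) = smear (ket n) m (conjNeg h) := by
  rw [smear, smear, ← integral_conj, ← integral_neg_eq_self]
  refine integral_congr_ae (Eventually.of_forall fun β => ?_)
  simp only [map_mul, conjNeg_apply, inner_conj_symm]
  rw [← adjoint_displacement, ContinuousLinearMap.adjoint_inner_left]

/-- Decay in n comes from right multiplication by a a†, decay in m from the same estimate for the
adjoint, as D(β)† = D(-β). Order 2k in each index gives order k in both, by the inequality between
geometric and arithmetic means. -/
lemma exists_norm_smear_ket_le (k : ℕ) (h : 𝓢(ℂ, ℂ)) :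
    ∃ C : ℝ, 0 ≤ C ∧ ∀ m n : ℕ,
      ((m + 1 : ℝ) * (n + 1)) ^ k * ‖smear (ket m) n h‖ ≤ C := by
  refine ⟨((∫ β, ‖(smearNumber ^ (2 * k)) h β‖) +
    ∫ β, ‖(smearNumber ^ (2 * k)) (conjNeg h) β‖) / 2, ?_, fun m n => ?_⟩
  · have h1 : ∀ g : 𝓢(ℂ, ℂ), 0 ≤ ∫ β, ‖g β‖ := fun g => integral_nonneg fun _ => norm_nonneg _
    linarith [h1 ((smearNumber ^ (2 * k)) h), h1 ((smearNumber ^ (2 * k)) (conjNeg h))]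
  · have h1 := norm_smear_le_pow (ket m) n (2 * k) h
    have h2 := norm_smear_le_pow (ket n) m (2 * k) (conjNeg h)
    rw [← conj_smear_ket, RCLike.norm_conj] at h2
    rw [norm_ket, one_mul] at h1 h2
    rw [mul_comm 2 k, pow_mul] at h1 h2
    have h3 : ((m + 1 : ℝ) ^ k * (n + 1) ^ k) ≤
      (((n + 1 : ℝ) ^ k) ^ 2 + ((m + 1 : ℝ) ^ k) ^ 2) / 2 := by
      nlinarith [sq_nonneg ((m + 1 : ℝ) ^ k - (n + 1 : ℝ) ^ k)]
    rw [mul_pow]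
    calc _ ≤ (((n + 1 : ℝ) ^ k) ^ 2 + ((m + 1 : ℝ) ^ k) ^ 2) / 2 * ‖smear (ket m) n h‖ := by gcongr
      _ ≤ _ := by rw [mul_comm 2 k]; linarith

lemma summable_one_div_sq_prod :
    Summable (fun p : ℕ × ℕ => 1 / ((p.1 + 1 : ℝ) * (p.2 + 1)) ^ 2) := by
  have h := summable_one_div_add_one_sq
  refine (h.mul_of_nonneg h (fun _ => by positivity) fun _ => by positivity).congr fun p => ?_
  rw [mul_pow, one_div_mul_one_div]

lemma summable_smear_mul_growth (h : 𝓢(ℂ, ℂ)) (q : ℕ) :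
    Summable (fun p : ℕ × ℕ =>
      ‖smear (ket p.1) p.2 h‖ * ((p.1 + 1 : ℝ) * (p.2 + 1)) ^ q) := by
  obtain ⟨C, hC, hb⟩ := exists_norm_smear_ket_le (q + 2) h
  refine Summable.of_nonneg_of_le (fun p => by positivity) (fun p => ?_)
    (summable_one_div_sq_prod.mul_left C)
  rw [mul_one_div, le_div_iff₀ (by positivity), mul_assoc, ← pow_add, mul_comm]
  exact hb p.1 p.2

lemma hasSum_smear (h : 𝓢(ℂ, ℂ)) (φ : Fock) :
    HasSum (fun p : ℕ × ℕ => smear (ket p.1) p.2 h * (⟪φ, ket p.1⟫_ℂ * ⟪ket p.2, φ⟫_ℂ))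
      (∫ β, h β * ⟪φ, displacement β φ⟫_ℂ) := by
  obtain ⟨T, hT⟩ := (isBddSesq_integral_displacement h.integrable).exists_clm
  have hs : Summable (fun p : ℕ × ℕ =>
      smear (ket p.1) p.2 h * (⟪φ, ket p.1⟫_ℂ * ⟪ket p.2, φ⟫_ℂ)) := by
    refine Summable.of_norm_bounded ((summable_smear_mul_growth h 0).mul_right (‖φ‖ * ‖φ‖))
      fun p => ?_
    rw [norm_mul, norm_mul, pow_zero, mul_one]
    gcongr
    · simpa [norm_ket] using norm_inner_le_norm (𝕜 := ℂ) φ (ket p.1)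
    · simpa [norm_ket] using norm_inner_le_norm (𝕜 := ℂ) (ket p.2) φ
  rw [← hT, ← (hasSum_inner_mul_inner φ (T φ)).tsum_eq, ← tsum_prod_right hs fun m => ?_]
  · exact hs.hasSum
  · rw [← ContinuousLinearMap.adjoint_inner_left T]
    refine ((hasSum_inner_mul_inner (T.adjoint (ket m)) φ).mul_left ⟪φ, ket m⟫_ℂ).congr_fun
      fun n => ?_
    rw [ContinuousLinearMap.adjoint_inner_left, hT]
    simp only [smear]
    ring

lemma inner_coherent_displacement (α β : ℂ) :
    ⟪coherent α, displacement β (coherent α)⟫_ℂ = gauss β * symplecticKernel β α := by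
  rw [coherent_eq, map_smul, inner_smul_left, inner_smul_right, inner_expVec_displacement,
    Complex.conj_ofReal, Complex.ofReal_exp, gauss, symplecticKernel, ← Complex.exp_add,
    ← Complex.exp_add, ← Complex.exp_add]
  congr 1
  have := Complex.mul_conj' α
  push_cast
  rw [← this]
  ring

/-- The left-over Gaussian is the diagonal element in ⟨α|D(β)|α⟩ = e^{-|β|²/2} e^{βα* - β*α}, so the
transform of `g` is the Husimi function of ∫ h(β)D(β). Expanding in number states gives the series,
with rapidly decaying coefficients against polynomially growing seminorms. -/
lemma hasSum_cohSchwartz {g h : 𝓢(ℂ, ℂ)} (hg : ∀ β, g β = h β * gauss β) :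
    HasSum (fun p : ℕ × ℕ => smear (ket p.1) p.2 h • cohSchwartz p.2 p.1) (sft g) := by
  refine hasSum_schwartz (fun α => ?_) fun k j => ?_
  · have h1 := hasSum_smear h (coherent α)
    have h2 : sft g α = ∫ β, h β * ⟪coherent α, displacement β (coherent α)⟫_ℂ := by
      rw [sft_apply, symplecticFourier]
      refine integral_congr_ae (Eventually.of_forall fun β => ?_)
      simp only [hg, inner_coherent_displacement]
      ring
    rw [h2]
    refine h1.congr_fun fun p => ?_
    rw [smul_apply, cohSchwartz_apply, cohForm, smul_eq_mul]
    ring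
  · obtain ⟨C, hC, q, hq⟩ := exists_seminorm_cohSchwartz_le k j
    refine Summable.of_nonneg_of_le (fun p => apply_nonneg _ _) (fun p => ?_)
      ((summable_smear_mul_growth h q).mul_right C)
    rw [map_smul_eq_mul, mul_assoc]
    gcongr
    refine (hq p.2 p.1).trans ?_
    rw [mul_comm]
    gcongr
    nlinarith [mul_nonneg (p.1.cast_nonneg : (0 : ℝ) ≤ p.1) (p.2.cast_nonneg : (0 : ℝ) ≤ p.2)]

/-! ### Uniqueness of the P distribution -/

/-- Division by the Gaussian leaves the Schwartz space in general; compact support makes it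
harmless. -/
lemma exists_eq_mul_gauss {g : 𝓢(ℂ, ℂ)} (hg : HasCompactSupport g) :
    ∃ h : 𝓢(ℂ, ℂ), ∀ β, g β = h β * gauss β := by
  have hc : ContDiff ℝ (⊤ : ℕ∞) (fun β : ℂ => conj β) :=
    (Complex.conjCLE : ℂ ≃L[ℝ] ℂ).contDiff
  have he : ContDiff ℝ (⊤ : ℕ∞) (fun β : ℂ => Complex.exp (β * conj β / 2)) :=
    ((contDiff_id.mul hc).div_const 2).cexp
  refine ⟨(hg.mul_left (f := fun β : ℂ => Complex.exp (β * conj β / 2))).toSchwartzMap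
    (he.mul (g.smooth _)), fun β => ?_⟩
  change g β = Complex.exp (β * conj β / 2) * g β * Complex.exp (-(β * conj β) / 2)
  rw [mul_right_comm, ← Complex.exp_add, neg_div, add_neg_cancel, Complex.exp_zero, one_mul]

/-- The functions ⟨m|α⟩⟨α|n⟩ have a span whose closure contains the transforms of all compactly
supported functions. These are dense, because the symplectic Fourier transform is continuous and
onto. -/
lemma temperedDistribution_eq_zero {P : 𝓢'(ℂ, ℂ)} (hP : ∀ m n : ℕ, P (cohSchwartz m n) = 0) :
    P = 0 := by
  have h1 : ∀ g : 𝓢(ℂ, ℂ), HasCompactSupport g → P (sft g) = 0 := fun g hg => by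
    obtain ⟨h, hh⟩ := exists_eq_mul_gauss hg
    have hs := (hasSum_cohSchwartz hh).map P.toLinearMap.toAddMonoidHom P.continuous
    refine hs.unique (hasSum_zero.congr_fun fun p => ?_)
    change P (_ • _) = 0
    rw [map_smul, hP, smul_zero]
  ext f
  obtain ⟨g, rfl⟩ := sft_surjective f
  have h2 : Tendsto (fun N => P (sft (truncate g N))) atTop (𝓝 (P (sft g))) :=
    ((P.continuous.comp sft.continuous).tendsto g).comp (tendsto_truncate g)
  simp_rw [h1 _ (hasCompactSupport_truncate g _)] at h2
  exact tendsto_nhds_unique h2 tendsto_const_nhds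

lemma isGlauberP_iff (X : Fock →L[ℂ] Fock) (P : 𝓢'(ℂ, ℂ)) :
    IsGlauberP X P ↔
      ∀ m n : ℕ, ⟪(ket m : Fock), X (ket n)⟫_ℂ = (Real.pi : ℂ)⁻¹ * P (cohSchwartz m n) := by
  refine forall_congr' fun m => forall_congr' fun n => ⟨?_, fun h => ⟨_, fun α => rfl, h⟩⟩
  rintro ⟨f, hf, h⟩
  have : f = cohSchwartz m n := SchwartzMap.ext hf
  rw [h, this]

lemma IsGlauberP.eq {X : Fock →L[ℂ] Fock} {P P' : 𝓢'(ℂ, ℂ)} (h : IsGlauberP X P)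
    (h' : IsGlauberP X P') : P = P' := by
  rw [isGlauberP_iff] at h h'
  refine sub_eq_zero.1 (temperedDistribution_eq_zero fun m n => ?_)
  have hpi : (Real.pi : ℂ)⁻¹ ≠ 0 := inv_ne_zero (by exact_mod_cast Real.pi_ne_zero)
  change P _ - P' _ = 0
  exact sub_eq_zero.2 (mul_left_cancel₀ hpi ((h m n).symm.trans (h' m n)))

lemma IsWignerDist.isGlauberP_channelC {X : Fock →L[ℂ] Fock} {W : 𝓢'(ℂ, ℂ)}
    (hW : IsWignerDist X W) : IsGlauberP (channelC X) W := by
  rw [isGlauberP_iff]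
  intro m n
  have hpi : (Real.pi : ℂ) ≠ 0 := by exact_mod_cast Real.pi_ne_zero
  rw [(isWignerDist_iff X W).1 hW, wigner_cohForm X (cohSchwartz_apply m n),
    inv_mul_cancel_left₀ hpi]

lemma IsWignerDist.isGlauberP_channelC_iff {X : Fock →L[ℂ] Fock} {W : 𝓢'(ℂ, ℂ)}
    (hW : IsWignerDist X W) (P : 𝓢'(ℂ, ℂ)) : IsGlauberP (channelC X) P ↔ P = W :=
  ⟨fun h => h.eq hW.isGlauberP_channelC, fun h => h ▸ hW.isGlauberP_channelC⟩

lemma integrable_mul_husimi (X : Fock →L[ℂ] Fock) (f : 𝓢(ℂ, ℂ)) :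
    Integrable (fun α => f α * husimi X α) :=
  (f.integrable.norm.mul_const ‖X‖).mono'
    (f.continuous.mul (continuous_husimi X)).aestronglyMeasurable
    (Eventually.of_forall fun α => by
      rw [norm_mul]; gcongr; exact norm_husimi_le X α)

/-- The Husimi function as a tempered distribution. -/
lemma exists_husimi_distribution (X : Fock →L[ℂ] Fock) :
    ∃ Q : 𝓢'(ℂ, ℂ), ∀ f : 𝓢(ℂ, ℂ), Q f = ∫ α, f α * husimi X α := by
  refine exists_temperedDistribution (K := ‖X‖) (fun f g => ?_) (fun c f => ?_)
    (ContinuousLinearMap.id ℂ _) (fun f => ?_)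
  · rw [← integral_add (integrable_mul_husimi X f) (integrable_mul_husimi X g)]
    refine integral_congr_ae (Eventually.of_forall fun α => ?_)
    simp only [add_apply, add_mul]
  · rw [← integral_const_mul]
    refine integral_congr_ae (Eventually.of_forall fun α => ?_)
    simp only [smul_apply, smul_eq_mul, mul_assoc]
  · rw [mul_comm, ← integral_mul_const]
    refine (norm_integral_le_integral_norm _).trans (integral_mono
      (integrable_mul_husimi X f).norm (f.integrable.norm.mul_const _) fun α => ?_)
    simp only [norm_mul, ContinuousLinearMap.id_apply]
    gcongr
    exact norm_husimi_le X α

end QuantumOptics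

end

theorem proposition1 (X : QuantumOptics.Fock →L[ℂ] QuantumOptics.Fock) :
    -- every bounded operator: the equalities of distributions on the complex plane
    (∃ W : 𝓢'(ℂ, ℂ), QuantumOptics.IsWignerDist X W ∧
      ∀ P : 𝓢'(ℂ, ℂ), QuantumOptics.IsGlauberP (QuantumOptics.channelC X) P ↔ P = W) ∧
    (∃ Q : 𝓢'(ℂ, ℂ),
      (∀ f : 𝓢(ℂ, ℂ), Integrable (fun α : ℂ => f α * QuantumOptics.husimi X α) ∧
        Q f = ∫ α : ℂ, f α * QuantumOptics.husimi X α) ∧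
      QuantumOptics.IsWignerDist (QuantumOptics.channelC X) Q ∧
      ∀ P : 𝓢'(ℂ, ℂ), QuantumOptics.IsGlauberP
        (QuantumOptics.channelC (QuantumOptics.channelC X)) P ↔ P = Q) ∧
    QuantumOptics.IsGlauberPFun (QuantumOptics.channelC (QuantumOptics.channelC X))
      (QuantumOptics.husimi X) ∧
    -- trace-class operators: the pointwise equalities
    (QuantumOptics.IsTraceClass X →
      QuantumOptics.IsWignerFun (QuantumOptics.channelC X) (QuantumOptics.husimi X) ∧
      ∀ w : ℂ → ℂ, QuantumOptics.IsWignerFun X w →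
        QuantumOptics.IsGlauberPFun (QuantumOptics.channelC X) w) := by
  refine ⟨?_, ?_, QuantumOptics.isGlauberPFun_channelC_channelC X, fun hX => ?_⟩
  · obtain ⟨W, hW⟩ := QuantumOptics.exists_isWignerDist X
    exact ⟨W, hW, hW.isGlauberP_channelC_iff⟩
  · obtain ⟨Q, hQ⟩ := QuantumOptics.exists_husimi_distribution X
    have hW : QuantumOptics.IsWignerDist (QuantumOptics.channelC X) Q :=
      (QuantumOptics.isWignerDist_iff _ Q).2 fun f => by
        rw [hQ, QuantumOptics.wigner_channelC]
    -- Q is the Wigner distribution of 𝒞(X), so the first part of the theorem, applied to 𝒞(X),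
    -- makes it the only P distribution of 𝒞²(X).
    exact ⟨Q, fun f => ⟨QuantumOptics.integrable_mul_husimi X f, hQ f⟩, hW,
      hW.isGlauberP_channelC_iff⟩
  · obtain ⟨u, v, h⟩ := hX.exists_isNuclear
    exact ⟨h.isWignerFun_channelC, fun w hw => h.isGlauberPFun_channelC hw⟩
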